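/- **Setting.** For each sample size $n$ consider the linear IV model $$Y_i=D_i\beta+X_{i\cdot}^\top\varphi+Z_{i\cdot}^\top\pi+e_i,\qquad D_i=X_{i\cdot}^\top\psi+Z_{i\cdot}^\top\gamma+\varepsilon_{i2},\qquad i=1,\dots,n,$$ with $X_{i\cdot}\in\mathbb R^{p_x}$, $Z_{i\cdot}\in\mathbb R^{p_z}$, $p_z\ge 2$, $p=p_x+p_z\to\infty$ and $\gamma\ne0$; all quantities may depend on $n$. Put $W_{i\cdot}=(X_{i\cdot}^\top,Z_{i\cdot}^\top)^\top$, $\Psi=\psi\beta+\varphi$, $\Gamma=\gamma\beta+\pi$, $\varepsilon_{i1}=\varepsilon_{i2}\beta+e_i$, $\Sigma=\mathbb E(W_{i\cdot}W_{i\cdot}^\top)$, $\Omega=\Sigma^{-1}$, $\widehat\Sigma=W^\top W/n$, $A=\mathrm{diag}(Z^\top Z/n)$, $A^*=\mathrm{diag}(\mathbb E Z_{i\cdot}Z_{i\cdot}^\top)$. For a weighting matrix $B\in\{A,A^*\}$ let $\mathrm I_B(x,y)=x^\top By$, $\mathrm Q_B(x)=\mathrm I_B(x,x)$, $\beta_B=\mathrm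 I_B(\gamma,\Gamma)/\mathrm Q_B(\gamma)$, $\pi_B=\Gamma-\gamma\beta_B$; let $e_A=\varepsilon_1-\varepsilon_2\beta_A$, $Q_A=\mathrm Q_A(\pi_A)$, and $\mathrm R_{A^*}(\pi,\gamma)=\mathrm I_{A^*}(\pi,\gamma)/\sqrt{\mathrm Q_{A^*}(\pi)\mathrm Q_{A^*}(\gamma)}$ (and $0$ if a factor of the denominator is $0$). **Estimators.** $(\widehat\Psi,\widehat\Gamma)$ and $(\widehat\psi,\widehat\gamma)$ are Lasso solutions of the regressions of $Y$, resp. $D$, on $W$, i.e. minimizers of $n^{-1}\|y-W\theta\|_2^2+\lambda\|\theta\|_1$, with tuning parameters $\lambda_{1n},\lambda_{2n}$. $\widehat\Omega$ is the CLIME estimator: $\widehat\Omega^{(1)}$ has $j$-th column minimizing $\|\omega\|_1$ subject to $\|\widehat\Sigma\omega-\delta_j\|_\infty\le\mu_\omega$, and $\widehat\Omega_{jk}$ is $\widehat\Omega^{(1)}_{jk}$ if $|\widehat\Omega^{(1)}_{jk}|\le|\widehat\Omega^{(1)}_{kj}|$ and $\widehat\Omega^{(1)}_{kj}$ otherwise.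 With $\widehat u_v=\widehat\Omega(0^\top,(A v)^\top)^\top$ let $$\widehat{\mathrm Q}_A(\gamma)=\mathrm Q_A(\widehat\gamma)+\tfrac2n\widehat u_{\widehat\gamma}^\top W^\top(D-X\widehat\psi-Z\widehat\gamma),$$ $$\widehat{\mathrm I}_A(\gamma,\Gamma)=\mathrm I_A(\widehat\gamma,\widehat\Gamma)+\tfrac1n\widehat u_{\widehat\Gamma}^\top W^\top(D-X\widehat\psi-Z\widehat\gamma)+\tfrac1n\widehat u_{\widehat\gamma}^\top W^\top(Y-X\widehat\Psi-Z\widehat\Gamma),$$ $\widehat\beta_A=\widehat{\mathrm I}_A(\gamma,\Gamma)/\widehat{\mathrm Q}_A(\gamma)$ if $\widehat{\mathrm Q}_A(\gamma)>0$ and $0$ otherwise. $(\widehat\varphi_A,\widehat\pi_A)$ is a Lasso solution of the regression of $Y-D\widehat\beta_A$ on $W$ with tuning parameter $\lambda_{3n}$; $\widehat e_A=Y-D\widehat\beta_A-X\widehat\varphi_A-Z\widehat\pi_A$. The bias-corrected estimator and the Q statistic are $$\widehat Q_A=\widehat\pi_A^\top A\widehat\pi_A+\tfrac2n\widehat u_{\widehat\pi_A}^\top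 W^\top\widehat e_A,\qquad Q_n(A)=\sqrt n\,\log p\;\widehat Q_A.$$ With $\widehat A_0=A^{1/2}(I-\widehat\gamma\widehat\gamma^\top A/\widehat{\mathrm Q}_A(\gamma))$, $\widehat\Omega_z$ the last $p_z$ rows of $\widehat\Omega$ and $\widehat{\mathrm V}_A=n^{-1}\widehat A_0\widehat\Omega_z\sum_iW_{i\cdot}W_{i\cdot}^\top\widehat e_{iA}^2\,\widehat\Omega_z^\top\widehat A_0^\top$, the critical value $\mathrm{cv}_A(\alpha)$ is the $(1-\alpha)$-quantile of $\|\eta\|_\infty$, $\eta\sim N(0,\widehat{\mathrm V}_A)$ given the data. **Assumptions.** "Absolute" means not depending on $n$. 1. The triples $(W_{i\cdot},e_i,\varepsilon_{i2})$ are independent over $i$; the $W_{i\cdot}$ are identically distributed sub-Gaussian vectors: $\Pr(|v^\top W_{i\cdot}|>\mu)\le C\exp(-c\mu^2)$ for all unit vectors $v$ and all $\mu>0$; and $c_\Sigma\le\lambda_{\min}(\Sigma)\le\lambda_{\max}(\Sigma)\le C_\Sigma$. 2. $\Pr(|e_i|>\mu)$ and $\Pr(|\varepsilon_{i2}|>\mu)$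 are at most $C\exp(-c\mu^2)$ for all $\mu>0$; $\mathbb E(e_i|W_{i\cdot})=\mathbb E(\varepsilon_{i2}|W_{i\cdot})=0$; $\sigma_{\min}^2\le\mathrm{Var}(\varepsilon_{im}|W_{i\cdot})\le\sigma^2_{\max}$ and $\mathbb E(|\varepsilon_{im}|^{2+c_0}|W_{i\cdot})\le C_0$ for $m=1,2$; the conditional correlation of $\varepsilon_{i1},\varepsilon_{i2}$ given $W_{i\cdot}$ is at most $\rho_\sigma<1$ in absolute value. 3. $\Omega=(\omega_{jk})\succ0$, $\|\Omega\|_1\le m_\omega$, $\max_j\sum_k|\omega_{jk}|^q\le s_\omega$ (number of nonzero entries if $q=0$), with $0\le q<1$ fixed, $m_\omega,s_\omega\ge1$. 4. $s_\omega m_\omega^{3-2q}s^{(3-q)/2}(\log p)^{(7+\nu-q)/2}/n^{(1-q)/2}=o(1\wedge\|\gamma\|_2)$ for an absolute constant $\nu>0$, where the sequence $s$ bounds the sparsity index: $\max\{\|\varphi\|_0+\|\pi\|_0,\|\psi\|_0+\|\gamma\|_0,\|\Psi\|_0+\|\Gamma\|_0\}\le s$. 5. $\lambda_{\ell n}=C_\ell\sqrt{\log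 p/n}$ with constants $C_\ell\ge C_\lambda$ ($\ell=1,2$), and $\mu_\omega=C_\omega\sqrt{\log p/n}$ with a constant $C_\omega$; $C_\lambda$ and $C_\omega$ are sufficiently large, depending only on the absolute constants in 1 and 2. 6. $\lambda_{3n}=C_3\sqrt{\log p/n}$ with a constant $C_3$ (not depending on $n$) such that $C_3\ge C_\lambda(1+\|\pi\|_2/\|\gamma\|_2)$ for all $n$. **Theorem.** Under Assumptions 1–6, $$\widehat Q_A=Q_A+\Delta_Q+\frac{u_{\pi_A}^\top W^\top e_A}{n},\qquad u_{\pi_A}=(0_{p_x}^\top,(A\pi_A)^\top)^\top,\qquad |\Delta_Q|=o_p\!\left(\frac{1+\sqrt n\,\|\pi_{A^*}\|_2^2}{\sqrt n\,\log p}\right).$$ Moreover: (a) If $\pi=0$ (for every $n$), then $Q_n(A)\to0$ in probability, and $\Pr(Q_n(A)>\mathrm{cv}_A(\alpha))\to0$ for every $\alpha\in(0,1)$. (b) If $\|\pi_{A^*}\|_2\gtrsim n^{-1/4}$, then $Q_n(A)-c\sqrt{\log p}\to\infty$ in probability for every constant $c$. For all $\alpha,c_r\in(0,1)$ and $\epsilon>0$,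 $\inf_\pi\Pr(Q_n(A)>\mathrm{cv}_A(\alpha))\to1$, where all other parameters are given and the infimum is over all $\pi$ in $\mathcal H_Q(\epsilon)=\{\pi:\|\pi_{A^*}\|_2=\epsilon n^{-1/4},\ |\mathrm R_{A^*}(\pi,\gamma)|\le c_r\}$ that satisfy Assumptions 4 and 6 with the given $s$ and $C_3$. -/

import Mathlib

open MeasureTheory ProbabilityTheory Filter Topology Matrix

universe u

noncomputable section

namespace IVTest

/-! ### Norms and quadratic forms -/

/-- Euclidean norm of a vector. -/
def l2norm {κ : Type} [Fintype κ] (v : κ → ℝ) : ℝ := Real.sqrt (∑ j, v j ^ 2)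

/-- `L₁` norm of a vector. -/
def l1norm {κ : Type} [Fintype κ] (v : κ → ℝ) : ℝ := ∑ j, |v j|

/-- Number of nonzero entries of a vector. -/
def l0norm {κ : Type} [Fintype κ] (v : κ → ℝ) : ℕ := Nat.card {j : κ // v j ≠ 0}

/-- `I_A(x, y) = xᵀ A y`. -/
def bil {κ : Type} [Fintype κ] (A : Matrix κ κ ℝ) (x y : κ → ℝ) : ℝ := x ⬝ᵥ (A *ᵥ y)

/-- `Q_A(x) = xᵀ A x`. -/
def quad {κ : Type} [Fintype κ] (A : Matrix κ κ ℝ) (x : κ → ℝ) : ℝ := bil A x x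

/-- Column index of the design matrix `W = [X, Z]`: `Sum.inl` for the covariates `X`,
`Sum.inr` for the instruments `Z`. -/
abbrev Idx (px pz : ℕ) : Type := Fin px ⊕ Fin pz

/-- The vector `(0ᵀ, vᵀ)ᵀ`, with zeros in the covariate block. -/
def emb {px pz : ℕ} (v : Fin pz → ℝ) : Idx px pz → ℝ := Sum.elim (fun _ => 0) v

/-! ### Observed data, Lasso, CLIME -/

/-- An observed sample of size `n`: outcome `Y`, endogenous variable `D`, design `W = [X, Z]`. -/
structure Data (n px pz : ℕ) where
  Y : Fin n → ℝ
  D : Fin n → ℝ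
  W : Matrix (Fin n) (Idx px pz) ℝ

/-- Lasso objective `n⁻¹ ‖y - W θ‖₂² + lam ‖θ‖₁`. -/
def lassoObj {n px pz : ℕ} (y : Fin n → ℝ) (W : Matrix (Fin n) (Idx px pz) ℝ) (lam : ℝ)
    (θ : Idx px pz → ℝ) : ℝ :=
  (1 / (n : ℝ)) * ∑ i, (y i - (W *ᵥ θ) i) ^ 2 + lam * l1norm θ

/-- `θ` is a Lasso solution. -/
def IsLasso {n px pz : ℕ} (y : Fin n → ℝ) (W : Matrix (Fin n) (Idx px pz) ℝ) (lam : ℝ)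
    (θ : Idx px pz → ℝ) : Prop :=
  ∀ θ', lassoObj y W lam θ ≤ lassoObj y W lam θ'

/-- The empirical Gram matrix `n⁻¹ Wᵀ W`. -/
def gram {n px pz : ℕ} (W : Matrix (Fin n) (Idx px pz) ℝ) :
    Matrix (Idx px pz) (Idx px pz) ℝ :=
  (1 / (n : ℝ)) • (Wᵀ * W)

/-- The constraint `‖S w - δ_j‖_∞ ≤ μ`. -/
def ClimeFeasible {κ : Type} [Fintype κ] [DecidableEq κ] (S : Matrix κ κ ℝ) (μ : ℝ) (j : κ)
    (w : κ → ℝ) : Prop :=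
  ∀ k, |(S *ᵥ w) k - (Pi.single j 1 : κ → ℝ) k| ≤ μ

/-- `w` minimizes `‖w‖₁` under the constraint `‖S w - δ_j‖_∞ ≤ μ`
(no requirement when the constraint cannot be met by any vector). -/
def IsClimeColumn {κ : Type} [Fintype κ] [DecidableEq κ] (S : Matrix κ κ ℝ) (μ : ℝ) (j : κ)
    (w : κ → ℝ) : Prop :=
  (∃ w', ClimeFeasible S μ j w') →
    ClimeFeasible S μ j w ∧ ∀ w', ClimeFeasible S μ j w' → l1norm w ≤ l1norm w'

/-- Symmetrization step of CLIME: of the two entries `(j,k)` and `(k,j)`, keep the one of smaller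
absolute value. -/
def climeSym {κ : Type} (M : Matrix κ κ ℝ) : Matrix κ κ ℝ :=
  Matrix.of fun j k => if |M j k| ≤ |M k j| then M j k else M k j

/-- The solutions of the optimization problems: `thY = (Ψ̂, Γ̂)`, `thD = (ψ̂, γ̂)`, the
unsymmetrized CLIME matrix `Om1`, and `thA = (φ̂_A, π̂_A)`. -/
structure Estimates (px pz : ℕ) where
  thY : Idx px pz → ℝ
  thD : Idx px pz → ℝ
  Om1 : Matrix (Idx px pz) (Idx px pz) ℝ
  thA : Idx px pz → ℝ

/-! ### Statistics -/

section Stats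

/-- `σ̂²_{jz} = n⁻¹ ∑ᵢ Z_{ij}²`. -/
def zVar {n px pz : ℕ} (W : Matrix (Fin n) (Idx px pz) ℝ) (j : Fin pz) : ℝ :=
  (1 / (n : ℝ)) * ∑ i, W i (Sum.inr j) ^ 2

/-- The weighting matrix `A = diag(Zᵀ Z / n)`. -/
def weightA {n px pz : ℕ} (W : Matrix (Fin n) (Idx px pz) ℝ) : Matrix (Fin pz) (Fin pz) ℝ :=
  Matrix.diagonal (zVar W)

/-- `A^{1/2}`. -/
def sqrtA {n px pz : ℕ} (W : Matrix (Fin n) (Idx px pz) ℝ) : Matrix (Fin pz) (Fin pz) ℝ :=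
  Matrix.diagonal fun j => Real.sqrt (zVar W j)

/-- The CLIME estimator `Ω̂`. -/
def OmHat {px pz : ℕ} (E : Estimates px pz) : Matrix (Idx px pz) (Idx px pz) ℝ := climeSym E.Om1

/-- `γ̂`. -/
def gamHat {px pz : ℕ} (E : Estimates px pz) : Fin pz → ℝ := fun j => E.thD (Sum.inr j)

/-- `Γ̂`. -/
def GamHat {px pz : ℕ} (E : Estimates px pz) : Fin pz → ℝ := fun j => E.thY (Sum.inr j)

/-- `π̂_A`. -/
def piHat {px pz : ℕ} (E : Estimates px pz) : Fin pz → ℝ := fun j => E.thA (Sum.inr j)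

/-- Projection direction `û = Ω̂ (0ᵀ, (A v)ᵀ)ᵀ`, for `v = γ̂, Γ̂, π̂_A`. -/
def uHat {n px pz : ℕ} (d : Data n px pz) (E : Estimates px pz) (v : Fin pz → ℝ) :
    Idx px pz → ℝ :=
  OmHat E *ᵥ emb (weightA d.W *ᵥ v)

/-- Debiased estimator of `Q_A(γ)`. -/
def QgamHat {n px pz : ℕ} (d : Data n px pz) (E : Estimates px pz) : ℝ :=
  quad (weightA d.W) (gamHat E) +
    (2 / (n : ℝ)) * (uHat d E (gamHat E) ⬝ᵥ (d.Wᵀ *ᵥ (d.D - d.W *ᵥ E.thD)))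

/-- Debiased estimator of `I_A(γ, Γ)`. -/
def IHat {n px pz : ℕ} (d : Data n px pz) (E : Estimates px pz) : ℝ :=
  bil (weightA d.W) (gamHat E) (GamHat E) +
    (1 / (n : ℝ)) * (uHat d E (GamHat E) ⬝ᵥ (d.Wᵀ *ᵥ (d.D - d.W *ᵥ E.thD))) +
    (1 / (n : ℝ)) * (uHat d E (gamHat E) ⬝ᵥ (d.Wᵀ *ᵥ (d.Y - d.W *ᵥ E.thY)))

open Classical in
/-- `β̂_A`. -/
def betaHat {n px pz : ℕ} (d : Data n px pz) (E : Estimates px pz) : ℝ :=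
  if 0 < QgamHat d E then IHat d E / QgamHat d E else 0

/-- Residuals `ê_A = Y - D β̂_A - X φ̂_A - Z π̂_A`. -/
def resid {n px pz : ℕ} (d : Data n px pz) (E : Estimates px pz) : Fin n → ℝ :=
  d.Y - betaHat d E • d.D - d.W *ᵥ E.thA

/-- The bias-corrected quadratic estimator `Q̂_A`. -/
def QHat {n px pz : ℕ} (d : Data n px pz) (E : Estimates px pz) : ℝ :=
  quad (weightA d.W) (piHat E) +
    (2 / (n : ℝ)) * (uHat d E (piHat E) ⬝ᵥ (d.Wᵀ *ᵥ resid d E))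

/-- The Q statistic `Q_n(A) = √n · log p · Q̂_A`. -/
def Qstat {n px pz : ℕ} (d : Data n px pz) (E : Estimates px pz) : ℝ :=
  Real.sqrt n * Real.log ((px + pz : ℕ) : ℝ) * QHat d E

/-- `Â₀ = A^{1/2} (I - γ̂ γ̂ᵀ A / Q̂_A(γ))`. -/
def A0Hat {n px pz : ℕ} (d : Data n px pz) (E : Estimates px pz) : Matrix (Fin pz) (Fin pz) ℝ :=
  sqrtA d.W *
    (1 - (1 / QgamHat d E) • (Matrix.vecMulVec (gamHat E) (gamHat E) * weightA d.W))

/-- `Ω̂_z`: the last `p_z` rows of `Ω̂`. -/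
def OmHatZ {px pz : ℕ} (E : Estimates px pz) : Matrix (Fin pz) (Idx px pz) ℝ :=
  (OmHat E).submatrix Sum.inr id

/-- `V̂_A = n⁻¹ Â₀ Ω̂_z (∑ᵢ Wᵢ Wᵢᵀ ê_{iA}²) Ω̂_zᵀ Â₀ᵀ`. -/
def VHat {n px pz : ℕ} (d : Data n px pz) (E : Estimates px pz) : Matrix (Fin pz) (Fin pz) ℝ :=
  (1 / (n : ℝ)) •
    (A0Hat d E * OmHatZ E *
      (∑ i, (resid d E i) ^ 2 • Matrix.vecMulVec (d.W i) (d.W i)) *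
      (OmHatZ E)ᵀ * (A0Hat d E)ᵀ)

/-- The critical value: the `1 - α` quantile of `‖η‖_∞` for `η ∼ N(0, V̂_A)`. -/
def cv {n px pz : ℕ} (d : Data n px pz) (E : Estimates px pz) (α : ℝ) : ℝ :=
  sInf {x : ℝ | 1 - α ≤
    (multivariateGaussian 0 (VHat d E)).real
      {η : EuclideanSpace ℝ (Fin pz) | ‖WithLp.ofLp η‖ ≤ x}}

/-- `E` solves the optimization problems of the procedure on the data `d`, with Lasso tuning
parameters `lam1`, `lam2`, `lam3` and CLIME tuning parameter `μ`. -/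
structure IsEstimates {n px pz : ℕ} (lam1 lam2 lam3 μ : ℝ) (d : Data n px pz)
    (E : Estimates px pz) : Prop where
  lassoY : IsLasso d.Y d.W lam1 E.thY
  lassoD : IsLasso d.D d.W lam2 E.thD
  clime : ∀ j, IsClimeColumn (gram d.W) μ j (fun k => E.Om1 k j)
  lassoA : IsLasso (d.Y - betaHat d E • d.D) d.W lam3 E.thA

end Stats

/-! ### The model -/

/-- All constituents of the linear IV model at sample size `n` except the vector `π` of direct
effects of the instruments: dimensions, sample space, rows `W_i = (X_i, Z_i)` with their
common law, errors `e_i` and `ε_{i2}`, and the parameters `β, φ, ψ, γ`. -/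
structure Design (n : ℕ) where
  px : ℕ
  pz : ℕ
  S : Type u
  mS : MeasurableSpace S
  P : Measure S
  isProb : IsProbabilityMeasure P
  law : Measure (Idx px pz → ℝ)
  W : Fin n → S → Idx px pz → ℝ
  e : Fin n → S → ℝ
  eps2 : Fin n → S → ℝ
  β : ℝ
  φ : Fin px → ℝ
  ψ : Fin px → ℝ
  γ : Fin pz → ℝ

attribute [instance] Design.mS Design.isProb

namespace Design

/-- `p = p_x + p_z`. -/
def p {n : ℕ} (M : Design.{u} n) : ℕ := M.px + M.pz

/-- The tuning rate `√(log p / n)`. -/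
def rate {n : ℕ} (M : Design.{u} n) : ℝ := Real.sqrt (Real.log (M.p : ℝ) / n)

/-- Reduced-form error `ε_{i1} = ε_{i2} β + e_i`. -/
def eps1 {n : ℕ} (M : Design.{u} n) (i : Fin n) (ω : M.S) : ℝ := M.eps2 i ω * M.β + M.e i ω

/-- `D_i = X_iᵀ ψ + Z_iᵀ γ + ε_{i2}`. -/
def D {n : ℕ} (M : Design.{u} n) (ω : M.S) (i : Fin n) : ℝ :=
  M.W i ω ⬝ᵥ Sum.elim M.ψ M.γ + M.eps2 i ω

/-- `Y_i = D_i β + X_iᵀ φ + Z_iᵀ π + e_i`. -/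
def Y {n : ℕ} (M : Design.{u} n) (π : Fin M.pz → ℝ) (ω : M.S) (i : Fin n) : ℝ :=
  M.D ω i * M.β + M.W i ω ⬝ᵥ Sum.elim M.φ π + M.e i ω

/-- The observed sample when the direct effects are `π`. -/
def data {n : ℕ} (M : Design.{u} n) (π : Fin M.pz → ℝ) (ω : M.S) : Data n M.px M.pz where
  Y := M.Y π ω
  D := M.D ω
  W := Matrix.of fun i => M.W i ω

/-- `A = diag(Zᵀ Z / n)`. -/
def A {n : ℕ} (M : Design.{u} n) (ω : M.S) : Matrix (Fin M.pz) (Fin M.pz) ℝ :=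
  weightA (Matrix.of fun i => M.W i ω)

/-- `Σ = E(W_i W_iᵀ)`. -/
def Sig {n : ℕ} (M : Design.{u} n) : Matrix (Idx M.px M.pz) (Idx M.px M.pz) ℝ :=
  Matrix.of fun j k => ∫ w, w j * w k ∂M.law

/-- `Ω = Σ⁻¹`. -/
def Om {n : ℕ} (M : Design.{u} n) : Matrix (Idx M.px M.pz) (Idx M.px M.pz) ℝ := (M.Sig)⁻¹

/-- `A* = diag(E(Z_i Z_iᵀ))`. -/
def Astar {n : ℕ} (M : Design.{u} n) : Matrix (Fin M.pz) (Fin M.pz) ℝ :=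
  Matrix.diagonal fun j => ∫ w, w (Sum.inr j) ^ 2 ∂M.law

/-- `Γ = γ β + π`. -/
def Gam {n : ℕ} (M : Design.{u} n) (π : Fin M.pz → ℝ) : Fin M.pz → ℝ := M.β • M.γ + π

/-- `β_B = I_B(γ, Γ) / Q_B(γ)` for a weighting matrix `B` (`A` or `A*`). -/
def betaOf {n : ℕ} (M : Design.{u} n) (B : Matrix (Fin M.pz) (Fin M.pz) ℝ)
    (π : Fin M.pz → ℝ) : ℝ :=
  bil B M.γ (M.Gam π) / quad B M.γ

/-- `π_B = Γ - γ β_B = π - γ (β_B - β)` for a weighting matrix `B` (`A` or `A*`). -/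
def piOf {n : ℕ} (M : Design.{u} n) (B : Matrix (Fin M.pz) (Fin M.pz) ℝ)
    (π : Fin M.pz → ℝ) : Fin M.pz → ℝ :=
  M.Gam π - M.betaOf B π • M.γ

/-- `π_{A*}`. -/
def piStar {n : ℕ} (M : Design.{u} n) (π : Fin M.pz → ℝ) : Fin M.pz → ℝ := M.piOf M.Astar π

/-- `e_A = ε₁ - ε₂ β_A`. -/
def eA {n : ℕ} (M : Design.{u} n) (π : Fin M.pz → ℝ) (ω : M.S) (i : Fin n) : ℝ :=
  M.eps1 i ω - M.eps2 i ω * M.betaOf (M.A ω) π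

/-- `Q_A = Q_A(π_A)`. -/
def QA {n : ℕ} (M : Design.{u} n) (π : Fin M.pz → ℝ) (ω : M.S) : ℝ :=
  quad (M.A ω) (M.piOf (M.A ω) π)

/-- The linear term `u_{π_A}ᵀ Wᵀ e_A / n` with `u_{π_A} = (0ᵀ, (A π_A)ᵀ)ᵀ`. -/
def linTerm {n : ℕ} (M : Design.{u} n) (π : Fin M.pz → ℝ) (ω : M.S) : ℝ :=
  (emb (M.A ω *ᵥ M.piOf (M.A ω) π) ⬝ᵥ
    ((Matrix.of fun i => M.W i ω : Matrix (Fin n) (Idx M.px M.pz) ℝ)ᵀ *ᵥ M.eA π ω)) / n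

open Classical in
/-- Relatedness `R_{A*}(π, γ)`. -/
def Rstar {n : ℕ} (M : Design.{u} n) (π : Fin M.pz → ℝ) : ℝ :=
  if 0 < quad M.Astar π ∧ 0 < quad M.Astar M.γ then
    bil M.Astar π M.γ / Real.sqrt (quad M.Astar π * quad M.Astar M.γ) else 0

/-- The alternative set `H_Q(t)` with relatedness bound `cr`. -/
def HQ {n : ℕ} (M : Design.{u} n) (cr t : ℝ) : Set (Fin M.pz → ℝ) :=
  {π | l2norm (M.piStar π) = t * (n : ℝ) ^ (-(1 / 4 : ℝ)) ∧ |M.Rstar π| ≤ cr}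

/-- The sparsity index
`s = max{‖φ‖₀ + ‖π‖₀, ‖ψ‖₀ + ‖γ‖₀, ‖Ψ‖₀ + ‖Γ‖₀}` with `Ψ = ψ β + φ`. -/
def sparsity {n : ℕ} (M : Design.{u} n) (π : Fin M.pz → ℝ) : ℕ :=
  max (l0norm M.φ + l0norm π)
    (max (l0norm M.ψ + l0norm M.γ) (l0norm (M.β • M.ψ + M.φ) + l0norm (M.Gam π)))

/-- The `σ`-algebra generated by the row `W_i`. -/
abbrev sigW {n : ℕ} (M : Design.{u} n) (i : Fin n) : MeasurableSpace M.S :=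
  MeasurableSpace.comap (M.W i) inferInstance

/-- `σ_{i12} = cov(ε_{i1}, ε_{i2} | W_i)`. -/
def sigma12 {n : ℕ} (M : Design.{u} n) (i : Fin n) : M.S → ℝ :=
  M.P[(M.eps1 i - M.P[M.eps1 i | M.sigW i]) * (M.eps2 i - M.P[M.eps2 i | M.sigW i]) | M.sigW i]

end Design

/-! ### Assumptions -/

/-- The absolute constants of the distributional assumptions. -/
structure Constants where
  c : ℝ
  C : ℝ
  cSig : ℝ
  CSig : ℝ
  sigMin : ℝ
  sigMax : ℝ
  c0 : ℝ
  C0 : ℝ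
  rho : ℝ
  c_pos : 0 < c
  C_pos : 0 < C
  cSig_pos : 0 < cSig
  cSig_le : cSig ≤ CSig
  sigMin_pos : 0 < sigMin
  sigMin_le : sigMin ≤ sigMax
  c0_pos : 0 < c0
  C0_pos : 0 < C0
  rho_lt : rho < 1

/-- The observations are independent across `i`. -/
def Independent {n : ℕ} (M : Design.{u} n) : Prop :=
  iIndepFun (fun i ω => (M.W i ω, (M.e i ω, M.eps2 i ω))) M.P

/-- The rows `W_i` are identically distributed sub-Gaussian vectors, and the eigenvalues of
`Σ = E(W_i W_iᵀ)` lie in `[c_Σ, C_Σ]`. -/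
structure DesignAssumption (K : Constants) {n : ℕ} (M : Design.{u} n) : Prop where
  meas : ∀ i, Measurable (M.W i)
  identDistrib : ∀ i, M.P.map (M.W i) = M.law
  subGaussian : ∀ i, ∀ v : Idx M.px M.pz → ℝ, l2norm v = 1 → ∀ t : ℝ, 0 < t →
    M.P.real {ω | t < |v ⬝ᵥ M.W i ω|} ≤ K.C * Real.exp (-K.c * t ^ 2)
  eigen_lower : ∀ v, K.cSig * l2norm v ^ 2 ≤ quad M.Sig v
  eigen_upper : ∀ v, quad M.Sig v ≤ K.CSig * l2norm v ^ 2

/-- Sub-Gaussian, conditionally centered errors, with conditional variances bounded from above and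
away from zero, bounded conditional moments of order `2 + c₀`, and conditional correlation of
`ε_{i1}, ε_{i2}` bounded by `ρ < 1`. -/
structure ErrorAssumption (K : Constants) {n : ℕ} (M : Design.{u} n) : Prop where
  meas_e : ∀ i, Measurable (M.e i)
  meas_eps2 : ∀ i, Measurable (M.eps2 i)
  tail_e : ∀ i, ∀ t : ℝ, 0 < t →
    M.P.real {ω | t < |M.e i ω|} ≤ K.C * Real.exp (-K.c * t ^ 2)
  tail_eps2 : ∀ i, ∀ t : ℝ, 0 < t →
    M.P.real {ω | t < |M.eps2 i ω|} ≤ K.C * Real.exp (-K.c * t ^ 2)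
  mean_e : ∀ i, M.P[M.e i | M.sigW i] =ᵐ[M.P] 0
  mean_eps2 : ∀ i, M.P[M.eps2 i | M.sigW i] =ᵐ[M.P] 0
  var1 : ∀ i, ∀ᵐ ω ∂M.P, K.sigMin ≤ condVar (M.sigW i) (M.eps1 i) M.P ω ∧
    condVar (M.sigW i) (M.eps1 i) M.P ω ≤ K.sigMax
  var2 : ∀ i, ∀ᵐ ω ∂M.P, K.sigMin ≤ condVar (M.sigW i) (M.eps2 i) M.P ω ∧
    condVar (M.sigW i) (M.eps2 i) M.P ω ≤ K.sigMax
  moment1 : ∀ i, ∀ᵐ ω ∂M.P,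
    (M.P[fun ω' => |M.eps1 i ω'| ^ (2 + K.c0) | M.sigW i]) ω ≤ K.C0
  moment2 : ∀ i, ∀ᵐ ω ∂M.P,
    (M.P[fun ω' => |M.eps2 i ω'| ^ (2 + K.c0) | M.sigW i]) ω ≤ K.C0
  corr : ∀ i, ∀ᵐ ω ∂M.P, |M.sigma12 i ω| /
    (Real.sqrt (condVar (M.sigW i) (M.eps1 i) M.P ω) *
      Real.sqrt (condVar (M.sigW i) (M.eps2 i) M.P ω)) ≤ K.rho

open Classical in
/-- The class `U(m, q, s)` of precision matrices. For `q = 0` the `L_q` sum counts the nonzero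
entries. -/
def PrecisionClass {κ : Type} [Fintype κ] (m q s : ℝ) (Om : Matrix κ κ ℝ) : Prop :=
  Om.PosDef ∧ (∀ k, ∑ j, |Om j k| ≤ m) ∧
    ∀ j, ∑ k, (if Om j k = 0 then 0 else |Om j k| ^ q) ≤ s

/-- The sequence of models satisfies the distributional assumptions, the precision-matrix
condition, and the rate condition
`s_ω m_ω^{3-2q} s^{(3-q)/2} (log p)^{(7+ν-q)/2} / n^{(1-q)/2} = o(1 ∧ ‖γ‖₂)`,
with `p → ∞`, `γ ≠ 0` and more than one instrument. -/
structure StandingAssumptions (K : Constants) (q ν : ℝ) (M : ∀ n, Design.{u} n)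
    (m_om s_om : ℕ → ℝ) (s : ℕ → ℕ) : Prop where
  indep : ∀ n, Independent (M n)
  design : ∀ n, DesignAssumption K (M n)
  error : ∀ n, ErrorAssumption K (M n)
  one_le_m : ∀ n, 1 ≤ m_om n
  one_le_s : ∀ n, 1 ≤ s_om n
  precision : ∀ n, PrecisionClass (m_om n) q (s_om n) (M n).Om
  two_le_pz : ∀ n, 2 ≤ (M n).pz
  gam_ne : ∀ n, (M n).γ ≠ 0
  p_tendsto : Tendsto (fun n => (M n).p) atTop atTop
  rates : (fun n : ℕ => s_om n * m_om n ^ (3 - 2 * q) * (s n : ℝ) ^ ((3 - q) / 2) *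
      Real.log ((M n).p : ℝ) ^ ((7 + ν - q) / 2) / (n : ℝ) ^ ((1 - q) / 2))
    =o[atTop] fun n => min 1 (l2norm (M n).γ)

/-- The conditions on `π` at one sample size: the sparsity index is at most `s`, and the Lasso
constant `C₃` dominates `C_lam (1 + ‖π‖₂ / ‖γ‖₂)`. -/
def Admissible {n : ℕ} (M : Design.{u} n) (s : ℕ) (Clam C3 : ℝ) (π : Fin M.pz → ℝ) : Prop :=
  M.sparsity π ≤ s ∧ Clam * (1 + l2norm π / l2norm M.γ) ≤ C3

/-- `X_n = o_p(a_n)`. -/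
def IsLittleOP (M : ∀ n, Design.{u} n) (X : ∀ n, (M n).S → ℝ) (a : ℕ → ℝ) : Prop :=
  ∀ δ : ℝ, 0 < δ → Tendsto (fun n => (M n).P {ω | δ * a n < |X n ω|}) atTop (𝓝 0)

/-- `X_n → ∞` in probability. -/
def TendstoInfinityInProb (M : ∀ n, Design.{u} n) (X : ∀ n, (M n).S → ℝ) : Prop :=
  ∀ B : ℝ, Tendsto (fun n => (M n).P {ω | X n ω ≤ B}) atTop (𝓝 0)

end IVTest

end

namespace IVTest

/-! ### Vector norms -/

section Norms

variable {κ : Type} [Fintype κ]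

/-! The argument is deterministic on one event that does not involve `π`. On `GoodEvent` every
empirical average of a product of four features of an observation (coordinates of `W_i`, coordinates
of `Ωᵀ W_i`, the two errors, the constant `1`) is within `τ √(log p / n)` of its mean. These
products have tails of order `exp (-c √t)`. Truncation, a Chernoff bound and a union bound over at
most `(5p)⁴` products make the event likely once `(log p)⁷ ≤ n` (`exists_goodEvent_bound`,
`tendsto_bad_bound`). `Setup` records what holds there. `exists_deviation_constants` turns every
consequence of `Setup` into a probability bound uniform over admissible `π`, which is what the
infimum in (b) needs.

On the event write `x = m_ω √s √(log p / n)`. The Lasso errors are of order `√s √(log p / n)` in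
`ℓ₂` and `s √(log p / n)` in `ℓ₁`, and the Lasso scores are at most half the tuning parameter. CLIME
has row and column sums at most `m_ω`, because `Ω` itself is feasible. A bias correction is
therefore at most `‖Ω̂‖₁ ‖A v‖₁` times the largest score (`Setup.abs_correction_le`), and this crude
bound is enough: no cancellation is used. It gives `|β̂_A - β_A| ‖γ‖ ≲ x` (`exists_betaHat_bounds`),
then `|Q̂_A - Q_A| ≲ x ‖π_{A*}‖ + x²`, while the linear term is itself `≲ x ‖π_{A*}‖`
(`exists_QHat_bounds`). The rate condition makes `√n (log p)² x²` small, and an arithmetic-geometric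
mean inequality bounds `√n log p (x P + x²)` by a small multiple of `1 + √n P²`
(`Setup.scaled_error_le`). This is the decomposition.

For the test, the diagonal of `V̂_A` is bounded and one diagonal entry stays away from zero
(`exists_VHat_bounds`). Hence the critical value lies between a positive constant (small-ball bound
for one Gaussian coordinate) and a multiple of `√(log p)` (union bound). If `π = 0` then `Q_A = 0`,
the statistic tends to zero and stays below the critical value. If `‖π_{A*}‖ ≳ n^{-1/4}` then `Q_A ≳
‖π_{A*}‖²` makes the statistic at least of order `log p`, which exceeds every multiple of `√(log
p)`. -/

theorem l2norm_eq_norm (v : κ → ℝ) : l2norm v = ‖WithLp.toLp 2 v‖ := by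
  rw [EuclideanSpace.norm_eq]; simp [l2norm]

theorem l2norm_nonneg (v : κ → ℝ) : 0 ≤ l2norm v := Real.sqrt_nonneg _

theorem l1norm_nonneg (v : κ → ℝ) : 0 ≤ l1norm v := Finset.sum_nonneg fun _ _ => abs_nonneg _

theorem l2norm_sq (v : κ → ℝ) : l2norm v ^ 2 = ∑ j, v j ^ 2 :=
  Real.sq_sqrt (Finset.sum_nonneg fun _ _ => sq_nonneg _)

theorem l2norm_sq_eq_dotProduct (v : κ → ℝ) : l2norm v ^ 2 = v ⬝ᵥ v := by
  rw [l2norm_sq, dotProduct]; simp only [sq]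

theorem l2norm_add_le (u v : κ → ℝ) : l2norm (u + v) ≤ l2norm u + l2norm v := by
  simp only [l2norm_eq_norm, WithLp.toLp_add]; exact norm_add_le _ _

theorem l2norm_sub_le (u v : κ → ℝ) : l2norm (u - v) ≤ l2norm u + l2norm v := by
  simp only [l2norm_eq_norm, WithLp.toLp_sub]; exact norm_sub_le _ _

theorem l2norm_smul (c : ℝ) (v : κ → ℝ) : l2norm (c • v) = |c| * l2norm v := by
  simp only [l2norm_eq_norm, WithLp.toLp_smul, norm_smul, Real.norm_eq_abs]

theorem l2norm_pos {v : κ → ℝ} (h : v ≠ 0) : 0 < l2norm v := by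
  rw [l2norm_eq_norm, norm_pos_iff]; simpa using h

theorem l1norm_add_le (u v : κ → ℝ) : l1norm (u + v) ≤ l1norm u + l1norm v := by
  simp only [l1norm, ← Finset.sum_add_distrib]
  exact Finset.sum_le_sum fun j _ => abs_add_le _ _

theorem l1norm_sub_le (u v : κ → ℝ) : l1norm (u - v) ≤ l1norm u + l1norm v := by
  simp only [l1norm, ← Finset.sum_add_distrib]
  exact Finset.sum_le_sum fun j _ => abs_sub _ _

theorem l1norm_smul (c : ℝ) (v : κ → ℝ) : l1norm (c • v) = |c| * l1norm v := by
  simp [l1norm, Finset.mul_sum, abs_mul]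

theorem abs_apply_le_l2norm (v : κ → ℝ) (j : κ) : |v j| ≤ l2norm v := by
  refine Real.abs_le_sqrt ?_
  exact Finset.single_le_sum (f := fun j => v j ^ 2) (fun _ _ => sq_nonneg _) (Finset.mem_univ j)

theorem abs_dotProduct_le_l2norm (u v : κ → ℝ) : |u ⬝ᵥ v| ≤ l2norm u * l2norm v := by
  rw [← Real.sqrt_sq_eq_abs, l2norm, l2norm, ← Real.sqrt_mul (Finset.sum_nonneg fun _ _ => sq_nonneg _)]
  exact Real.sqrt_le_sqrt (Finset.sum_mul_sq_le_sq_mul_sq _ _ _)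

theorem abs_dotProduct_le_l1norm {u v : κ → ℝ} {B : ℝ} (h : ∀ j, |v j| ≤ B) :
    |u ⬝ᵥ v| ≤ l1norm u * B := by
  rw [dotProduct, l1norm, Finset.sum_mul]
  refine (Finset.abs_sum_le_sum_abs _ _).trans (Finset.sum_le_sum fun j _ => ?_)
  rw [abs_mul]
  exact mul_le_mul_of_nonneg_left (h j) (abs_nonneg _)

theorem l2norm_sq_le_mul_l1norm {v : κ → ℝ} {B : ℝ} (h : ∀ j, |v j| ≤ B) :
    l2norm v ^ 2 ≤ l1norm v * B := by
  rw [l2norm_sq_eq_dotProduct]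
  exact (le_abs_self _).trans (abs_dotProduct_le_l1norm h)

theorem l1norm_le_sqrt_card_mul (s : Finset κ) (v : κ → ℝ) :
    ∑ j ∈ s, |v j| ≤ Real.sqrt s.card * l2norm v := by
  rw [l2norm, ← Real.sqrt_mul (Nat.cast_nonneg _)]
  refine Real.le_sqrt_of_sq_le ?_
  refine (sq_sum_le_card_mul_sum_sq (s := s) (f := fun j => |v j|)).trans ?_
  simp only [sq_abs]
  exact mul_le_mul_of_nonneg_left
    (Finset.sum_le_sum_of_subset_of_nonneg (Finset.subset_univ _) fun _ _ _ => sq_nonneg _)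
    (Nat.cast_nonneg _)

theorem l0norm_eq_card [DecidableEq κ] (v : κ → ℝ) :
    l0norm v = (Finset.univ.filter fun j => v j ≠ 0).card := by
  classical
  rw [l0norm, Nat.card_eq_fintype_card, Fintype.card_subtype]

theorem l1norm_le_sqrt_l0norm_mul (v : κ → ℝ) :
    l1norm v ≤ Real.sqrt (l0norm v) * l2norm v := by
  classical
  rw [l0norm_eq_card]
  refine le_trans (le_of_eq ?_) (l1norm_le_sqrt_card_mul _ v)
  rw [l1norm, Finset.sum_filter]
  refine Finset.sum_congr rfl fun j _ => ?_
  by_cases h : v j = 0 <;> simp [h]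

theorem l0norm_add_le (u v : κ → ℝ) : l0norm (u + v) ≤ l0norm u + l0norm v := by
  classical
  simp only [l0norm_eq_card]
  refine le_trans (Finset.card_le_card ?_) (Finset.card_union_le _ _)
  intro j hj
  simp only [Finset.mem_filter, Finset.mem_univ, true_and, Finset.mem_union, Pi.add_apply] at *
  by_contra h
  push Not at h
  exact hj (by rw [h.1, h.2, add_zero])

theorem l0norm_smul_le (c : ℝ) (v : κ → ℝ) : l0norm (c • v) ≤ l0norm v := by
  classical
  simp only [l0norm_eq_card]
  refine Finset.card_le_card fun j hj => ?_
  simp only [Finset.mem_filter, Finset.mem_univ, true_and, Pi.smul_apply, smul_eq_mul] at *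
  exact fun h => hj (by rw [h, mul_zero])

theorem l0norm_sub_smul_le (u v : κ → ℝ) (c : ℝ) :
    l0norm (u - c • v) ≤ l0norm u + l0norm v := by
  rw [sub_eq_add_neg, ← neg_smul]
  exact (l0norm_add_le _ _).trans (Nat.add_le_add_left (l0norm_smul_le _ _) _)

theorem l0norm_pos {v : κ → ℝ} (h : v ≠ 0) : 0 < l0norm v := by
  classical
  rw [l0norm_eq_card, Finset.card_pos]
  obtain ⟨j, hj⟩ := Function.ne_iff.1 h
  exact ⟨j, by simpa using hj⟩

theorem l0norm_sumElim {px pz : ℕ} (u : Fin px → ℝ) (v : Fin pz → ℝ) :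
    l0norm (Sum.elim u v : Idx px pz → ℝ) = l0norm u + l0norm v := by
  classical
  simp only [l0norm_eq_card, Finset.card_filter, Fintype.sum_sum_type, Sum.elim_inl, Sum.elim_inr]
  congr

theorem l1norm_emb {px pz : ℕ} (v : Fin pz → ℝ) : l1norm (emb v : Idx px pz → ℝ) = l1norm v := by
  simp [l1norm, emb, Fintype.sum_sum_type]

theorem l2norm_emb {px pz : ℕ} (v : Fin pz → ℝ) : l2norm (emb v : Idx px pz → ℝ) = l2norm v := by
  simp [l2norm, emb, Fintype.sum_sum_type]

theorem l1norm_inr_le {px pz : ℕ} (v : Idx px pz → ℝ) :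
    l1norm (fun j : Fin pz => v (Sum.inr j)) ≤ l1norm v := by
  simp only [l1norm, Fintype.sum_sum_type]
  exact le_add_of_nonneg_left (Finset.sum_nonneg fun _ _ => abs_nonneg _)

theorem l2norm_inr_le {px pz : ℕ} (v : Idx px pz → ℝ) :
    l2norm (fun j : Fin pz => v (Sum.inr j)) ≤ l2norm v := by
  refine Real.sqrt_le_sqrt ?_
  rw [Fintype.sum_sum_type]
  exact le_add_of_nonneg_left (Finset.sum_nonneg fun _ _ => sq_nonneg _)

theorem l1norm_mulVec_le {m : ℝ} {O : Matrix κ κ ℝ} (hO : ∀ k, ∑ j, |O j k| ≤ m) (v : κ → ℝ) :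
    l1norm (O *ᵥ v) ≤ m * l1norm v := by
  calc l1norm (O *ᵥ v) ≤ ∑ j, ∑ k, |O j k| * |v k| :=
        Finset.sum_le_sum fun j _ => (Finset.abs_sum_le_sum_abs _ _).trans
          (le_of_eq (Finset.sum_congr rfl fun k _ => abs_mul _ _))
    _ = ∑ k, (∑ j, |O j k|) * |v k| := by
        rw [Finset.sum_comm]; simp only [Finset.sum_mul]
    _ ≤ ∑ k, m * |v k| :=
        Finset.sum_le_sum fun k _ => mul_le_mul_of_nonneg_right (hO k) (abs_nonneg _)
    _ = m * l1norm v := by rw [l1norm, Finset.mul_sum]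

/-- Hölder's inequality, applied twice. It converts finitely many entrywise deviations into a bound
valid for all vectors at once, in particular for vectors computed from the same data. -/
theorem abs_quadForm_le {S : Matrix κ κ ℝ} {B : ℝ} (hS : ∀ j k, |S j k| ≤ B) (u v : κ → ℝ) :
    |u ⬝ᵥ (S *ᵥ v)| ≤ l1norm u * (l1norm v * B) := by
  refine abs_dotProduct_le_l1norm fun j => ?_
  rw [mulVec, dotProduct_comm]
  exact abs_dotProduct_le_l1norm (hS j)

end Norms

/-! ### The Lasso -/

section Lasso

variable {n px pz : ℕ}

theorem lassoObj_sub (y : Fin n → ℝ) (W : Matrix (Fin n) (Idx px pz) ℝ) (lam : ℝ)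
    (θ δ : Idx px pz → ℝ) :
    lassoObj y W lam (θ + δ) - lassoObj y W lam θ =
      (1 / (n : ℝ)) * ∑ i, (W *ᵥ δ) i ^ 2 - 2 * (δ ⬝ᵥ ((1 / (n : ℝ)) • (Wᵀ *ᵥ (y - W *ᵥ θ))))
        + lam * (l1norm (θ + δ) - l1norm θ) := by
  have h : δ ⬝ᵥ ((1 / (n : ℝ)) • (Wᵀ *ᵥ (y - W *ᵥ θ))) =
      (1 / (n : ℝ)) * ∑ i, (W *ᵥ δ) i * (y i - (W *ᵥ θ) i) := by
    rw [dotProduct_smul, smul_eq_mul, mulVec_transpose, dotProduct_comm, ← dotProduct_mulVec,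
      dotProduct_comm]
    rfl
  rw [h, lassoObj, lassoObj, mulVec_add]
  simp only [Pi.add_apply]
  have : ∑ i, (y i - ((W *ᵥ θ) i + (W *ᵥ δ) i)) ^ 2 = ∑ i, (y i - (W *ᵥ θ) i) ^ 2
      + ∑ i, (W *ᵥ δ) i ^ 2 - 2 * ∑ i, (W *ᵥ δ) i * (y i - (W *ᵥ θ) i) := by
    rw [← Finset.sum_add_distrib, Finset.mul_sum, ← Finset.sum_sub_distrib]
    exact Finset.sum_congr rfl fun i _ => by ring
  rw [this]; ring

/-- Stationarity: the scores of a Lasso solution are at most half the tuning parameter. -/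
theorem IsLasso.abs_score_le {y : Fin n → ℝ} {W : Matrix (Fin n) (Idx px pz) ℝ} {lam : ℝ}
    {θ : Idx px pz → ℝ} (h : IsLasso y W lam θ) (hlam : 0 ≤ lam) (j : Idx px pz) :
    |((1 / (n : ℝ)) • (Wᵀ *ᵥ (y - W *ᵥ θ))) j| ≤ lam / 2 := by
  set g := ((1 / (n : ℝ)) • (Wᵀ *ᵥ (y - W *ᵥ θ))) j with hg
  set S := (1 / (n : ℝ)) * ∑ i, W i j ^ 2 with hS
  have hS0 : 0 ≤ S := mul_nonneg (by positivity) (Finset.sum_nonneg fun _ _ => sq_nonneg _)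
  -- Optimality is tested against moving the single coordinate `j` by `t`. The penalty changes by at
  -- most `lam * |t|`.
  have key : ∀ t : ℝ, 2 * t * g ≤ t ^ 2 * S + lam * |t| := by
    intro t
    have h1 := lassoObj_sub y W lam θ (Pi.single j t)
    have h2 := h (θ + Pi.single j t)
    have h3 : l1norm (θ + Pi.single j t) - l1norm θ ≤ |t| := by
      have := l1norm_add_le θ (Pi.single j t)
      have h4 : l1norm (Pi.single j t : Idx px pz → ℝ) = |t| := by
        rw [l1norm, Finset.sum_eq_single j] <;> simp +contextual
      linarith
    rw [single_dotProduct, ← hg] at h1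
    have h5 : (1 / (n : ℝ)) * ∑ i, (W *ᵥ (Pi.single j t)) i ^ 2 = t ^ 2 * S := by
      simp only [mulVec_single, hS, Pi.smul_apply, MulOpposite.smul_eq_mul_unop,
        MulOpposite.unop_op, mul_pow, ← Finset.sum_mul, Matrix.col_apply]
      ring
    rw [h5] at h1
    have h6 := mul_le_mul_of_nonneg_left h3 hlam
    linarith
  by_contra hcon
  push Not at hcon
  set ξ := |g| - lam / 2 with hξ
  have hξ0 : 0 < ξ := by linarith
  -- With the step length `ξ / (S + 1)` the quadratic cost `t² S` stays below the first-order gain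
  -- `2 t ξ`, which contradicts `key`. The `+ 1` covers `S = 0`.
  have hε : 0 < ξ / (S + 1) := by positivity
  have hlt : ξ / (S + 1) * S < 2 * ξ := by
    rw [div_mul_eq_mul_div, div_lt_iff₀ (by positivity)]; nlinarith
  rcases le_total 0 g with h0 | h0
  · have := key (ξ / (S + 1))
    rw [abs_of_pos hε] at this
    rw [abs_of_nonneg h0] at hξ
    have h7 : 2 * g ≤ ξ / (S + 1) * S + lam := by
      refine le_of_mul_le_mul_left ?_ hε
      nlinarith
    linarith
  · have := key (-(ξ / (S + 1)))
    rw [abs_neg, abs_of_pos hε] at this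
    rw [abs_of_nonpos h0] at hξ
    have h7 : -(2 * g) ≤ ξ / (S + 1) * S + lam := by
      refine le_of_mul_le_mul_left ?_ hε
      nlinarith
    linarith

theorem quad_gram (W : Matrix (Fin n) (Idx px pz) ℝ) (δ : Idx px pz → ℝ) :
    quad (gram W) δ = (1 / (n : ℝ)) * ∑ i, (W *ᵥ δ) i ^ 2 := by
  rw [quad, bil, gram, smul_mulVec, dotProduct_smul, ← mulVec_mulVec, mulVec_transpose,
    dotProduct_comm, ← dotProduct_mulVec, smul_eq_mul]
  simp only [dotProduct, sq]

theorem quad_gram_ge {S : Matrix (Idx px pz) (Idx px pz) ℝ} {W : Matrix (Fin n) (Idx px pz) ℝ}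
    {c ρ : ℝ} (hS : ∀ v, c * l2norm v ^ 2 ≤ quad S v) (hdev : ∀ j k, |gram W j k - S j k| ≤ ρ)
    (v : Idx px pz → ℝ) :
    c * l2norm v ^ 2 - ρ * l1norm v ^ 2 ≤ quad (gram W) v := by
  have h := abs_quadForm_le (S := gram W - S) hdev v v
  rw [sub_mulVec, dotProduct_sub] at h
  have h1 := hS v
  simp only [quad, bil] at *
  have := neg_le_of_abs_le h
  nlinarith

/-- Estimation error of the Lasso under a sparse truth: `ℓ₂` and `ℓ₁` bounds. -/
theorem IsLasso.error_bound {S : Matrix (Idx px pz) (Idx px pz) ℝ}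
    {W : Matrix (Fin n) (Idx px pz) ℝ} {c ρ lam : ℝ} {y ξ : Fin n → ℝ} {θ θ' : Idx px pz → ℝ}
    {k : ℕ} (hc : 0 < c) (hS : ∀ v, c * l2norm v ^ 2 ≤ quad S v)
    (hdev : ∀ j l, |gram W j l - S j l| ≤ ρ) (hρ : 32 * (ρ * k) ≤ c) (hpos : 0 < lam)
    (hy : y = W *ᵥ θ + ξ) (hξ : ∀ j, |((1 / (n : ℝ)) • (Wᵀ *ᵥ ξ)) j| ≤ lam / 4)
    (hk : l0norm θ ≤ k) (h : IsLasso y W lam θ') :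
    l2norm (θ' - θ) ≤ 3 * lam * Real.sqrt k / c ∧
      l1norm (θ' - θ) ≤ 4 * Real.sqrt k * l2norm (θ' - θ) := by
  classical
  have hlam := hpos.le
  set δ := θ' - θ with hδ
  have hθ' : θ + δ = θ' := by rw [hδ]; abel
  have h1 := lassoObj_sub y W lam θ δ
  rw [hθ', ← quad_gram] at h1
  have hres : y - W *ᵥ θ = ξ := by rw [hy]; abel
  rw [hres] at h1
  have h2 := h θ
  have h3 := le_of_abs_le (abs_dotProduct_le_l1norm (u := δ) hξ)
  set T := Finset.univ.filter fun j => θ j ≠ 0 with hT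
  have hsplit : ∀ v : Idx px pz → ℝ, l1norm v = ∑ j ∈ T, |v j| + ∑ j ∈ Tᶜ, |v j| := fun v =>
    (Finset.sum_add_sum_compl T fun j => |v j|).symm
  have h4 : l1norm θ - l1norm θ' ≤ ∑ j ∈ T, |δ j| - ∑ j ∈ Tᶜ, |δ j| := by
    rw [hsplit θ, hsplit θ']
    have e1 : ∑ j ∈ Tᶜ, |θ j| = 0 := Finset.sum_eq_zero fun j hj => by
      simpa [hT] using hj
    have e2 : ∑ j ∈ Tᶜ, |θ' j| = ∑ j ∈ Tᶜ, |δ j| := Finset.sum_congr rfl fun j hj => by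
      have : θ j = 0 := by simpa [hT] using hj
      rw [hδ, Pi.sub_apply, this, sub_zero]
    have e3 : ∑ j ∈ T, |θ j| ≤ ∑ j ∈ T, |θ' j| + ∑ j ∈ T, |δ j| := by
      rw [← Finset.sum_add_distrib]
      refine Finset.sum_le_sum fun j _ => ?_
      have := abs_sub (θ' j) (δ j)
      rwa [hδ, Pi.sub_apply, sub_sub_cancel] at this
    linarith
  have hq0 : 0 ≤ quad (gram W) δ := by
    rw [quad_gram]
    exact mul_nonneg (by positivity) (Finset.sum_nonneg fun _ _ => sq_nonneg _)
  set a := ∑ j ∈ T, |δ j| with ha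
  set b := ∑ j ∈ Tᶜ, |δ j| with hb
  have ha0 : 0 ≤ a := Finset.sum_nonneg fun _ _ => abs_nonneg _
  have hb0 : 0 ≤ b := Finset.sum_nonneg fun _ _ => abs_nonneg _
  have hsum : l1norm δ = a + b := hsplit δ
  -- The noise term costs at most `lam / 2 * (a + b)` and the penalty gains `lam * (b - a)`. The net
  -- coefficient of `b` is negative, so nonnegativity of the quadratic form confines `δ` to the cone
  -- `b ≤ 3 a`.
  have hbasic : quad (gram W) δ ≤ lam * (3 / 2 * a - b / 2) := by
    rw [hsum] at h3
    have := mul_le_mul_of_nonneg_left h4 hlam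
    linarith
  have hTk : Real.sqrt T.card ≤ Real.sqrt k := by
    refine Real.sqrt_le_sqrt ?_
    rw [← l0norm_eq_card]; exact_mod_cast hk
  have hal2 : a ≤ Real.sqrt k * l2norm δ :=
    (l1norm_le_sqrt_card_mul T δ).trans (mul_le_mul_of_nonneg_right hTk (l2norm_nonneg _))
  have hk0 := Real.sqrt_nonneg (k : ℝ)
  have hl0 := l2norm_nonneg δ
  have hρ0 : ∀ j : Idx px pz, 0 ≤ ρ := fun j => (abs_nonneg _).trans (hdev j j)
  have hcone : b ≤ 3 * a := by
    have := nonneg_of_mul_nonneg_right (hq0.trans hbasic) hpos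
    linarith
  have hl1 : l1norm δ ≤ 4 * Real.sqrt k * l2norm δ := by rw [hsum]; linarith
  refine ⟨?_, hl1⟩
  have hge := quad_gram_ge hS hdev δ
  have hl1sq : l1norm δ ^ 2 ≤ 16 * k * l2norm δ ^ 2 := by
    have := pow_le_pow_left₀ (l1norm_nonneg _) hl1 2
    rw [mul_pow, mul_pow, Real.sq_sqrt (Nat.cast_nonneg _)] at this
    linarith
  rcases isEmpty_or_nonempty (Idx px pz) with he | ⟨⟨j⟩⟩
  · have : l2norm δ = 0 := by simp [l2norm]
    rw [this]; positivity
  have := mul_le_mul_of_nonneg_left hl1sq (hρ0 j)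
  -- On the cone `‖δ‖₁² ≤ 16 k ‖δ‖₂²`, so `32 ρ k ≤ c` lets the population eigenvalue bound survive
  -- for the empirical Gram matrix with half its constant.
  have hmain : c / 2 * l2norm δ ^ 2 ≤ lam * (3 / 2 * (Real.sqrt k * l2norm δ)) := by
    have e1 : lam * (3 / 2 * a - b / 2) ≤ lam * (3 / 2 * (Real.sqrt k * l2norm δ)) :=
      mul_le_mul_of_nonneg_left (by linarith) hlam
    have e2 : 16 * (ρ * k) * l2norm δ ^ 2 ≤ c / 2 * l2norm δ ^ 2 :=
      mul_le_mul_of_nonneg_right (by linarith) (sq_nonneg _)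
    linarith
  rcases hl0.eq_or_lt with h0 | h0
  · rw [← h0]; positivity
  rw [le_div_iff₀ hc]
  refine le_of_mul_le_mul_right ?_ h0
  linarith

end Lasso

/-! ### Concentration of averages with stretched exponential tails -/

section Concentration

variable {Ω : Type u} {mΩ : MeasurableSpace Ω} {P : Measure Ω} [IsProbabilityMeasure P]

/-- One term of the exponential series, `y⁶ / 6! ≤ exp y` at `y = b √t`. The decay `t⁻³` is enough
to integrate `t P(|ξ| > t)` over `t > 1`. -/
theorem exp_neg_mul_sqrt_le {b t : ℝ} (hb : 0 < b) (ht : 0 < t) :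
    Real.exp (-b * Real.sqrt t) ≤ 720 / b ^ 6 * t ^ (-3 : ℝ) := by
  have h := Real.pow_div_factorial_le_exp (b * Real.sqrt t) (by positivity) 6
  have h6 : (b * Real.sqrt t) ^ 6 = b ^ 6 * t ^ 3 := by
    rw [mul_pow, show (6 : ℕ) = 2 * 3 from rfl, pow_mul (Real.sqrt t), Real.sq_sqrt ht.le]
  rw [h6] at h
  rw [neg_mul, Real.exp_neg, Real.rpow_neg ht.le, show (3 : ℝ) = ((3 : ℕ) : ℝ) by norm_num,
    Real.rpow_natCast, ← div_eq_mul_inv, div_div]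
  refine inv_le_of_inv_le₀ (by positivity) ?_
  rw [inv_div]
  rwa [show ((Nat.factorial 6 : ℕ) : ℝ) = 720 by norm_num [Nat.factorial]] at h

/-- Stretched exponential tails bound the second moment. -/
theorem exists_second_moment_bound {B b : ℝ} (hB : 0 < B) (hb : 0 < b) :
    ∃ V : ℝ, 0 < V ∧ ∀ {Ω : Type u} {_ : MeasurableSpace Ω} (P : Measure Ω)
      [IsProbabilityMeasure P] (ξ : Ω → ℝ), Measurable ξ →
      (∀ t : ℝ, 1 ≤ t → P.real {ω | t < |ξ ω|} ≤ B * Real.exp (-b * Real.sqrt t)) →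
      Integrable (fun ω => ξ ω ^ 2) P ∧ ∫ ω, ξ ω ^ 2 ∂P ≤ V := by
  set B' := B * (720 / b ^ 6) with hB'
  have hB'0 : 0 < B' := by positivity
  refine ⟨2 * (1 + B'), by positivity, fun P _ ξ hξ htail => ?_⟩
  have hlin : ∫⁻ ω, ENNReal.ofReal (ξ ω ^ 2) ∂P ≤ ENNReal.ofReal (2 * (1 + B')) := by
    have h1 := lintegral_rpow_eq_lintegral_meas_lt_mul P (f := fun ω => |ξ ω|)
      (Eventually.of_forall fun _ => abs_nonneg _) hξ.abs.aemeasurable (p := 2) (by norm_num)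
    have e1 : ∀ ω, |ξ ω| ^ (2 : ℝ) = ξ ω ^ 2 := fun ω => by
      rw [Real.rpow_two, sq_abs]
    simp only [e1] at h1
    rw [h1, ENNReal.ofReal_mul (by norm_num)]
    refine mul_le_mul_right ?_ _
    -- The layer-cake integral is split at `1`: below, the probability is at most `1`; above, the
    -- polynomial bound `B' t⁻³` is integrated.
    rw [← Set.Ioc_union_Ioi_eq_Ioi (zero_le_one' ℝ), ENNReal.ofReal_add zero_le_one hB'0.le]
    refine (lintegral_union_le _ _ _).trans (add_le_add ?_ ?_)
    · calc ∫⁻ t in Set.Ioc (0 : ℝ) 1, P {a | t < |ξ a|} * ENNReal.ofReal (t ^ ((2 : ℝ) - 1))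
          ≤ ∫⁻ _ in Set.Ioc (0 : ℝ) 1, 1 := by
            refine setLIntegral_mono measurable_const fun t ht => ?_
            refine mul_le_one' prob_le_one ?_
            rw [ENNReal.ofReal_le_one]
            exact Real.rpow_le_one ht.1.le ht.2 (by norm_num)
        _ ≤ ENNReal.ofReal 1 := by simp
    · have hint : IntegrableOn (fun t : ℝ => B' * t ^ (-2 : ℝ)) (Set.Ioi 1) :=
        (integrableOn_Ioi_rpow_of_lt (by norm_num) one_pos).const_mul _
      calc ∫⁻ t in Set.Ioi (1 : ℝ), P {a | t < |ξ a|} * ENNReal.ofReal (t ^ ((2 : ℝ) - 1))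
          ≤ ∫⁻ t in Set.Ioi (1 : ℝ), ENNReal.ofReal (B' * t ^ (-2 : ℝ)) := by
            refine setLIntegral_mono (by fun_prop) fun t ht => ?_
            have ht1 : (1 : ℝ) < t := ht
            have ht0 : 0 < t := one_pos.trans ht1
            have h2 : P {a | t < |ξ a|} ≤ ENNReal.ofReal (B' * t ^ (-3 : ℝ)) := by
              rw [← ofReal_measureReal]
              refine ENNReal.ofReal_le_ofReal ((htail t ht1.le).trans ?_)
              rw [hB', mul_assoc]
              exact mul_le_mul_of_nonneg_left (exp_neg_mul_sqrt_le hb ht0) hB.le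
            refine (mul_le_mul_left h2 _).trans ?_
            rw [← ENNReal.ofReal_mul (by positivity), mul_assoc, ← Real.rpow_add ht0]
            norm_num
        _ = ENNReal.ofReal (∫ t in Set.Ioi (1 : ℝ), B' * t ^ (-2 : ℝ)) := by
            rw [ofReal_integral_eq_lintegral_ofReal hint]
            refine (ae_restrict_iff' measurableSet_Ioi).2 (Eventually.of_forall fun t ht => ?_)
            have : (0 : ℝ) < t := one_pos.trans ht
            positivity
        _ ≤ ENNReal.ofReal B' := by
            rw [integral_const_mul, integral_Ioi_rpow_of_lt (by norm_num) one_pos]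
            norm_num
  have hint : Integrable (fun ω => ξ ω ^ 2) P := by
    refine ⟨(hξ.pow_const 2).aestronglyMeasurable, ?_⟩
    rw [hasFiniteIntegral_iff_ofReal (Eventually.of_forall fun _ => sq_nonneg _)]
    exact hlin.trans_lt ENNReal.ofReal_lt_top
  refine ⟨hint, ?_⟩
  rw [integral_eq_lintegral_of_nonneg_ae (Eventually.of_forall fun _ => sq_nonneg _)
    hint.aestronglyMeasurable]
  exact ENNReal.toReal_le_of_le_ofReal (by positivity) hlin

/-- For `|u| ≤ 1` one has `exp u ≤ 1 + u + u²`, which costs `lam² V`. Centering at the mean of `ξ`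
instead of that of its truncation costs `lam² V` more, because the discarded part satisfies `|ξ| ≤
lam ξ²`. This explains the `2` in the exponent. -/
theorem integral_exp_truncation_le {V lam : ℝ} {ξ : Ω → ℝ} (hξ : Measurable ξ) (hlam : 0 < lam)
    (hint : Integrable (fun ω => ξ ω ^ 2) P) (hV : ∫ ω, ξ ω ^ 2 ∂P ≤ V) :
    Integrable (fun ω => Real.exp
      (lam * ((if lam * |ξ ω| ≤ 1 then ξ ω else 0) - ∫ ω, ξ ω ∂P))) P ∧
    ∫ ω, Real.exp (lam * ((if lam * |ξ ω| ≤ 1 then ξ ω else 0) - ∫ ω, ξ ω ∂P)) ∂P ≤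
      Real.exp (2 * lam ^ 2 * V) := by
  set Y : Ω → ℝ := fun ω => if lam * |ξ ω| ≤ 1 then ξ ω else 0 with hY
  have hYm : Measurable Y :=
    Measurable.ite (measurableSet_le (hξ.abs.const_mul lam) measurable_const) hξ measurable_const
  have hYb : ∀ ω, |lam * Y ω| ≤ 1 := fun ω => by
    simp only [hY]; split_ifs with h
    · rwa [abs_mul, abs_of_pos hlam]
    · simp
  have hξ1 : Integrable ξ P := by
    have h2 : MemLp ξ 2 P := (memLp_two_iff_integrable_sq hξ.aestronglyMeasurable).2 hint
    exact h2.integrable (by norm_num)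
  have hbd : ∀ f : Ω → ℝ, Measurable f → (∃ C, ∀ ω, |f ω| ≤ C) → Integrable f P :=
    fun f hf ⟨C, hC⟩ => Integrable.of_bound hf.aestronglyMeasurable C
      (Eventually.of_forall hC)
  have hexpb : ∀ ω, |Real.exp (lam * Y ω)| ≤ Real.exp 1 := fun ω => by
    rw [abs_of_pos (Real.exp_pos _)]
    exact Real.exp_le_exp.2 (le_of_abs_le (hYb ω))
  have hexpi : Integrable (fun ω => Real.exp (lam * Y ω)) P :=
    hbd _ (hYm.const_mul lam).exp ⟨_, hexpb⟩
  have hYi : Integrable (fun ω => lam * Y ω) P := hbd _ (hYm.const_mul lam) ⟨1, hYb⟩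
  have hYi' : Integrable Y P := by
    have := hYi.const_mul lam⁻¹
    simpa [← mul_assoc, inv_mul_cancel₀ hlam.ne'] using this
  have hsplit : ∀ ω, Real.exp (lam * (Y ω - ∫ ω, ξ ω ∂P)) =
      Real.exp (lam * Y ω) * Real.exp (-(lam * ∫ ω, ξ ω ∂P)) := fun ω => by
    rw [← Real.exp_add]; congr 1; ring
  change Integrable (fun ω => Real.exp (lam * (Y ω - ∫ ω, ξ ω ∂P))) P ∧
    ∫ ω, Real.exp (lam * (Y ω - ∫ ω, ξ ω ∂P)) ∂P ≤ _
  simp only [hsplit]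
  refine ⟨hexpi.mul_const _, ?_⟩
  rw [integral_mul_const]
  have h1 : ∫ ω, Real.exp (lam * Y ω) ∂P ≤ 1 + lam * ∫ ω, Y ω ∂P + lam ^ 2 * V := by
    calc ∫ ω, Real.exp (lam * Y ω) ∂P ≤ ∫ ω, (1 + lam * Y ω + lam ^ 2 * ξ ω ^ 2) ∂P := by
          refine integral_mono hexpi (((integrable_const _).add hYi).add (hint.const_mul _))
            fun ω => ?_
          have := le_of_abs_le (Real.abs_exp_sub_one_sub_id_le (hYb ω))
          have h3 : (lam * Y ω) ^ 2 ≤ lam ^ 2 * ξ ω ^ 2 := by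
            rw [mul_pow]
            refine mul_le_mul_of_nonneg_left ?_ (sq_nonneg _)
            simp only [hY]; split_ifs
            · exact le_rfl
            · simpa using sq_nonneg (ξ ω)
          simp only
          linarith
      _ = 1 + lam * ∫ ω, Y ω ∂P + lam ^ 2 * ∫ ω, ξ ω ^ 2 ∂P := by
          have h4 : Integrable (fun ω => 1 + lam * Y ω) P := (integrable_const _).add hYi
          rw [integral_add h4 (hint.const_mul _), integral_add (integrable_const _) hYi, integral_const_mul, integral_const_mul]
          simp
      _ ≤ _ := by gcongr
  have h2 : ∫ ω, Y ω ∂P ≤ ∫ ω, ξ ω ∂P + lam * V := by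
    calc ∫ ω, Y ω ∂P ≤ ∫ ω, (ξ ω + lam * ξ ω ^ 2) ∂P := by
          refine integral_mono hYi' (hξ1.add (hint.const_mul _)) fun ω => ?_
          simp only [hY]; split_ifs with h
          · have := sq_nonneg (ξ ω); nlinarith
          · push Not at h
            have h3 : -|ξ ω| ≤ ξ ω := neg_abs_le _
            have h4 : |ξ ω| ≤ lam * ξ ω ^ 2 := by
              rw [← sq_abs, sq]; nlinarith [abs_nonneg (ξ ω)]
            linarith
      _ = ∫ ω, ξ ω ∂P + lam * ∫ ω, ξ ω ^ 2 ∂P := by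
          rw [integral_add hξ1 (hint.const_mul _), integral_const_mul]
      _ ≤ _ := by gcongr
  have h3 : ∫ ω, Real.exp (lam * Y ω) ∂P ≤
      Real.exp (lam * ∫ ω, ξ ω ∂P + 2 * lam ^ 2 * V) := by
    refine h1.trans (le_trans ?_ (Real.add_one_le_exp _))
    have := mul_le_mul_of_nonneg_left h2 hlam.le
    linarith
  refine (mul_le_mul_of_nonneg_right h3 (Real.exp_pos _).le).trans (le_of_eq ?_)
  rw [← Real.exp_add]; congr 1; ring

/-- Chernoff's bound for the variables truncated at `lam⁻¹`, with exponent parameter `lam` itself,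
plus the probability that some truncation is active. For `lam = √(log p / n)` the factor `n lam²`
becomes `log p`. -/
theorem measureReal_sum_sub_ge_le {n : ℕ} {B b V lam τ : ℝ} {ξ : Fin n → Ω → ℝ}
    (hind : iIndepFun ξ P) (hξ : ∀ i, Measurable (ξ i)) (hlam : 0 < lam) (hlam1 : lam ≤ 1)
    (htail : ∀ i, ∀ t : ℝ, 1 ≤ t → P.real {ω | t < |ξ i ω|} ≤ B * Real.exp (-b * Real.sqrt t))
    (hint : ∀ i, Integrable (fun ω => ξ i ω ^ 2) P) (hV : ∀ i, ∫ ω, ξ i ω ^ 2 ∂P ≤ V) :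
    P.real {ω | n * (τ * lam) ≤ ∑ i, (ξ i ω - ∫ ω, ξ i ω ∂P)} ≤
      Real.exp (-(τ - 2 * V) * (n * lam ^ 2)) +
        n * (B * Real.exp (-b * Real.sqrt lam⁻¹)) := by
  set g : Fin n → ℝ → ℝ := fun i x =>
    (if lam * |x| ≤ 1 then x else 0) - ∫ ω, ξ i ω ∂P with hg
  have hgm : ∀ i, Measurable (g i) := fun i =>
    (Measurable.ite (measurableSet_le (measurable_id.abs.const_mul lam) measurable_const)
      measurable_id measurable_const).sub_const _
  set Z : Fin n → Ω → ℝ := fun i => g i ∘ ξ i with hZ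
  have hZind : iIndepFun Z P := hind.comp g hgm
  have hZm : ∀ i, Measurable (Z i) := fun i => (hgm i).comp (hξ i)
  have hZb := fun i => integral_exp_truncation_le (hξ i) hlam (hint i) (hV i)
  have hmgf : mgf (∑ i, Z i) P lam ≤ Real.exp (2 * lam ^ 2 * V) ^ n := by
    rw [hZind.mgf_sum hZm]
    calc ∏ i, mgf (Z i) P lam ≤ ∏ _i : Fin n, Real.exp (2 * lam ^ 2 * V) :=
          Finset.prod_le_prod (fun i _ => mgf_nonneg) fun i _ => (hZb i).2
      _ = _ := by simp
  have hZi : Integrable (fun ω => Real.exp (lam * (∑ i, Z i) ω)) P := by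
    exact hZind.integrable_exp_mul_sum hZm fun i _ => (hZb i).1
  have hch := measure_ge_le_exp_mul_mgf (μ := P) (X := ∑ i, Z i) (n * (τ * lam)) hlam.le hZi
  -- Outside the union of the large-value events the truncation is the identity, so both sums agree.
  have hsub : {ω | n * (τ * lam) ≤ ∑ i, (ξ i ω - ∫ ω, ξ i ω ∂P)} ⊆
      {ω | n * (τ * lam) ≤ (∑ i, Z i) ω} ∪ ⋃ i, {ω | lam⁻¹ < |ξ i ω|} := by
    intro ω hω
    by_cases h : ∃ i, lam⁻¹ < |ξ i ω|
    · exact Or.inr (Set.mem_iUnion.2 h)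
    · push Not at h
      left
      simp only [Set.mem_ofPred_eq, Finset.sum_apply] at hω ⊢
      convert hω using 2 with i
      simp only [hZ, hg, Function.comp]
      rw [if_pos]
      have := mul_le_mul_of_nonneg_left (h i) hlam.le
      rwa [mul_inv_cancel₀ hlam.ne'] at this
  refine (measureReal_mono hsub).trans ((measureReal_union_le _ _).trans (add_le_add ?_ ?_))
  · refine hch.trans ((mul_le_mul_of_nonneg_left hmgf (Real.exp_pos _).le).trans (le_of_eq ?_))
    rw [← Real.exp_nat_mul, ← Real.exp_add]
    congr 1; ring
  · refine (measureReal_iUnion_fintype_le _).trans ?_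
    refine (Finset.sum_le_sum fun i _ => htail i lam⁻¹ (one_le_inv_iff₀.2 ⟨hlam, hlam1⟩)).trans ?_
    simp

/-- Two-sided deviation inequality for averages of independent variables with stretched
exponential tails. -/
theorem measureReal_abs_average_sub_gt_le {n : ℕ} (hn : 0 < n) {B b V lam τ : ℝ}
    {ξ : Fin n → Ω → ℝ}
    (hind : iIndepFun ξ P) (hξ : ∀ i, Measurable (ξ i)) (hlam : 0 < lam) (hlam1 : lam ≤ 1)
    (htail : ∀ i, ∀ t : ℝ, 1 ≤ t → P.real {ω | t < |ξ i ω|} ≤ B * Real.exp (-b * Real.sqrt t))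
    (hint : ∀ i, Integrable (fun ω => ξ i ω ^ 2) P) (hV : ∀ i, ∫ ω, ξ i ω ^ 2 ∂P ≤ V) :
    P.real {ω | τ * lam <
        |(1 / (n : ℝ)) * ∑ i, ξ i ω - (1 / (n : ℝ)) * ∑ i, ∫ ω, ξ i ω ∂P|} ≤
      2 * (Real.exp (-(τ - 2 * V) * (n * lam ^ 2)) +
        n * (B * Real.exp (-b * Real.sqrt lam⁻¹))) := by
  have h1 := measureReal_sum_sub_ge_le (τ := τ) hind hξ hlam hlam1 htail hint hV
  have h2 := measureReal_sum_sub_ge_le (τ := τ) (ξ := fun i ω => -ξ i ω) (B := B) (b := b) (V := V)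
    (P := P)
    (hind.comp (fun _ x => -x) fun _ => measurable_neg) (fun i => (hξ i).neg) hlam hlam1
    (by simpa only [abs_neg] using htail) (by simpa only [neg_sq] using hint)
    (by simpa only [neg_sq] using hV)
  have hn' : (0 : ℝ) < n := Nat.cast_pos.2 hn
  have hsub : {ω | τ * lam <
        |(1 / (n : ℝ)) * ∑ i, ξ i ω - (1 / (n : ℝ)) * ∑ i, ∫ ω, ξ i ω ∂P|} ⊆
      {ω | n * (τ * lam) ≤ ∑ i, (ξ i ω - ∫ ω, ξ i ω ∂P)} ∪
      {ω | n * (τ * lam) ≤ ∑ i, (-ξ i ω - ∫ ω, -ξ i ω ∂P)} := by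
    intro ω hω
    simp only [Set.mem_ofPred_eq, Set.mem_union] at hω ⊢
    simp only [integral_neg, ← neg_sub', Finset.sum_neg_distrib, Finset.sum_sub_distrib]
    rw [← mul_sub, abs_mul, abs_of_pos (by positivity), one_div, inv_mul_eq_div,
      lt_div_iff₀ hn'] at hω
    rcases lt_abs.1 hω with h | h
    · left; linarith
    · right; linarith
  refine (measureReal_mono hsub).trans ((measureReal_union_le _ _).trans ?_)
  linarith

end Concentration

/-! ### Quantiles of the maximum of a Gaussian vector -/

section GaussianQuantile

/-- Argued through the moment generating function and not the density, so that a degenerate variance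
`v = 0` is included. -/
theorem gaussianReal_abs_gt_le {v : NNReal} {V x : ℝ} (hvV : (v : ℝ) ≤ V) (hV : 0 < V)
    (hx : 0 ≤ x) :
    (gaussianReal 0 v).real {y | x < |y|} ≤ 2 * Real.exp (-x ^ 2 / (2 * V)) := by
  have hsub : HasSubgaussianMGF id V.toNNReal (gaussianReal 0 v) := by
    refine ⟨fun t => integrable_exp_mul_gaussianReal t, fun t => ?_⟩
    rw [mgf_id_gaussianReal]
    refine Real.exp_le_exp.2 ?_
    rw [zero_mul, zero_add, Real.coe_toNNReal _ hV.le]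
    gcongr
  have h1 := hsub.measure_ge_le hx
  have h2 := hsub.neg.measure_ge_le hx
  rw [Real.coe_toNNReal _ hV.le] at h1 h2
  have hincl : {y : ℝ | x < |y|} ⊆ {y | x ≤ id y} ∪ {y | x ≤ (-id) y} := by
    intro y hy
    rw [Set.mem_ofPred_eq] at hy
    rcases lt_abs.1 hy with h | h
    · exact Or.inl h.le
    · exact Or.inr h.le
  refine (measureReal_mono hincl).trans ((measureReal_union_le _ _).trans ?_)
  linarith

/-- The density is at most `1 / √(2π v) ≤ 1 / (2 √w)`, and the interval has length `2 x`. -/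
theorem gaussianReal_abs_le_le {v : NNReal} {w x : ℝ} (hw : 0 < w) (hwv : w ≤ v) (hx : 0 ≤ x) :
    (gaussianReal 0 v).real {y | |y| ≤ x} ≤ x / Real.sqrt w := by
  have hv : v ≠ 0 := by
    rintro rfl
    simp at hwv; linarith
  have hset : {y : ℝ | |y| ≤ x} = Set.Icc (-x) x := by
    ext y; simp [abs_le]
  have hw' := Real.sqrt_pos.2 hw
  rw [hset, measureReal_def, gaussianReal_apply _ hv]
  refine ENNReal.toReal_le_of_le_ofReal (by positivity) ?_
  calc ∫⁻ y in Set.Icc (-x) x, gaussianPDF 0 v y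
      ≤ ∫⁻ _ in Set.Icc (-x) x, ENNReal.ofReal (1 / (2 * Real.sqrt w)) := by
        refine setLIntegral_mono measurable_const fun y _ => ENNReal.ofReal_le_ofReal ?_
        rw [gaussianPDFReal]
        have h1 : Real.exp (-(y - 0) ^ 2 / (2 * v)) ≤ 1 := by
          rw [Real.exp_le_one_iff]
          exact div_nonpos_of_nonpos_of_nonneg (neg_nonpos.2 (sq_nonneg _)) (by positivity)
        have h2 : 2 * Real.sqrt w ≤ Real.sqrt (2 * Real.pi * v) := by
          refine Real.le_sqrt_of_sq_le ?_
          rw [mul_pow, Real.sq_sqrt hw.le]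
          nlinarith [Real.pi_gt_three]
        calc _ ≤ (Real.sqrt (2 * Real.pi * v))⁻¹ * 1 :=
              mul_le_mul_of_nonneg_left h1 (by positivity)
          _ ≤ 1 / (2 * Real.sqrt w) := by
              rw [mul_one, one_div]; exact inv_anti₀ (by positivity) h2
    _ = ENNReal.ofReal (x / Real.sqrt w) := by
        rw [lintegral_const, Measure.restrict_apply_univ, Real.volume_Icc,
          ← ENNReal.ofReal_mul (by positivity)]
        congr 1; field_simp; ring

variable {pz : ℕ} {S : Matrix (Fin pz) (Fin pz) ℝ}

theorem measureReal_coord_multivariateGaussian (hS : S.PosSemidef) (j : Fin pz) {s : Set ℝ}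
    (hs : MeasurableSet s) :
    (multivariateGaussian 0 S).real {η : EuclideanSpace ℝ (Fin pz) | η j ∈ s} =
      (gaussianReal 0 (S j j).toNNReal).real s := by
  have h := (measurePreserving_eval_multivariateGaussian (μ := 0) hS (i := j)).measureReal_preimage
    hs.nullMeasurableSet
  simpa [Set.preimage] using h

theorem measurableSet_norm_le (x : ℝ) :
    MeasurableSet {η : EuclideanSpace ℝ (Fin pz) | ‖WithLp.ofLp η‖ ≤ x} :=
  measurableSet_le (by fun_prop) measurable_const

theorem le_measureReal_norm_le {V α x : ℝ} (hS : S.PosSemidef) (hV : 0 < V) (hx : 0 ≤ x)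
    (hdiag : ∀ j, S j j ≤ V) (hα : pz * (2 * Real.exp (-x ^ 2 / (2 * V))) ≤ α) :
    1 - α ≤ (multivariateGaussian 0 S).real
      {η : EuclideanSpace ℝ (Fin pz) | ‖WithLp.ofLp η‖ ≤ x} := by
  have hcompl : (multivariateGaussian 0 S).real
      {η : EuclideanSpace ℝ (Fin pz) | ‖WithLp.ofLp η‖ ≤ x}ᶜ ≤ α := by
    have hincl : {η : EuclideanSpace ℝ (Fin pz) | ‖WithLp.ofLp η‖ ≤ x}ᶜ ⊆
        ⋃ j, {η : EuclideanSpace ℝ (Fin pz) | η j ∈ {y : ℝ | x < |y|}} := by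
      intro η hη
      by_contra hcon
      rw [Set.mem_compl_iff, Set.mem_ofPred_eq] at hη
      refine hη ((pi_norm_le_iff_of_nonneg hx).2 fun j => ?_)
      by_contra h
      refine hcon (Set.mem_iUnion.2 ⟨j, ?_⟩)
      simpa using h
    refine (measureReal_mono hincl).trans ((measureReal_iUnion_fintype_le _).trans ?_)
    refine le_trans (Finset.sum_le_sum
      (g := fun _ => 2 * Real.exp (-x ^ 2 / (2 * V))) fun j _ => ?_) (le_trans (le_of_eq ?_) hα)
    · rw [measureReal_coord_multivariateGaussian hS j
        (measurableSet_lt measurable_const measurable_abs)]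
      refine gaussianReal_abs_gt_le ?_ hV hx
      rw [Real.coe_toNNReal']
      exact max_le (hdiag j) hV.le
    · simp
  rw [probReal_compl_eq_one_sub (measurableSet_norm_le x)] at hcompl
  linarith

/-- The maximum dominates the single coordinate `j`, so one variance bounded from below prevents
concentration near zero. -/
theorem measureReal_norm_le_le {w x : ℝ} (hS : S.PosSemidef) (hw : 0 < w) (hx : 0 ≤ x)
    (j : Fin pz) (hdiag : w ≤ S j j) :
    (multivariateGaussian 0 S).real {η : EuclideanSpace ℝ (Fin pz) | ‖WithLp.ofLp η‖ ≤ x} ≤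
      x / Real.sqrt w := by
  have hincl : {η : EuclideanSpace ℝ (Fin pz) | ‖WithLp.ofLp η‖ ≤ x} ⊆
      {η : EuclideanSpace ℝ (Fin pz) | η j ∈ {y : ℝ | |y| ≤ x}} := fun η hη => by
    rw [Set.mem_ofPred_eq] at *
    rw [Set.mem_ofPred_eq]
    exact (norm_le_pi_norm (WithLp.ofLp η) j).trans hη
  refine (measureReal_mono hincl).trans ?_
  rw [measureReal_coord_multivariateGaussian hS j
    (measurableSet_le measurable_abs measurable_const)]
  refine gaussianReal_abs_le_le hw ?_ hx
  exact hdiag.trans (Real.le_coe_toNNReal _)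

variable {n px : ℕ} {d : Data n px pz} {E : Estimates px pz}

theorem posSemidef_VHat : (VHat d E).PosSemidef := by
  rw [VHat]
  refine Matrix.PosSemidef.smul ?_ (by positivity)
  have h : (∑ i, (resid d E i) ^ 2 • Matrix.vecMulVec (d.W i) (d.W i)).PosSemidef := by
    refine Matrix.posSemidef_sum _ fun i _ => Matrix.PosSemidef.smul ?_ (sq_nonneg _)
    simpa using Matrix.posSemidef_vecMulVec_self_star (d.W i)
  have h2 := h.mul_mul_conjTranspose_same (A0Hat d E * OmHatZ E)
  rw [conjTranspose_eq_transpose_of_trivial, transpose_mul] at h2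
  simpa only [Matrix.mul_assoc] using h2

theorem nonneg_of_mem_quantileSet {α x : ℝ} (hα : α < 1)
    (h : 1 - α ≤ (multivariateGaussian 0 S).real
      {η : EuclideanSpace ℝ (Fin pz) | ‖WithLp.ofLp η‖ ≤ x}) : 0 ≤ x := by
  by_contra hx
  have : {η : EuclideanSpace ℝ (Fin pz) | ‖WithLp.ofLp η‖ ≤ x} = ∅ := by
    ext η
    simp only [Set.mem_ofPred_eq, Set.mem_empty_iff_false, iff_false, not_le]
    exact (not_le.1 hx).trans_le (norm_nonneg _)
  rw [this, measureReal_empty] at h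
  linarith

/-- A union bound over the coordinates puts `x` into the set whose infimum is the critical value.
That set is bounded below by `0` because `α < 1` excludes negative radii. -/
theorem cv_le {V α x : ℝ} (hV : 0 < V) (hα : α < 1) (hx : 0 ≤ x)
    (hdiag : ∀ j, VHat d E j j ≤ V) (hp : pz * (2 * Real.exp (-x ^ 2 / (2 * V))) ≤ α) :
    cv d E α ≤ x := by
  have hS := posSemidef_VHat (d := d) (E := E)
  rw [cv]
  generalize VHat d E = S at *
  refine csInf_le ⟨0, fun y hy => ?_⟩ ?_
  · rw [Set.mem_ofPred_eq] at hy
    exact nonneg_of_mem_quantileSet hα hy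
  · rw [Set.mem_ofPred_eq]
    exact le_measureReal_norm_le hS hV hx hdiag hp

theorem le_cv {w α : ℝ} (hw : 0 < w) (hα0 : 0 < α) (hα : α < 1) {j : Fin pz}
    (hdiag : w ≤ VHat d E j j) : (1 - α) * Real.sqrt w ≤ cv d E α := by
  have hw' := Real.sqrt_pos.2 hw
  have hS := posSemidef_VHat (d := d) (E := E)
  rw [cv]
  generalize VHat d E = S at *
  -- Nonemptiness has to be shown, since the infimum of the empty set would be the default value
  -- `0`. Any upper bound `V` for the diagonal serves.
  refine le_csInf ?_ fun x hx => ?_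
  · set V := ∑ j, |S j j| + 1 with hV
    have hV0 : 0 < V := by positivity
    have hlim : Tendsto (fun x : ℝ => (pz : ℝ) * (2 * Real.exp (-x ^ 2 / (2 * V)))) atTop (𝓝 0) := by
      have h1 : Tendsto (fun x : ℝ => -x ^ 2 / (2 * V)) atTop atBot := by
        simp only [neg_div]
        exact tendsto_neg_atTop_atBot.comp
          ((tendsto_pow_atTop two_ne_zero).atTop_div_const (by positivity))
      simpa using (((Real.tendsto_exp_atBot.comp h1).const_mul 2).const_mul (pz : ℝ))
    obtain ⟨x, hx, hx0⟩ := ((hlim.eventually (gt_mem_nhds hα0)).and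
      (eventually_ge_atTop (0 : ℝ))).exists
    refine ⟨x, ?_⟩
    rw [Set.mem_ofPred_eq]
    refine le_measureReal_norm_le hS hV0 hx0 (fun j => ?_) hx.le
    have := Finset.single_le_sum (f := fun j => |S j j|) (fun _ _ => abs_nonneg _)
      (Finset.mem_univ j)
    have h2 := le_abs_self (S j j)
    have h3 : |S j j| ≤ ∑ j, |S j j| := this
    linarith
  · rw [Set.mem_ofPred_eq] at hx
    have hx0 := nonneg_of_mem_quantileSet hα hx
    have := le_trans hx (measureReal_norm_le_le hS hw hx0 j hdiag)
    rwa [le_div_iff₀ hw'] at this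

end GaussianQuantile

/-! ### Sub-Gaussian building blocks -/

section Tails

variable {Ω : Type u} {mΩ : MeasurableSpace Ω} {P : Measure Ω} [IsProbabilityMeasure P]

/-- If `|x y| > s`, one of the factors exceeds `√s`. -/
theorem tail_mul_le {x y : Ω → ℝ} {g h : ℝ → ℝ} {s : ℝ} (hs : 0 < s)
    (hx : ∀ t, 0 < t → P.real {ω | t < |x ω|} ≤ g t)
    (hy : ∀ t, 0 < t → P.real {ω | t < |y ω|} ≤ h t) :
    P.real {ω | s < |x ω * y ω|} ≤ g (Real.sqrt s) + h (Real.sqrt s) := by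
  have hsub : {ω | s < |x ω * y ω|} ⊆
      {ω | Real.sqrt s < |x ω|} ∪ {ω | Real.sqrt s < |y ω|} := by
    intro ω hω
    simp only [Set.mem_ofPred_eq, Set.mem_union] at hω ⊢
    by_contra hcon
    push Not at hcon
    have := mul_le_mul hcon.1 hcon.2 (abs_nonneg _) (Real.sqrt_nonneg _)
    rw [Real.mul_self_sqrt hs.le, ← abs_mul] at this
    linarith
  exact (measureReal_mono hsub).trans ((measureReal_union_le _ _).trans
    (add_le_add (hx _ (Real.sqrt_pos.2 hs)) (hy _ (Real.sqrt_pos.2 hs))))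

/-- Splitting the product twice leaves each factor at level `t^{1/4}`; its Gaussian tail then decays
like `exp (-c √t)`. -/
theorem tail_four_mul_le {C c : ℝ} {x y z w : Ω → ℝ}
    (hx : ∀ t, 0 < t → P.real {ω | t < |x ω|} ≤ C * Real.exp (-c * t ^ 2))
    (hy : ∀ t, 0 < t → P.real {ω | t < |y ω|} ≤ C * Real.exp (-c * t ^ 2))
    (hz : ∀ t, 0 < t → P.real {ω | t < |z ω|} ≤ C * Real.exp (-c * t ^ 2))
    (hw : ∀ t, 0 < t → P.real {ω | t < |w ω|} ≤ C * Real.exp (-c * t ^ 2)) {t : ℝ} (ht : 0 < t) :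
    P.real {ω | t < |x ω * y ω * (z ω * w ω)|} ≤ 4 * C * Real.exp (-c * Real.sqrt t) := by
  refine (tail_mul_le ht (fun s hs => tail_mul_le hs hx hy)
    (fun s hs => tail_mul_le hs hz hw)).trans (le_of_eq ?_)
  rw [Real.sq_sqrt (Real.sqrt_nonneg t)]; ring

end Tails

/-! ### Features of one observation and their tails. -/

section Population

variable {K : Constants} {n : ℕ} {M : Design.{u} n}

theorem abs_average_le {f : Fin n → ℝ} {B : ℝ} (hB : 0 ≤ B) (h : ∀ i, |f i| ≤ B) :
    |(1 / (n : ℝ)) * ∑ i, f i| ≤ B := by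
  rcases Nat.eq_zero_or_pos n with rfl | hn
  · simpa
  have hn' : (0 : ℝ) < n := Nat.cast_pos.2 hn
  rw [abs_mul, abs_of_pos (by positivity), one_div, inv_mul_le_iff₀ hn']
  refine (Finset.abs_sum_le_sum_abs _ _).trans ((Finset.sum_le_sum fun i _ => h i).trans ?_)
  simp

/-- The triple observed at index `i`. -/
def Design.obs (M : Design.{u} n) (i : Fin n) (ω : M.S) : (Idx M.px M.pz → ℝ) × ℝ × ℝ :=
  (M.W i ω, (M.e i ω, M.eps2 i ω))

/-- The sub-Gaussian functionals of one observation that enter the analysis: the coordinates of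
`W_i`, the coordinates of `Ωᵀ W_i`, the two errors, and the constant `1`. -/
noncomputable def Design.feature (M : Design.{u} n) :
    (Idx M.px M.pz ⊕ Idx M.px M.pz) ⊕ Fin 3 → (Idx M.px M.pz → ℝ) × ℝ × ℝ → ℝ
  | Sum.inl (Sum.inl j), x => x.1 j
  | Sum.inl (Sum.inr k), x => (fun l => M.Om l k) ⬝ᵥ x.1
  | Sum.inr 0, x => x.2.1
  | Sum.inr 1, x => x.2.2
  | Sum.inr 2, _ => 1

/-- Products of four features. -/
noncomputable def Design.prodFeature (M : Design.{u} n)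
    (l : Fin 4 → (Idx M.px M.pz ⊕ Idx M.px M.pz) ⊕ Fin 3)
    (x : (Idx M.px M.pz → ℝ) × ℝ × ℝ) : ℝ :=
  M.feature (l 0) x * M.feature (l 1) x * (M.feature (l 2) x * M.feature (l 3) x)

/-- All averages of products of four features are within `τ √(log p / n)` of their means. -/
def GoodEvent (τ : ℝ) (M : Design.{u} n) (ω : M.S) : Prop :=
  ∀ l, |(1 / (n : ℝ)) * ∑ i, M.prodFeature l (M.obs i ω) -
    (1 / (n : ℝ)) * ∑ i, ∫ ω', M.prodFeature l (M.obs i ω') ∂M.P| ≤ τ * M.rate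

theorem measurable_feature (l : (Idx M.px M.pz ⊕ Idx M.px M.pz) ⊕ Fin 3) :
    Measurable (M.feature l) := by
  rcases l with (j | k) | a
  · exact (measurable_pi_apply j).comp measurable_fst
  · change Measurable fun x : (Idx M.px M.pz → ℝ) × ℝ × ℝ => ∑ l, M.Om l k * x.1 l
    exact Finset.measurable_sum _ fun l _ =>
      ((measurable_pi_apply l).comp measurable_fst).const_mul _
  · fin_cases a
    · exact measurable_fst.comp measurable_snd
    · exact measurable_snd.comp measurable_snd
    · exact measurable_const

theorem measurable_prodFeature (l : Fin 4 → (Idx M.px M.pz ⊕ Idx M.px M.pz) ⊕ Fin 3) :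
    Measurable (M.prodFeature l) :=
  ((measurable_feature _).mul (measurable_feature _)).mul
    ((measurable_feature _).mul (measurable_feature _))

theorem measurable_obs (hD : DesignAssumption K M) (hE : ErrorAssumption K M) (i : Fin n) :
    Measurable (M.obs i) :=
  (hD.meas i).prodMk ((hE.meas_e i).prodMk (hE.meas_eps2 i))

theorem isUnit_Sig (hO : M.Om.PosDef) : IsUnit M.Sig := by
  rw [← Matrix.isUnit_nonsing_inv_iff]
  exact hO.isUnit

theorem Sig_mul_Om (hO : M.Om.PosDef) : M.Sig * M.Om = 1 :=
  Matrix.mul_nonsing_inv _ ((Matrix.isUnit_iff_isUnit_det _).1 (isUnit_Sig hO))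

theorem Om_mul_Sig (hO : M.Om.PosDef) : M.Om * M.Sig = 1 :=
  Matrix.nonsing_inv_mul _ ((Matrix.isUnit_iff_isUnit_det _).1 (isUnit_Sig hO))

theorem Om_symm (hO : M.Om.PosDef) (j k : Idx M.px M.pz) : M.Om j k = M.Om k j := by
  have := hO.1.apply k j
  simpa using this

theorem Sig_symm (j k : Idx M.px M.pz) : M.Sig j k = M.Sig k j := by
  simp only [Design.Sig, Matrix.of_apply, mul_comm]

/-- With `b = Ω v`, so `Σ b = v`: `c_Σ ‖b‖² ≤ bᵀ Σ b = bᵀ v ≤ ‖b‖ ‖v‖`. Thus the columns of `Ω` have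
bounded length and the coordinates of `Ωᵀ W_i` are sub-Gaussian with absolute constants. -/
theorem l2norm_Om_mulVec_le (hD : DesignAssumption K M) (hO : M.Om.PosDef)
    (v : Idx M.px M.pz → ℝ) : l2norm (M.Om *ᵥ v) ≤ l2norm v / K.cSig := by
  set b := M.Om *ᵥ v with hb
  have h1 : M.Sig *ᵥ b = v := by rw [hb, mulVec_mulVec, Sig_mul_Om hO, one_mulVec]
  have h2 := hD.eigen_lower b
  rw [quad, bil, h1] at h2
  have h3 := le_of_abs_le (abs_dotProduct_le_l2norm b v)
  rw [le_div_iff₀ K.cSig_pos]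
  rcases (l2norm_nonneg b).eq_or_lt with h0 | h0
  · rw [← h0, zero_mul]; exact l2norm_nonneg _
  · refine le_of_mul_le_mul_left ?_ h0
    linarith

/-- With `b = Ω v`, the form `Σ` is nonnegative at `v - C_Σ b`. Expanding with `Σ b = v` and
bounding `vᵀ Σ v` by `C_Σ ‖v‖²` gives `‖v‖² ≤ C_Σ bᵀ v`. -/
theorem le_l2norm_Om_mulVec (hD : DesignAssumption K M) (hO : M.Om.PosDef)
    (v : Idx M.px M.pz → ℝ) : l2norm v / K.CSig ≤ l2norm (M.Om *ᵥ v) := by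
  set b := M.Om *ᵥ v with hb
  have hC : 0 < K.CSig := K.cSig_pos.trans_le K.cSig_le
  have h1 : M.Sig *ᵥ b = v := by rw [hb, mulVec_mulVec, Sig_mul_Om hO, one_mulVec]
  have hsym : ∀ x y : Idx M.px M.pz → ℝ, x ⬝ᵥ (M.Sig *ᵥ y) = y ⬝ᵥ (M.Sig *ᵥ x) := fun x y => by
    rw [dotProduct_mulVec, dotProduct_comm, ← mulVec_transpose]
    congr 2
    ext j k; exact Sig_symm k j
  have h2 : 0 ≤ quad M.Sig (v - K.CSig • b) :=
    le_trans (mul_nonneg K.cSig_pos.le (sq_nonneg _)) (hD.eigen_lower _)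
  have h3 : quad M.Sig (v - K.CSig • b) =
      quad M.Sig v - 2 * K.CSig * (v ⬝ᵥ v) + K.CSig ^ 2 * (b ⬝ᵥ v) := by
    simp only [quad, bil, mulVec_sub, mulVec_smul, dotProduct_sub, sub_dotProduct, smul_dotProduct,
      dotProduct_smul, smul_eq_mul, hsym b v, h1]
    ring
  have h4 := hD.eigen_upper v
  have h5 := le_of_abs_le (abs_dotProduct_le_l2norm b v)
  rw [h3, ← l2norm_sq_eq_dotProduct] at h2
  rw [div_le_iff₀ hC]
  rcases (l2norm_nonneg v).eq_or_lt with h0 | h0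
  · rw [← h0]; exact mul_nonneg (l2norm_nonneg _) hC.le
  · have h6 : K.CSig * l2norm v ^ 2 ≤ K.CSig * (K.CSig * (l2norm b * l2norm v)) := by
      have := mul_le_mul_of_nonneg_left h5 (sq_nonneg K.CSig)
      linarith
    have h7 := le_of_mul_le_mul_left h6 hC
    refine le_of_mul_le_mul_right ?_ h0
    linarith

theorem tail_dotProduct_le (hD : DesignAssumption K M) (i : Fin n) {v : Idx M.px M.pz → ℝ} {R : ℝ}
    (hv : l2norm v ≤ R) {t : ℝ} (ht : 0 < t) :
    M.P.real {ω | t < |v ⬝ᵥ M.W i ω|} ≤ K.C * Real.exp (-(K.c / R ^ 2) * t ^ 2) := by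
  rcases (l2norm_nonneg v).eq_or_lt with h0 | h0
  · have hv0 : v = 0 := by
      by_contra h
      exact (l2norm_pos h).ne h0
    have : {ω | t < |v ⬝ᵥ M.W i ω|} = ∅ := by
      ext ω
      simp [hv0, ht.le]
    rw [this, measureReal_empty]
    exact mul_nonneg K.C_pos.le (Real.exp_pos _).le
  · have h1 : l2norm ((l2norm v)⁻¹ • v) = 1 := by
      rw [l2norm_smul, abs_of_pos (inv_pos.2 h0), inv_mul_cancel₀ h0.ne']
    have h2 := hD.subGaussian i _ h1 ((l2norm v)⁻¹ * t) (by positivity)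
    have h3 : {ω | (l2norm v)⁻¹ * t < |((l2norm v)⁻¹ • v) ⬝ᵥ M.W i ω|} =
        {ω | t < |v ⬝ᵥ M.W i ω|} := by
      ext ω
      simp only [Set.mem_ofPred_eq, smul_dotProduct, smul_eq_mul, abs_mul,
        abs_of_pos (inv_pos.2 h0)]
      exact mul_lt_mul_iff_right₀ (inv_pos.2 h0)
    rw [h3] at h2
    refine h2.trans (mul_le_mul_of_nonneg_left (Real.exp_le_exp.2 ?_) K.C_pos.le)
    have hR2 : l2norm v ^ 2 ≤ R ^ 2 := pow_le_pow_left₀ h0.le hv 2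
    have h4 : K.c / R ^ 2 * t ^ 2 ≤ K.c / l2norm v ^ 2 * t ^ 2 := by
      refine mul_le_mul_of_nonneg_right ?_ (sq_nonneg _)
      exact div_le_div_of_nonneg_left K.c_pos.le (by positivity) hR2
    have h5 : K.c * ((l2norm v)⁻¹ * t) ^ 2 = K.c / l2norm v ^ 2 * t ^ 2 := by
      rw [mul_pow, inv_pow, div_eq_mul_inv]; ring
    linarith

theorem exists_feature_tail (K : Constants) : ∃ B b : ℝ, 0 < B ∧ 0 < b ∧
    ∀ {n : ℕ} {M : Design.{u} n}, DesignAssumption K M → ErrorAssumption K M → M.Om.PosDef →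
    ∀ (i : Fin n) l (t : ℝ), 0 < t →
      M.P.real {ω | t < |M.feature l (M.obs i ω)|} ≤ B * Real.exp (-b * t ^ 2) := by
  -- `R` dominates both the length `1` of coordinate vectors and the length `1 / c_Σ` of the columns
  -- of `Ω`.
  set R := 1 + 1 / K.cSig with hRdef
  have hc := K.cSig_pos
  have hKc := K.c_pos
  have hKC := K.C_pos
  have hR1 : 1 ≤ R := by
    have : 0 < 1 / K.cSig := by positivity
    linarith
  have hR0 : 0 < R := by linarith
  set b := K.c / R ^ 2 with hb
  have hb0 : 0 < b := by positivity
  have hbc : b ≤ K.c := div_le_self hKc.le (one_le_pow₀ hR1)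
  -- The value `exp b` is there for the constant feature: it makes the bound at least `1` for `t <
  -- 1`, where the tail probability is `1`.
  refine ⟨max K.C (Real.exp b), b, lt_max_of_lt_left hKC, hb0, ?_⟩
  intro n M hD hE hO i l t ht
  have hle : K.C * Real.exp (-b * t ^ 2) ≤ max K.C (Real.exp b) * Real.exp (-b * t ^ 2) :=
    mul_le_mul_of_nonneg_right (le_max_left _ _) (Real.exp_pos _).le
  have hce : K.C * Real.exp (-K.c * t ^ 2) ≤ K.C * Real.exp (-b * t ^ 2) := by
    refine mul_le_mul_of_nonneg_left (Real.exp_le_exp.2 ?_) hKC.le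
    have := mul_le_mul_of_nonneg_right hbc (sq_nonneg t)
    linarith
  rcases l with (j | k) | a
  · have h1 := tail_dotProduct_le hD i (v := Pi.single j 1) (R := R) (by
      refine le_trans (le_of_eq ?_) hR1
      simp [l2norm, Pi.single_apply]) ht
    simp only [single_dotProduct, one_mul] at h1
    exact h1.trans hle
  · refine le_trans (tail_dotProduct_le hD i (R := R) ?_ ht) hle
    have h1 := l2norm_Om_mulVec_le hD hO (Pi.single k 1)
    have h2 : l2norm (Pi.single k 1 : Idx M.px M.pz → ℝ) = 1 := by
      simp [l2norm, Pi.single_apply]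
    rw [h2] at h1
    have h3 : M.Om *ᵥ Pi.single k 1 = fun l => M.Om l k := by
      rw [mulVec_single_one]; rfl
    rw [h3] at h1
    linarith
  · fin_cases a
    · exact (hE.tail_e i t ht).trans (hce.trans hle)
    · exact (hE.tail_eps2 i t ht).trans (hce.trans hle)
    · simp only [Design.feature, abs_one]
      by_cases h : t < 1
      · simp only [h]
        refine (measureReal_le_one).trans ?_
        refine le_trans ?_ (mul_le_mul_of_nonneg_right (le_max_right _ _) (Real.exp_pos _).le)
        rw [← Real.exp_add, Real.one_le_exp_iff]
        have := pow_le_one₀ (n := 2) ht.le h.le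
        nlinarith
      · simp only [h, Set.ofPred_false, measureReal_empty]
        positivity

theorem exists_prodFeature_bounds (K : Constants) : ∃ B b V : ℝ, 0 < B ∧ 0 < b ∧ 0 < V ∧
    ∀ {n : ℕ} {M : Design.{u} n}, DesignAssumption K M → ErrorAssumption K M → M.Om.PosDef →
    ∀ (i : Fin n) l,
      (∀ t : ℝ, 1 ≤ t →
        M.P.real {ω | t < |M.prodFeature l (M.obs i ω)|} ≤ B * Real.exp (-b * Real.sqrt t)) ∧
      Integrable (fun ω => M.prodFeature l (M.obs i ω) ^ 2) M.P ∧
      ∫ ω, M.prodFeature l (M.obs i ω) ^ 2 ∂M.P ≤ V := by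
  obtain ⟨B, b, hB, hb, h⟩ := exists_feature_tail.{u} K
  obtain ⟨V, hV, hV'⟩ := exists_second_moment_bound.{u} (B := 4 * B) (b := b) (by positivity) hb
  refine ⟨4 * B, b, V, by positivity, hb, hV, fun {n M} hD hE hO i l => ?_⟩
  have ht : ∀ t : ℝ, 1 ≤ t → M.P.real {ω | t < |M.prodFeature l (M.obs i ω)|} ≤
      4 * B * Real.exp (-b * Real.sqrt t) := fun t ht =>
    tail_four_mul_le (h hD hE hO i (l 0)) (h hD hE hO i (l 1)) (h hD hE hO i (l 2))
      (h hD hE hO i (l 3)) (one_pos.trans_le ht)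
  exact ⟨ht, hV' M.P _ ((measurable_prodFeature l).comp (measurable_obs hD hE i)) ht⟩

end Population

/-! ### Conditional moments and population means -/

section ConditionalMoments

variable {Ω : Type u} {m m0 : MeasurableSpace Ω} {P : Measure Ω} [IsProbabilityMeasure P]

theorem integral_mul_eq_integral_mul_condExp (hm : m ≤ m0) {G f : Ω → ℝ}
    (hG : StronglyMeasurable[m] G) (hf : Integrable f P) (hGf : Integrable (G * f) P) :
    Integrable (G * P[f | m]) P ∧ ∫ ω, (G * f) ω ∂P = ∫ ω, (G * P[f | m]) ω ∂P := by
  have h := condExp_mul_of_stronglyMeasurable_left hG hGf hf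
  exact ⟨(integrable_congr h).1 integrable_condExp,
    by rw [← integral_condExp hm, integral_congr_ae h]⟩

/-- Used with `G = (bᵀ W_i)²` and `f` the squared error, so that the conditional variance
assumptions control the weighted second moments in `V̂_A`. -/
theorem integral_mul_le_of_condExp_le (hm : m ≤ m0) {G f : Ω → ℝ} {c : ℝ}
    (hG : StronglyMeasurable[m] G) (hG0 : ∀ ω, 0 ≤ G ω) (hGi : Integrable G P)
    (hf : Integrable f P) (hGf : Integrable (G * f) P) (h : ∀ᵐ ω ∂P, (P[f | m]) ω ≤ c) :
    ∫ ω, (G * f) ω ∂P ≤ c * ∫ ω, G ω ∂P := by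
  obtain ⟨h1, h2⟩ := integral_mul_eq_integral_mul_condExp hm hG hf hGf
  rw [h2, ← integral_const_mul]
  refine integral_mono_ae h1 (hGi.const_mul c) ?_
  filter_upwards [h] with ω hω
  rw [Pi.mul_apply, mul_comm]
  exact mul_le_mul_of_nonneg_right hω (hG0 ω)

theorem le_integral_mul_of_le_condExp (hm : m ≤ m0) {G f : Ω → ℝ} {c : ℝ}
    (hG : StronglyMeasurable[m] G) (hG0 : ∀ ω, 0 ≤ G ω) (hGi : Integrable G P)
    (hf : Integrable f P) (hGf : Integrable (G * f) P) (h : ∀ᵐ ω ∂P, c ≤ (P[f | m]) ω) :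
    c * ∫ ω, G ω ∂P ≤ ∫ ω, (G * f) ω ∂P := by
  obtain ⟨h1, h2⟩ := integral_mul_eq_integral_mul_condExp hm hG hf hGf
  rw [h2, ← integral_const_mul]
  refine integral_mono_ae (hGi.const_mul c) h1 ?_
  filter_upwards [h] with ω hω
  rw [Pi.mul_apply, mul_comm]
  exact mul_le_mul_of_nonneg_left hω (hG0 ω)

end ConditionalMoments

section Means

variable {K : Constants} {n : ℕ} {M : Design.{u} n}

theorem integrable_prodFeature (hD : DesignAssumption K M) (hE : ErrorAssumption K M)
    (hO : M.Om.PosDef) (i : Fin n) (l : Fin 4 → (Idx M.px M.pz ⊕ Idx M.px M.pz) ⊕ Fin 3) :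
    Integrable (fun ω => M.prodFeature l (M.obs i ω)) M.P := by
  obtain ⟨B, b, V, -, -, -, h⟩ := exists_prodFeature_bounds.{u} K
  have h2 := (h hD hE hO i l).2.1
  have h1 : MemLp (fun ω => M.prodFeature l (M.obs i ω)) 2 M.P :=
    (memLp_two_iff_integrable_sq
      ((measurable_prodFeature l).comp (measurable_obs hD hE i)).aestronglyMeasurable).2 h2
  exact h1.integrable (by norm_num)

theorem abs_integral_prodFeature_le {V : ℝ} {i : Fin n}
    {l : Fin 4 → (Idx M.px M.pz ⊕ Idx M.px M.pz) ⊕ Fin 3}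
    (hi : Integrable (fun ω => M.prodFeature l (M.obs i ω)) M.P)
    (hi2 : Integrable (fun ω => M.prodFeature l (M.obs i ω) ^ 2) M.P)
    (hV : ∫ ω, M.prodFeature l (M.obs i ω) ^ 2 ∂M.P ≤ V) :
    |∫ ω, M.prodFeature l (M.obs i ω) ∂M.P| ≤ 1 + V := by
  refine (abs_integral_le_integral_abs).trans ?_
  calc ∫ ω, |M.prodFeature l (M.obs i ω)| ∂M.P
      ≤ ∫ ω, (1 + M.prodFeature l (M.obs i ω) ^ 2) ∂M.P := by
        refine integral_mono hi.abs ((integrable_const _).add hi2) fun ω => ?_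
        have := sq_nonneg (|M.prodFeature l (M.obs i ω)| - 1)
        have h2 := sq_abs (M.prodFeature l (M.obs i ω))
        have h3 := abs_nonneg (M.prodFeature l (M.obs i ω))
        simp only
        nlinarith
    _ ≤ 1 + V := by
        rw [integral_add (integrable_const _) hi2]
        simpa using hV

theorem sigW_le (hD : DesignAssumption K M) (i : Fin n) : M.sigW i ≤ M.mS :=
  (hD.meas i).comap_le

theorem integrable_W_mul (hD : DesignAssumption K M) (hE : ErrorAssumption K M)
    (hO : M.Om.PosDef) (i : Fin n) (j k : Idx M.px M.pz) :
    Integrable (fun ω => M.W i ω j * M.W i ω k) M.P := by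
  have := integrable_prodFeature hD hE hO i
    ![Sum.inl (Sum.inl j), Sum.inl (Sum.inl k), Sum.inr 2, Sum.inr 2]
  simpa [Design.prodFeature, Design.feature, Design.obs] using this

theorem integral_W_mul (hD : DesignAssumption K M) (i : Fin n) (j k : Idx M.px M.pz) :
    ∫ ω, M.W i ω j * M.W i ω k ∂M.P = M.Sig j k := by
  have h : Measurable fun w : Idx M.px M.pz → ℝ => w j * w k :=
    (measurable_pi_apply j).mul (measurable_pi_apply k)
  rw [Design.Sig, Matrix.of_apply, ← hD.identDistrib i,
    integral_map (hD.meas i).aemeasurable h.aestronglyMeasurable]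

theorem dotProduct_sq_mul {κ : Type} [Fintype κ] (b w : κ → ℝ) (u : ℝ) :
    (b ⬝ᵥ w) ^ 2 * u = ∑ j, ∑ k, b j * b k * (w j * w k * u) := by
  rw [sq, dotProduct, Finset.sum_mul_sum, Finset.sum_mul]
  refine Finset.sum_congr rfl fun j _ => ?_
  rw [Finset.sum_mul]
  exact Finset.sum_congr rfl fun k _ => by ring

theorem abs_sum_mul_mul_le {κ : Type} [Fintype κ] {S : κ → κ → ℝ} {B : ℝ}
    (hS : ∀ j k, |S j k| ≤ B) (b : κ → ℝ) :
    |∑ j, ∑ k, b j * b k * S j k| ≤ l1norm b ^ 2 * B := by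
  have h := abs_quadForm_le (S := Matrix.of S) hS b b
  refine le_trans (le_of_eq ?_) (h.trans (le_of_eq (by ring)))
  congr 1
  simp only [dotProduct, mulVec, Matrix.of_apply, Finset.mul_sum]
  exact Finset.sum_congr rfl fun j _ => Finset.sum_congr rfl fun k _ => by ring

theorem integral_dotProduct_sq (hD : DesignAssumption K M) (hE : ErrorAssumption K M)
    (hO : M.Om.PosDef) (i : Fin n) (b : Idx M.px M.pz → ℝ) :
    Integrable (fun ω => (b ⬝ᵥ M.W i ω) ^ 2) M.P ∧
      ∫ ω, (b ⬝ᵥ M.W i ω) ^ 2 ∂M.P = quad M.Sig b := by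
  have h1 : ∀ ω, (b ⬝ᵥ M.W i ω) ^ 2 = ∑ j, ∑ k, b j * b k * (M.W i ω j * M.W i ω k) := fun ω => by
    have := dotProduct_sq_mul b (M.W i ω) 1
    simpa using this
  simp only [h1]
  have hi : ∀ j k, Integrable (fun ω => b j * b k * (M.W i ω j * M.W i ω k)) M.P := fun j k =>
    (integrable_W_mul hD hE hO i j k).const_mul _
  refine ⟨integrable_finsetSum _ fun j _ => integrable_finsetSum _ fun k _ => hi j k, ?_⟩
  rw [integral_finsetSum _ fun j _ => integrable_finsetSum _ fun k _ => hi j k]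
  simp only [quad, bil, dotProduct, mulVec, Finset.mul_sum]
  refine Finset.sum_congr rfl fun j _ => ?_
  rw [integral_finsetSum _ fun k _ => hi j k]
  refine Finset.sum_congr rfl fun k _ => ?_
  rw [integral_const_mul, integral_W_mul hD]
  ring

theorem integrable_W_mul_W_mul (hD : DesignAssumption K M) (hE : ErrorAssumption K M)
    (hO : M.Om.PosDef) (i : Fin n) (j k : Idx M.px M.pz) :
    Integrable (fun ω => M.W i ω j * M.W i ω k * (M.e i ω * M.e i ω)) M.P ∧
    Integrable (fun ω => M.W i ω j * M.W i ω k * (M.e i ω * M.eps2 i ω)) M.P ∧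
    Integrable (fun ω => M.W i ω j * M.W i ω k * (M.eps2 i ω * M.eps2 i ω)) M.P := by
  have h1 := integrable_prodFeature hD hE hO i
    ![Sum.inl (Sum.inl j), Sum.inl (Sum.inl k), Sum.inr 0, Sum.inr 0]
  have h2 := integrable_prodFeature hD hE hO i
    ![Sum.inl (Sum.inl j), Sum.inl (Sum.inl k), Sum.inr 0, Sum.inr 1]
  have h3 := integrable_prodFeature hD hE hO i
    ![Sum.inl (Sum.inl j), Sum.inl (Sum.inl k), Sum.inr 1, Sum.inr 1]
  exact ⟨h1, h2, h3⟩

theorem integrable_errors (hD : DesignAssumption K M) (hE : ErrorAssumption K M)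
    (hO : M.Om.PosDef) (i : Fin n) :
    Integrable (M.e i) M.P ∧ Integrable (M.eps2 i) M.P ∧
    Integrable (fun ω => M.e i ω * M.e i ω) M.P ∧
    Integrable (fun ω => M.e i ω * M.eps2 i ω) M.P ∧
    Integrable (fun ω => M.eps2 i ω * M.eps2 i ω) M.P := by
  have h := fun l => integrable_prodFeature hD hE hO i l
  have h1 := h ![Sum.inr 0, Sum.inr 2, Sum.inr 2, Sum.inr 2]
  have h2 := h ![Sum.inr 1, Sum.inr 2, Sum.inr 2, Sum.inr 2]
  have h3 := h ![Sum.inr 0, Sum.inr 0, Sum.inr 2, Sum.inr 2]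
  have h4 := h ![Sum.inr 0, Sum.inr 1, Sum.inr 2, Sum.inr 2]
  have h5 := h ![Sum.inr 1, Sum.inr 1, Sum.inr 2, Sum.inr 2]
  simp only [Design.prodFeature, Design.feature, Design.obs, Matrix.cons_val, mul_one]
    at h1 h2 h3 h4 h5
  exact ⟨h1, h2, h3, h4, h5⟩

theorem integral_W_mul_error_eq_zero (hD : DesignAssumption K M) (hE : ErrorAssumption K M)
    (hO : M.Om.PosDef) (i : Fin n) (j : Idx M.px M.pz) :
    ∫ ω, M.W i ω j * M.e i ω ∂M.P = 0 ∧ ∫ ω, M.W i ω j * M.eps2 i ω ∂M.P = 0 := by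
  have hW : StronglyMeasurable[M.sigW i] fun ω => M.W i ω j :=
    ((measurable_pi_apply j).comp (comap_measurable (M.W i))).stronglyMeasurable
  obtain ⟨he, he2, -⟩ := integrable_errors hD hE hO i
  have h := fun l => integrable_prodFeature hD hE hO i l
  have h1 := h ![Sum.inl (Sum.inl j), Sum.inr 0, Sum.inr 2, Sum.inr 2]
  have h2 := h ![Sum.inl (Sum.inl j), Sum.inr 1, Sum.inr 2, Sum.inr 2]
  simp only [Design.prodFeature, Design.feature, Design.obs, Matrix.cons_val, mul_one] at h1 h2
  constructor
  · refine ((integral_mul_eq_integral_mul_condExp (sigW_le hD i) hW he h1).2).trans ?_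
    refine integral_eq_zero_of_ae ?_
    filter_upwards [hE.mean_e i] with ω hω
    simp only [Pi.mul_apply, hω, Pi.zero_apply, mul_zero]
  · refine ((integral_mul_eq_integral_mul_condExp (sigW_le hD i) hW he2 h2).2).trans ?_
    refine integral_eq_zero_of_ae ?_
    filter_upwards [hE.mean_eps2 i] with ω hω
    simp only [Pi.mul_apply, hω, Pi.zero_apply, mul_zero]

theorem mean_eps1 (hD : DesignAssumption K M) (hE : ErrorAssumption K M)
    (hO : M.Om.PosDef) (i : Fin n) : M.P[M.eps1 i | M.sigW i] =ᵐ[M.P] 0 := by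
  obtain ⟨he, he2, -⟩ := integrable_errors hD hE hO i
  have h1 : M.eps1 i = M.β • M.eps2 i + M.e i := by
    ext ω; simp [Design.eps1, mul_comm]
  rw [h1]
  have h2 := condExp_add (he2.smul M.β) he (M.sigW i)
  have h3 := condExp_smul (μ := M.P) M.β (M.eps2 i) (M.sigW i)
  filter_upwards [h2, h3, hE.mean_e i, hE.mean_eps2 i] with ω h2 h3 h4 h5
  rw [h2, Pi.add_apply, h3, Pi.smul_apply, h4, h5]
  simp

/-- The conditional second moment of a combination of the two errors, given the row `W_i`. -/
theorem condExp_sq_bounds (hD : DesignAssumption K M) (hE : ErrorAssumption K M)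
    (hO : M.Om.PosDef) (i : Fin n) (r : ℝ) :
    ∀ᵐ ω ∂M.P, (1 - max K.rho 0) * K.sigMin ≤
        (M.P[fun ω => (M.e i ω + r * M.eps2 i ω) ^ 2 | M.sigW i]) ω ∧
      (M.P[fun ω => (M.e i ω + r * M.eps2 i ω) ^ 2 | M.sigW i]) ω ≤
        2 * K.sigMax * (1 + (r - M.β) ^ 2) := by
  obtain ⟨he, he2, hee, hee2, he22⟩ := integrable_errors hD hE hO i
  set t := r - M.β with ht
  have h11 : Integrable (M.eps1 i * M.eps1 i) M.P := by
    have : M.eps1 i * M.eps1 i = fun ω => M.β ^ 2 * (M.eps2 i ω * M.eps2 i ω) +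
        2 * M.β * (M.e i ω * M.eps2 i ω) + M.e i ω * M.e i ω := by
      ext ω; simp only [Design.eps1, Pi.mul_apply]; ring
    rw [this]
    exact ((he22.const_mul _).add (hee2.const_mul _)).add hee
  have h12 : Integrable (M.eps1 i * M.eps2 i) M.P := by
    have : M.eps1 i * M.eps2 i = fun ω => M.β * (M.eps2 i ω * M.eps2 i ω) +
        M.e i ω * M.eps2 i ω := by
      ext ω; simp only [Design.eps1, Pi.mul_apply]; ring
    rw [this]
    exact (he22.const_mul _).add hee2
  have h22 : Integrable (M.eps2 i * M.eps2 i) M.P := he22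
  -- Since `e + r ε₂ = ε₁ + t ε₂` with `t = r - β`, the assumptions on the reduced-form errors `ε₁,
  -- ε₂` apply.
  have hf : (fun ω => (M.e i ω + r * M.eps2 i ω) ^ 2) =
      M.eps1 i * M.eps1 i + (2 * t) • (M.eps1 i * M.eps2 i) + t ^ 2 • (M.eps2 i * M.eps2 i) := by
    ext ω
    simp only [Design.eps1, Pi.mul_apply, Pi.add_apply, Pi.smul_apply, smul_eq_mul, ht]
    ring
  rw [hf]
  have c1 := condExp_add (h11.add (h12.smul (2 * t))) (h22.smul (t ^ 2)) (M.sigW i)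
  have c2 := condExp_add h11 (h12.smul (2 * t)) (M.sigW i)
  have c3 := condExp_smul (μ := M.P) (2 * t) (M.eps1 i * M.eps2 i) (M.sigW i)
  have c4 := condExp_smul (μ := M.P) (t ^ 2) (M.eps2 i * M.eps2 i) (M.sigW i)
  have m1 := mean_eps1 hD hE hO i
  have m2 := hE.mean_eps2 i
  have v1 : condVar (M.sigW i) (M.eps1 i) M.P =ᵐ[M.P]
      M.P[M.eps1 i * M.eps1 i | M.sigW i] := by
    refine condExp_congr_ae ?_
    filter_upwards [m1] with ω h
    simp only [Pi.pow_apply, Pi.sub_apply, Pi.mul_apply, h, Pi.zero_apply]; ring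
  have v2 : condVar (M.sigW i) (M.eps2 i) M.P =ᵐ[M.P]
      M.P[M.eps2 i * M.eps2 i | M.sigW i] := by
    refine condExp_congr_ae ?_
    filter_upwards [m2] with ω h
    simp only [Pi.pow_apply, Pi.sub_apply, Pi.mul_apply, h, Pi.zero_apply]; ring
  have v12 : M.sigma12 i =ᵐ[M.P] M.P[M.eps1 i * M.eps2 i | M.sigW i] := by
    refine condExp_congr_ae ?_
    filter_upwards [m1, m2] with ω h h'
    simp only [Pi.sub_apply, Pi.mul_apply, h, h', Pi.zero_apply]; ring
  filter_upwards [c1, c2, c3, c4, v1, v2, v12, hE.var1 i, hE.var2 i, hE.corr i] with ω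
    c1 c2 c3 c4 v1 v2 v12 b1 b2 b12
  rw [c1, Pi.add_apply, c2, Pi.add_apply, c3, c4, Pi.smul_apply, Pi.smul_apply, ← v1, ← v2, ← v12]
  simp only [smul_eq_mul]
  set x := condVar (M.sigW i) (M.eps1 i) M.P ω
  set y := condVar (M.sigW i) (M.eps2 i) M.P ω
  set z := M.sigma12 i ω
  have hs := K.sigMin_pos
  have hx : 0 < x := hs.trans_le b1.1
  have hy : 0 < y := hs.trans_le b2.1
  have hx' := Real.sqrt_pos.2 hx
  have hy' := Real.sqrt_pos.2 hy
  have hz : |z| ≤ max K.rho 0 * (Real.sqrt x * Real.sqrt y) := by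
    rw [div_le_iff₀ (by positivity)] at b12
    exact b12.trans (mul_le_mul_of_nonneg_right (le_max_left _ _) (by positivity))
  have hρ0 : 0 ≤ max K.rho 0 := le_max_right _ _
  have hρ1 : max K.rho 0 < 1 := max_lt K.rho_lt one_pos
  -- The correlation bound and `2 |t| √x √y ≤ x + t² y` keep a fraction `1 - ρ` of `x + t² y`, hence
  -- of `x ≥ sigMin`, whatever `t` is. The maximum with `0` makes the factor nonnegative.
  have hcross : |2 * t * z| ≤ max K.rho 0 * (x + t ^ 2 * y) := by
    have h1 : 2 * |t| * (Real.sqrt x * Real.sqrt y) ≤ x + t ^ 2 * y := by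
      have := sq_nonneg (Real.sqrt x - |t| * Real.sqrt y)
      nlinarith [Real.sq_sqrt hx.le, Real.sq_sqrt hy.le, sq_abs t]
    rw [abs_mul, abs_mul, abs_two]
    calc 2 * |t| * |z| ≤ 2 * |t| * (max K.rho 0 * (Real.sqrt x * Real.sqrt y)) := by gcongr
      _ = max K.rho 0 * (2 * |t| * (Real.sqrt x * Real.sqrt y)) := by ring
      _ ≤ _ := by gcongr
  obtain ⟨hc1, hc2⟩ := abs_le.1 hcross
  have ht2 := sq_nonneg t
  constructor
  · have h1 : (1 - max K.rho 0) * K.sigMin ≤ (1 - max K.rho 0) * (x + t ^ 2 * y) := by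
      refine mul_le_mul_of_nonneg_left ?_ (by linarith)
      have := mul_nonneg ht2 hy.le
      linarith [b1.1]
    linarith
  · have h1 : max K.rho 0 * (x + t ^ 2 * y) ≤ 1 * (x + t ^ 2 * y) :=
      mul_le_mul_of_nonneg_right hρ1.le (by positivity)
    have h2 := mul_le_mul_of_nonneg_left b2.2 ht2
    linarith [b1.2]

/-- The mean of `(bᵀW_i)² (e_i + r ε_{i2})²`. -/
theorem integral_weighted_sq_bounds (hD : DesignAssumption K M) (hE : ErrorAssumption K M)
    (hO : M.Om.PosDef) (i : Fin n) (r : ℝ) (b : Idx M.px M.pz → ℝ) :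
    (1 - max K.rho 0) * K.sigMin * quad M.Sig b ≤
      ∫ ω, (b ⬝ᵥ M.W i ω) ^ 2 * (M.e i ω + r * M.eps2 i ω) ^ 2 ∂M.P ∧
    ∫ ω, (b ⬝ᵥ M.W i ω) ^ 2 * (M.e i ω + r * M.eps2 i ω) ^ 2 ∂M.P ≤
      2 * K.sigMax * (1 + (r - M.β) ^ 2) * quad M.Sig b ∧
    ∫ ω, (b ⬝ᵥ M.W i ω) ^ 2 * (M.e i ω + r * M.eps2 i ω) ^ 2 ∂M.P =
      ∑ j, ∑ k, b j * b k * (∫ ω, M.W i ω j * M.W i ω k * (M.e i ω * M.e i ω) ∂M.P +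
        2 * r * ∫ ω, M.W i ω j * M.W i ω k * (M.e i ω * M.eps2 i ω) ∂M.P +
        r ^ 2 * ∫ ω, M.W i ω j * M.W i ω k * (M.eps2 i ω * M.eps2 i ω) ∂M.P) := by
  obtain ⟨he, he2, hee, hee2, he22⟩ := integrable_errors hD hE hO i
  have hG : StronglyMeasurable[M.sigW i] fun ω => (b ⬝ᵥ M.W i ω) ^ 2 := by
    have : Measurable fun w : Idx M.px M.pz → ℝ => (b ⬝ᵥ w) ^ 2 := by
      refine Measurable.pow_const ?_ 2
      exact Finset.measurable_sum _ fun l _ => (measurable_pi_apply l).const_mul _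
    exact (this.comp (comap_measurable (M.W i))).stronglyMeasurable
  obtain ⟨hGi, hGq⟩ := integral_dotProduct_sq hD hE hO i b
  have hf : Integrable (fun ω => (M.e i ω + r * M.eps2 i ω) ^ 2) M.P := by
    have : (fun ω => (M.e i ω + r * M.eps2 i ω) ^ 2) = fun ω => M.e i ω * M.e i ω +
        2 * r * (M.e i ω * M.eps2 i ω) + r ^ 2 * (M.eps2 i ω * M.eps2 i ω) := by
      ext ω; ring
    rw [this]
    exact (hee.add (hee2.const_mul _)).add (he22.const_mul _)
  have hexp : ∀ ω, (b ⬝ᵥ M.W i ω) ^ 2 * (M.e i ω + r * M.eps2 i ω) ^ 2 =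
      ∑ j, ∑ k, b j * b k * (M.W i ω j * M.W i ω k * (M.e i ω * M.e i ω) +
        2 * r * (M.W i ω j * M.W i ω k * (M.e i ω * M.eps2 i ω)) +
        r ^ 2 * (M.W i ω j * M.W i ω k * (M.eps2 i ω * M.eps2 i ω))) := fun ω => by
    rw [dotProduct_sq_mul]
    refine Finset.sum_congr rfl fun j _ => Finset.sum_congr rfl fun k _ => by ring
  have hjk : ∀ j k, Integrable (fun ω => b j * b k *
      (M.W i ω j * M.W i ω k * (M.e i ω * M.e i ω) +
        2 * r * (M.W i ω j * M.W i ω k * (M.e i ω * M.eps2 i ω)) +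
        r ^ 2 * (M.W i ω j * M.W i ω k * (M.eps2 i ω * M.eps2 i ω)))) M.P := fun j k => by
    obtain ⟨i1, i2, i3⟩ := integrable_W_mul_W_mul hD hE hO i j k
    exact ((i1.add (i2.const_mul _)).add (i3.const_mul _)).const_mul _
  have hGf : Integrable ((fun ω => (b ⬝ᵥ M.W i ω) ^ 2) *
      fun ω => (M.e i ω + r * M.eps2 i ω) ^ 2) M.P := by
    have : ((fun ω => (b ⬝ᵥ M.W i ω) ^ 2) * fun ω => (M.e i ω + r * M.eps2 i ω) ^ 2) =
        fun ω => ∑ j, ∑ k, b j * b k * (M.W i ω j * M.W i ω k * (M.e i ω * M.e i ω) +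
        2 * r * (M.W i ω j * M.W i ω k * (M.e i ω * M.eps2 i ω)) +
        r ^ 2 * (M.W i ω j * M.W i ω k * (M.eps2 i ω * M.eps2 i ω))) := funext hexp
    rw [this]
    exact integrable_finsetSum _ fun j _ => integrable_finsetSum _ fun k _ => hjk j k
  have hb := condExp_sq_bounds hD hE hO i r
  have hG0 : ∀ ω, 0 ≤ (b ⬝ᵥ M.W i ω) ^ 2 := fun ω => sq_nonneg _
  refine ⟨?_, ?_, ?_⟩
  · rw [← hGq]
    exact le_integral_mul_of_le_condExp (sigW_le hD i) hG hG0 hGi hf hGf (hb.mono fun _ h => h.1)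
  · rw [← hGq]
    exact integral_mul_le_of_condExp_le (sigW_le hD i) hG hG0 hGi hf hGf (hb.mono fun _ h => h.2)
  · simp only [hexp]
    rw [integral_finsetSum _ fun j _ => integrable_finsetSum _ fun k _ => hjk j k]
    refine Finset.sum_congr rfl fun j _ => ?_
    rw [integral_finsetSum _ fun k _ => hjk j k]
    refine Finset.sum_congr rfl fun k _ => ?_
    obtain ⟨i1, i2, i3⟩ := integrable_W_mul_W_mul hD hE hO i j k
    have i12 : Integrable (fun ω => M.W i ω j * M.W i ω k * (M.e i ω * M.e i ω) +
        2 * r * (M.W i ω j * M.W i ω k * (M.e i ω * M.eps2 i ω))) M.P := i1.add (i2.const_mul _)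
    rw [integral_const_mul, integral_add i12 (i3.const_mul _), integral_add i1 (i2.const_mul _),
      integral_const_mul, integral_const_mul]

/-- The structural coefficient `β` is bounded by a constant. -/
theorem exists_beta_bound (K : Constants) : ∃ Cβ : ℝ, 0 < Cβ ∧
    ∀ {n : ℕ} {M : Design.{u} n}, 0 < n → DesignAssumption K M → ErrorAssumption K M →
      M.Om.PosDef → |M.β| ≤ Cβ := by
  obtain ⟨B, b, V, -, -, hV, h⟩ := exists_prodFeature_bounds.{u} K
  have hs := K.sigMin_pos
  have hS : 0 < K.sigMax := hs.trans_le K.sigMin_le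
  refine ⟨Real.sqrt ((2 * K.sigMax + 2 * V) / K.sigMin), by positivity, ?_⟩
  intro n M hn hD hE hO
  refine Real.abs_le_sqrt ?_
  rw [le_div_iff₀ hs]
  set i : Fin n := ⟨0, hn⟩
  obtain ⟨he, he2, hee, hee2, he22⟩ := integrable_errors hD hE hO i
  have hm := sigW_le hD i
  have m1 := mean_eps1 hD hE hO i
  have m2 := hE.mean_eps2 i
  have h11 : Integrable (fun ω => M.eps1 i ω * M.eps1 i ω) M.P := by
    have : (fun ω => M.eps1 i ω * M.eps1 i ω) = fun ω => M.β ^ 2 * (M.eps2 i ω * M.eps2 i ω) +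
        2 * M.β * (M.e i ω * M.eps2 i ω) + M.e i ω * M.e i ω := by
      ext ω; simp only [Design.eps1]; ring
    rw [this]
    exact ((he22.const_mul _).add (hee2.const_mul _)).add hee
  have v1 : ∫ ω, M.eps1 i ω * M.eps1 i ω ∂M.P ≤ K.sigMax := by
    have e1 : condVar (M.sigW i) (M.eps1 i) M.P =ᵐ[M.P]
        M.P[fun ω => M.eps1 i ω * M.eps1 i ω | M.sigW i] := by
      refine condExp_congr_ae ?_
      filter_upwards [m1] with ω h
      simp only [Pi.pow_apply, Pi.sub_apply, h, Pi.zero_apply]; ring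
    rw [← integral_condExp hm, ← integral_congr_ae e1]
    have := integral_mono_ae (integrable_condVar (m := M.sigW i) (X := M.eps1 i) (μ := M.P))
      (integrable_const K.sigMax) ((hE.var1 i).mono fun _ h => h.2)
    simpa using this
  have v2 : K.sigMin ≤ ∫ ω, M.eps2 i ω * M.eps2 i ω ∂M.P := by
    have e1 : condVar (M.sigW i) (M.eps2 i) M.P =ᵐ[M.P]
        M.P[fun ω => M.eps2 i ω * M.eps2 i ω | M.sigW i] := by
      refine condExp_congr_ae ?_
      filter_upwards [m2] with ω h
      simp only [Pi.pow_apply, Pi.sub_apply, h, Pi.zero_apply]; ring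
    rw [← integral_condExp hm, ← integral_congr_ae e1]
    have := integral_mono_ae (integrable_const K.sigMin)
      (integrable_condVar (m := M.sigW i) (X := M.eps2 i) (μ := M.P))
      ((hE.var2 i).mono fun _ h => h.1)
    simpa using this
  have v3 : ∫ ω, M.e i ω * M.e i ω ∂M.P ≤ V := by
    have := (h hD hE hO i ![Sum.inr 0, Sum.inr 2, Sum.inr 2, Sum.inr 2]).2.2
    simpa [Design.prodFeature, Design.feature, Design.obs, sq] using this
  -- Pointwise, `(β ε₂)² = (ε₁ - e)² ≤ 2 ε₁² + 2 e²`. All three second moments are controlled by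
  -- absolute constants, and that of `ε₂` from below, so `β` is bounded.
  have hle : M.β ^ 2 * ∫ ω, M.eps2 i ω * M.eps2 i ω ∂M.P ≤
      2 * ∫ ω, M.eps1 i ω * M.eps1 i ω ∂M.P + 2 * ∫ ω, M.e i ω * M.e i ω ∂M.P := by
    rw [← integral_const_mul, ← integral_const_mul, ← integral_const_mul,
      ← integral_add (h11.const_mul _) (hee.const_mul _)]
    refine integral_mono (he22.const_mul _) ((h11.const_mul _).add (hee.const_mul _)) fun ω => ?_
    simp only [Design.eps1]
    nlinarith [sq_nonneg (M.eps2 i ω * M.β + 2 * M.e i ω)]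
  have := mul_le_mul_of_nonneg_left v2 (sq_nonneg M.β)
  linarith

end Means

/-! ### Consequences of the good event -/

section SampleBounds

variable {K : Constants} {n : ℕ} {M : Design.{u} n}

/-- The design matrix. -/
def Design.Wmat (M : Design.{u} n) (ω : M.S) : Matrix (Fin n) (Idx M.px M.pz) ℝ :=
  Matrix.of fun i => M.W i ω

/-- Sample averages behave like their means, in the form in which it is used below. -/
structure SampleBounds (K : Constants) (τ F : ℝ) (M : Design.{u} n) (ω : M.S) : Prop where
  gram_dev : ∀ j k, |gram (M.Wmat ω) j k - M.Sig j k| ≤ τ * M.rate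
  noise_e : ∀ j, |((1 / (n : ℝ)) • ((M.Wmat ω)ᵀ *ᵥ fun i => M.e i ω)) j| ≤ τ * M.rate
  noise_eps2 : ∀ j, |((1 / (n : ℝ)) • ((M.Wmat ω)ᵀ *ᵥ fun i => M.eps2 i ω)) j| ≤ τ * M.rate
  precision : ∀ k, ClimeFeasible (gram (M.Wmat ω)) (τ * M.rate) k fun l => M.Om l k
  weighted_ge : ∀ (b : Idx M.px M.pz → ℝ) (r : ℝ),
    (1 - max K.rho 0) * K.sigMin * K.cSig * l2norm b ^ 2 -
        (1 + |r|) ^ 2 * (l1norm b ^ 2 * (τ * M.rate)) ≤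
      (1 / (n : ℝ)) * ∑ i, (b ⬝ᵥ M.W i ω) ^ 2 * (M.e i ω + r * M.eps2 i ω) ^ 2
  weighted_le : ∀ (b : Idx M.px M.pz → ℝ) (r : ℝ),
    (1 / (n : ℝ)) * ∑ i, (b ⬝ᵥ M.W i ω) ^ 2 * (M.e i ω + r * M.eps2 i ω) ^ 2 ≤
      2 * K.sigMax * (1 + (r - M.β) ^ 2) * K.CSig * l2norm b ^ 2 +
        (1 + |r|) ^ 2 * (l1norm b ^ 2 * (τ * M.rate))
  fourth_le : ∀ b δ : Idx M.px M.pz → ℝ,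
    (1 / (n : ℝ)) * ∑ i, (b ⬝ᵥ M.W i ω) ^ 2 * (δ ⬝ᵥ M.W i ω) ^ 2 ≤
      l1norm b ^ 2 * (l1norm δ ^ 2 * F)

theorem average_const (hn : 0 < n) (c : ℝ) : (1 / (n : ℝ)) * ∑ _i : Fin n, c = c := by
  have hn' : (n : ℝ) ≠ 0 := by positivity
  simp [hn']

theorem average_sum_sum {κ : Type} [Fintype κ] (f : Fin n → κ → κ → ℝ) (b : κ → ℝ) :
    (1 / (n : ℝ)) * ∑ i, ∑ j, ∑ k, b j * b k * f i j k =
      ∑ j, ∑ k, b j * b k * ((1 / (n : ℝ)) * ∑ i, f i j k) := by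
  rw [Finset.sum_comm, Finset.mul_sum]
  refine Finset.sum_congr rfl fun j _ => ?_
  rw [Finset.sum_comm, Finset.mul_sum]
  refine Finset.sum_congr rfl fun k _ => ?_
  rw [← Finset.mul_sum]; ring

theorem average_linear_comb (f0 f1 f2 : Fin n → ℝ) (r : ℝ) :
    (1 / (n : ℝ)) * ∑ i, (f0 i + 2 * r * f1 i + r ^ 2 * f2 i) =
      (1 / (n : ℝ)) * ∑ i, f0 i + 2 * r * ((1 / (n : ℝ)) * ∑ i, f1 i) +
        r ^ 2 * ((1 / (n : ℝ)) * ∑ i, f2 i) := by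
  simp only [Finset.sum_add_distrib, ← Finset.mul_sum]; ring

theorem abs_sub_linear_comb_le {x0 x1 x2 y0 y1 y2 r ρ : ℝ} (h0 : |x0 - y0| ≤ ρ)
    (h1 : |x1 - y1| ≤ ρ) (h2 : |x2 - y2| ≤ ρ) :
    |(x0 + 2 * r * x1 + r ^ 2 * x2) - (y0 + 2 * r * y1 + r ^ 2 * y2)| ≤ (1 + |r|) ^ 2 * ρ := by
  have e : (x0 + 2 * r * x1 + r ^ 2 * x2) - (y0 + 2 * r * y1 + r ^ 2 * y2) =
      (x0 - y0) + 2 * r * (x1 - y1) + r ^ 2 * (x2 - y2) := by ring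
  rw [e]
  refine (abs_add_three _ _ _).trans ?_
  rw [abs_mul, abs_mul, abs_mul, abs_two, abs_pow]
  have a0 := abs_nonneg r
  have e1 := mul_le_mul_of_nonneg_left h1 (by positivity : 0 ≤ 2 * |r|)
  have e2 := mul_le_mul_of_nonneg_left h2 (by positivity : 0 ≤ |r| ^ 2)
  linarith

/-- The average is a quadratic form in `b` whose entries are quadratic polynomials in `r`, so
entrywise deviations suffice. Uniformity in `b` and `r` permits the data-dependent choices made for
`V̂_A`. -/
theorem GoodEvent.weighted_dev {τ : ℝ} {ω : M.S} (h : GoodEvent τ M ω)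
    (hD : DesignAssumption K M) (hE : ErrorAssumption K M) (hO : M.Om.PosDef)
    (b : Idx M.px M.pz → ℝ) (r : ℝ) :
    |(1 / (n : ℝ)) * ∑ i, (b ⬝ᵥ M.W i ω) ^ 2 * (M.e i ω + r * M.eps2 i ω) ^ 2 -
      (1 / (n : ℝ)) * ∑ i, ∫ ω', (b ⬝ᵥ M.W i ω') ^ 2 * (M.e i ω' + r * M.eps2 i ω') ^ 2 ∂M.P| ≤
      (1 + |r|) ^ 2 * (l1norm b ^ 2 * (τ * M.rate)) := by
  have hexp : ∀ i, (b ⬝ᵥ M.W i ω) ^ 2 * (M.e i ω + r * M.eps2 i ω) ^ 2 =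
      ∑ j, ∑ k, b j * b k * (M.W i ω j * M.W i ω k * (M.e i ω * M.e i ω) +
        2 * r * (M.W i ω j * M.W i ω k * (M.e i ω * M.eps2 i ω)) +
        r ^ 2 * (M.W i ω j * M.W i ω k * (M.eps2 i ω * M.eps2 i ω))) := fun i => by
    rw [dotProduct_sq_mul]
    refine Finset.sum_congr rfl fun j _ => Finset.sum_congr rfl fun k _ => by ring
  simp only [hexp, fun i => (integral_weighted_sq_bounds hD hE hO i r b).2.2]
  rw [average_sum_sum, average_sum_sum, ← Finset.sum_sub_distrib]
  simp only [← Finset.sum_sub_distrib, ← mul_sub]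
  refine (abs_sum_mul_mul_le (B := (1 + |r|) ^ 2 * (τ * M.rate)) (fun j k => ?_) b).trans
    (le_of_eq (by ring))
  rw [Finset.sum_sub_distrib, mul_sub, average_linear_comb, average_linear_comb]
  exact abs_sub_linear_comb_le
    (h ![Sum.inl (Sum.inl j), Sum.inl (Sum.inl k), Sum.inr 0, Sum.inr 0])
    (h ![Sum.inl (Sum.inl j), Sum.inl (Sum.inl k), Sum.inr 0, Sum.inr 1])
    (h ![Sum.inl (Sum.inl j), Sum.inl (Sum.inl k), Sum.inr 1, Sum.inr 1])

/-- A quadratic form in `b` whose entries are quadratic forms in `δ`. It measures the effect on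
`V̂_A` of replacing errors by residuals. -/
theorem GoodEvent.fourth_le {τ V : ℝ} {ω : M.S} (h : GoodEvent τ M ω) (hV0 : 0 ≤ V)
    (hV : ∀ i l, |∫ ω, M.prodFeature l (M.obs i ω) ∂M.P| ≤ V) (b δ : Idx M.px M.pz → ℝ) :
    (1 / (n : ℝ)) * ∑ i, (b ⬝ᵥ M.W i ω) ^ 2 * (δ ⬝ᵥ M.W i ω) ^ 2 ≤
      l1norm b ^ 2 * (l1norm δ ^ 2 * (V + τ * M.rate)) := by
  have h4 : ∀ j k l m, |(1 / (n : ℝ)) * ∑ i,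
      M.W i ω l * M.W i ω m * (M.W i ω j * M.W i ω k)| ≤ V + τ * M.rate := by
    intro j k l m
    have h1 := h ![Sum.inl (Sum.inl l), Sum.inl (Sum.inl m), Sum.inl (Sum.inl j),
      Sum.inl (Sum.inl k)]
    have h2 := abs_average_le hV0 fun i => hV i ![Sum.inl (Sum.inl l), Sum.inl (Sum.inl m),
      Sum.inl (Sum.inl j), Sum.inl (Sum.inl k)]
    have h3 := abs_sub_abs_le_abs_sub ((1 / (n : ℝ)) * ∑ i,
      M.W i ω l * M.W i ω m * (M.W i ω j * M.W i ω k)) ((1 / (n : ℝ)) * ∑ i,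
        ∫ ω, M.prodFeature ![Sum.inl (Sum.inl l), Sum.inl (Sum.inl m),
      Sum.inl (Sum.inl j), Sum.inl (Sum.inl k)] (M.obs i ω) ∂M.P)
    have h5 := h3.trans h1
    linarith
  have h2 : ∀ j k, |(1 / (n : ℝ)) * ∑ i, M.W i ω j * M.W i ω k * (δ ⬝ᵥ M.W i ω) ^ 2| ≤
      l1norm δ ^ 2 * (V + τ * M.rate) := by
    intro j k
    have e : ∀ i, M.W i ω j * M.W i ω k * (δ ⬝ᵥ M.W i ω) ^ 2 =
        ∑ l, ∑ m, δ l * δ m * (M.W i ω l * M.W i ω m * (M.W i ω j * M.W i ω k)) := fun i => by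
      rw [mul_comm, dotProduct_sq_mul]
    simp only [e]
    rw [average_sum_sum]
    exact abs_sum_mul_mul_le (fun l m => h4 j k l m) δ
  simp only [dotProduct_sq_mul]
  rw [average_sum_sum]
  exact (le_abs_self _).trans (abs_sum_mul_mul_le h2 b)

/-- Every field is the good event at a suitable quadruple of features, padded with the constant
feature `Sum.inr 2` where fewer than four factors are needed. -/
theorem GoodEvent.sampleBounds {τ V : ℝ} {ω : M.S} (h : GoodEvent τ M ω) (hn : 0 < n)
    (hτ : 0 ≤ τ) (hrate : M.rate ≤ 1)
    (hD : DesignAssumption K M) (hE : ErrorAssumption K M) (hO : M.Om.PosDef)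
    (hV0 : 0 ≤ V) (hV : ∀ i l, |∫ ω, M.prodFeature l (M.obs i ω) ∂M.P| ≤ V) :
    SampleBounds K τ (V + τ) M ω := by
  have hW : ∀ i j, M.Wmat ω i j = M.W i ω j := fun i j => rfl
  refine ⟨fun j k => ?_, fun j => ?_, fun j => ?_, fun k j => ?_, fun b r => ?_, fun b r => ?_,
    fun b δ => ?_⟩
  · have h1 := h ![Sum.inl (Sum.inl j), Sum.inl (Sum.inl k), Sum.inr 2, Sum.inr 2]
    simp only [Design.prodFeature, Design.feature, Design.obs, Matrix.cons_val, mul_one,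
      integral_W_mul hD, average_const hn] at h1
    simpa only [gram, Matrix.smul_apply, mul_apply, transpose_apply, smul_eq_mul, hW] using h1
  · have h1 := h ![Sum.inl (Sum.inl j), Sum.inr 0, Sum.inr 2, Sum.inr 2]
    simp only [Design.prodFeature, Design.feature, Design.obs, Matrix.cons_val, mul_one,
      fun i => (integral_W_mul_error_eq_zero hD hE hO i j).1, average_const hn, sub_zero] at h1
    simpa only [Pi.smul_apply, mulVec, dotProduct, transpose_apply, smul_eq_mul, hW] using h1
  · have h1 := h ![Sum.inl (Sum.inl j), Sum.inr 1, Sum.inr 2, Sum.inr 2]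
    simp only [Design.prodFeature, Design.feature, Design.obs, Matrix.cons_val, mul_one,
      fun i => (integral_W_mul_error_eq_zero hD hE hO i j).2, average_const hn, sub_zero] at h1
    simpa only [Pi.smul_apply, mulVec, dotProduct, transpose_apply, smul_eq_mul, hW] using h1
  -- Entry `(j, k)` of `Σ̂ Ω` is the average of `W_{ij} (Ωᵀ W_i)_k`. Treating `(Ωᵀ W_i)_k` as one
  -- feature gives the error `τ √(log p / n)` without a factor `‖Ω‖₁`.
  · have h1 := h ![Sum.inl (Sum.inl j), Sum.inl (Sum.inr k), Sum.inr 2, Sum.inr 2]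
    have hm : ∀ i, ∫ ω, M.W i ω j * ((fun l => M.Om l k) ⬝ᵥ M.W i ω) ∂M.P =
        (Pi.single k 1 : Idx M.px M.pz → ℝ) j := fun i => by
      have e : ∀ ω, M.W i ω j * ((fun l => M.Om l k) ⬝ᵥ M.W i ω) =
          ∑ l, M.Om l k * (M.W i ω j * M.W i ω l) := fun ω => by
        rw [dotProduct, Finset.mul_sum]
        exact Finset.sum_congr rfl fun l _ => by ring
      simp only [e]
      rw [integral_finsetSum _ fun l _ => (integrable_W_mul hD hE hO i j l).const_mul _]
      simp only [integral_const_mul, integral_W_mul hD]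
      have h2 := congrFun (congrFun (Sig_mul_Om hO) j) k
      rw [mul_apply, Matrix.one_apply] at h2
      simp only [mul_comm (M.Om _ _)]
      rw [h2, Pi.single_apply]
    simp only [Design.prodFeature, Design.feature, Design.obs, Matrix.cons_val, mul_one, hm,
      average_const hn] at h1
    convert h1 using 3
    rw [gram, smul_mulVec, ← mulVec_mulVec, Pi.smul_apply, smul_eq_mul]
    congr 1
    rw [mulVec, dotProduct]
    refine Finset.sum_congr rfl fun i _ => ?_
    rw [transpose_apply, hW, mulVec, dotProduct_comm]
    rfl
  · have h1 := neg_le_of_abs_le (h.weighted_dev hD hE hO b r)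
    have h2 : (1 - max K.rho 0) * K.sigMin * K.cSig * l2norm b ^ 2 ≤
        (1 / (n : ℝ)) * ∑ i, ∫ ω', (b ⬝ᵥ M.W i ω') ^ 2 *
          (M.e i ω' + r * M.eps2 i ω') ^ 2 ∂M.P := by
      rw [← average_const hn ((1 - max K.rho 0) * K.sigMin * K.cSig * l2norm b ^ 2)]
      refine mul_le_mul_of_nonneg_left (Finset.sum_le_sum fun i _ => ?_) (by positivity)
      refine le_trans ?_ (integral_weighted_sq_bounds hD hE hO i r b).1
      rw [mul_assoc _ K.cSig]
      refine mul_le_mul_of_nonneg_left (hD.eigen_lower b) (mul_nonneg ?_ K.sigMin_pos.le)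
      have := max_lt K.rho_lt one_pos
      linarith
    linarith
  · have h1 := le_of_abs_le (h.weighted_dev hD hE hO b r)
    have h2 : (1 / (n : ℝ)) * ∑ i, ∫ ω', (b ⬝ᵥ M.W i ω') ^ 2 *
          (M.e i ω' + r * M.eps2 i ω') ^ 2 ∂M.P ≤
        2 * K.sigMax * (1 + (r - M.β) ^ 2) * K.CSig * l2norm b ^ 2 := by
      rw [← average_const hn (2 * K.sigMax * (1 + (r - M.β) ^ 2) * K.CSig * l2norm b ^ 2)]
      refine mul_le_mul_of_nonneg_left (Finset.sum_le_sum fun i _ => ?_) (by positivity)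
      refine (integral_weighted_sq_bounds hD hE hO i r b).2.1.trans ?_
      rw [mul_assoc _ K.CSig]
      have := K.sigMin_pos.trans_le K.sigMin_le
      exact mul_le_mul_of_nonneg_left (hD.eigen_upper b) (by positivity)
    linarith
  · refine (h.fourth_le hV0 hV b δ).trans ?_
    have : τ * M.rate ≤ τ := mul_le_of_le_one_right hτ hrate
    have h1 := sq_nonneg (l1norm b)
    have h2 := sq_nonneg (l1norm δ)
    gcongr

end SampleBounds

/-! ### Asymptotic regime and probability of the good event -/

section Regime

variable {K : Constants} {n : ℕ} {M : Design.{u} n}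

/-- `m³ s^{3/2} (log p)³ √(log p / n)`. -/
noncomputable def Design.load (M : Design.{u} n) (m : ℝ) (s : ℕ) : ℝ :=
  m ^ 3 * ((s : ℝ) * Real.sqrt s) * Real.log (M.p : ℝ) ^ 3 * M.rate

theorem rate_nonneg : 0 ≤ M.rate := Real.sqrt_nonneg _

theorem mul_rate_sq (hn : 0 < n) :
    n * M.rate ^ 2 = Real.log (M.p : ℝ) := by
  rw [Design.rate, Real.sq_sqrt (by positivity)]
  field_simp

theorem rate_pos (hn : 0 < n) (hL : 1 ≤ Real.log (M.p : ℝ)) : 0 < M.rate := by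
  have hL0 : 0 < Real.log (M.p : ℝ) := by linarith
  exact Real.sqrt_pos.2 (by positivity)

/-- Raised to the power `1 - q`, the load has every exponent of `m`, `s` and `log p` at most the one
in the rate condition, and each of these bases is at least `1`. From here on the condition enters
only through `Design.load`. -/
theorem load_rpow_le {q ν m so : ℝ} {s : ℕ} (hn : 0 < n) (hq0 : 0 ≤ q) (hν : 0 < ν)
    (hm : 1 ≤ m) (hso : 1 ≤ so) (hs : 1 ≤ s) (hL : 1 ≤ Real.log (M.p : ℝ)) :
    M.load m s ^ (1 - q) ≤ so * m ^ (3 - 2 * q) * (s : ℝ) ^ ((3 - q) / 2) *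
      Real.log (M.p : ℝ) ^ ((7 + ν - q) / 2) / (n : ℝ) ^ ((1 - q) / 2) := by
  rw [Design.load, Design.rate]
  set L := Real.log (M.p : ℝ)
  have hs' : (1 : ℝ) ≤ s := by exact_mod_cast hs
  have hn' : (0 : ℝ) < n := by exact_mod_cast hn
  have hm0 : 0 < m := by linarith
  have hs0 : (0 : ℝ) < s := by linarith
  have hL0 : 0 < L := by linarith
  have hX : m ^ 3 * ((s : ℝ) * Real.sqrt s) * L ^ 3 * Real.sqrt (L / n) =
      m ^ (3 : ℝ) * (s : ℝ) ^ (3 / 2 : ℝ) * L ^ (7 / 2 : ℝ) / (n : ℝ) ^ (1 / 2 : ℝ) := by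
    have e1 : m ^ (3 : ℝ) = m ^ 3 := by
      rw [show (3 : ℝ) = ((3 : ℕ) : ℝ) by norm_num, Real.rpow_natCast]
    have e2 : (s : ℝ) ^ (3 / 2 : ℝ) = s * Real.sqrt s := by
      rw [show (3 / 2 : ℝ) = 1 + 1 / 2 by norm_num, Real.rpow_add hs0, Real.rpow_one,
        ← Real.sqrt_eq_rpow]
    have e3 : L ^ (7 / 2 : ℝ) = L ^ 3 * Real.sqrt L := by
      rw [show (7 / 2 : ℝ) = ((3 : ℕ) : ℝ) + 1 / 2 by norm_num, Real.rpow_add hL0,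
        Real.rpow_natCast, ← Real.sqrt_eq_rpow]
    rw [e1, e2, e3, ← Real.sqrt_eq_rpow, Real.sqrt_div hL0.le]
    ring
  rw [hX, Real.div_rpow (by positivity) (by positivity), Real.mul_rpow (by positivity)
    (by positivity), Real.mul_rpow (by positivity) (by positivity), ← Real.rpow_mul hm0.le,
    ← Real.rpow_mul hs0.le, ← Real.rpow_mul hL0.le, ← Real.rpow_mul hn'.le]
  have d1 : m ^ (3 * (1 - q)) ≤ m ^ (3 - 2 * q) :=
    Real.rpow_le_rpow_of_exponent_le hm (by linarith)
  have d2 : (s : ℝ) ^ (3 / 2 * (1 - q)) ≤ (s : ℝ) ^ ((3 - q) / 2) :=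
    Real.rpow_le_rpow_of_exponent_le hs' (by linarith)
  have d3 : L ^ (7 / 2 * (1 - q)) ≤ L ^ ((7 + ν - q) / 2) :=
    Real.rpow_le_rpow_of_exponent_le hL (by linarith)
  have d4 : (n : ℝ) ^ (1 / 2 * (1 - q)) = (n : ℝ) ^ ((1 - q) / 2) := by congr 1; ring
  rw [d4]
  refine div_le_div_of_nonneg_right ?_ (by positivity)
  calc m ^ (3 * (1 - q)) * (s : ℝ) ^ (3 / 2 * (1 - q)) * L ^ (7 / 2 * (1 - q))
      ≤ m ^ (3 - 2 * q) * (s : ℝ) ^ ((3 - q) / 2) * L ^ ((7 + ν - q) / 2) := by gcongr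
    _ = 1 * m ^ (3 - 2 * q) * (s : ℝ) ^ ((3 - q) / 2) * L ^ ((7 + ν - q) / 2) := by ring
    _ ≤ _ := by gcongr

theorem load_nonneg {m : ℝ} {s : ℕ} (hm : 1 ≤ m) (hL : 1 ≤ Real.log (M.p : ℝ)) :
    0 ≤ M.load m s := by
  have := rate_nonneg (M := M)
  have h : 0 ≤ Real.log (M.p : ℝ) := by linarith
  rw [Design.load]
  positivity

/-- The non-distributional conditions at one sample size. -/
structure Regular (K : Constants) (κ : ℝ) (M : Design.{u} n) (m : ℝ) (s : ℕ) : Prop where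
  design : DesignAssumption K M
  error : ErrorAssumption K M
  posDef : M.Om.PosDef
  col_sum : ∀ k, ∑ j, |M.Om j k| ≤ m
  n_pos : 0 < n
  one_le_m : 1 ≤ m
  one_le_s : 1 ≤ s
  two_le_pz : 2 ≤ M.pz
  one_le_log : 1 ≤ Real.log (M.p : ℝ)
  gam_ne : M.γ ≠ 0
  load_le : M.load m s ≤ κ * min 1 (l2norm M.γ)

theorem StandingAssumptions.tendsto_log_p {q ν : ℝ} {M : ∀ n, Design.{u} n}
    {m_om s_om : ℕ → ℝ} {s : ℕ → ℕ} (h : StandingAssumptions K q ν M m_om s_om s) :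
    Tendsto (fun n => Real.log ((M n).p : ℝ)) atTop atTop :=
  Real.tendsto_log_atTop.comp (tendsto_natCast_atTop_atTop.comp h.p_tendsto)

theorem StandingAssumptions.eventually_regular {q ν κ : ℝ} {M : ∀ n, Design.{u} n}
    {m_om s_om : ℕ → ℝ} {s : ℕ → ℕ} (h : StandingAssumptions K q ν M m_om s_om s)
    (hq0 : 0 ≤ q) (hq1 : q < 1) (hν : 0 < ν) (hκ : 0 < κ) :
    ∀ᶠ n in atTop, 1 ≤ s n → Regular K κ (M n) (m_om n) (s n) := by
  -- The little-o constant is capped at `1` so that the load is at most `1`; then the load is at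
  -- most its power with exponent `1 - q`.
  have h1 := h.rates.bound (lt_min hκ one_pos)
  filter_upwards [h1, h.tendsto_log_p.eventually_ge_atTop 1, eventually_gt_atTop 0] with
    n h1 hL hn hs
  refine ⟨h.design n, h.error n, (h.precision n).1, (h.precision n).2.1, hn, h.one_le_m n, hs,
    h.two_le_pz n, hL, h.gam_ne n, ?_⟩
  have h2 := load_rpow_le (M := M n) hn hq0 hν (h.one_le_m n) (h.one_le_s n) hs hL
  have hg0 : 0 ≤ min 1 (l2norm (M n).γ) := le_min zero_le_one (l2norm_nonneg _)
  rw [Real.norm_eq_abs, Real.norm_eq_abs, abs_of_nonneg hg0] at h1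
  have h3 := h2.trans ((le_abs_self _).trans h1)
  have hX0 := load_nonneg (M := M n) (s := s n) (h.one_le_m n) hL
  have hg1 : min κ 1 * min 1 (l2norm (M n).γ) ≤ 1 :=
    mul_le_one₀ (min_le_right _ _) hg0 (min_le_left _ _)
  have hX1 : (M n).load (m_om n) (s n) ≤ 1 := by
    by_contra hcon
    have := Real.one_lt_rpow (not_le.1 hcon) (by linarith : 0 < 1 - q)
    linarith
  have h4 : (M n).load (m_om n) (s n) ≤ (M n).load (m_om n) (s n) ^ (1 - q) := by
    rcases hX0.eq_or_lt with h0 | h0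
    · rw [← h0]; exact Real.rpow_nonneg le_rfl _
    · have := Real.rpow_le_rpow_of_exponent_ge h0 hX1 (by linarith : 1 - q ≤ 1)
      rwa [Real.rpow_one] at this
  refine h4.trans (h3.trans ?_)
  exact mul_le_mul_of_nonneg_right (min_le_left _ _) hg0

theorem Regular.log_pow_mul_rate_le {κ m : ℝ} {s : ℕ} (h : Regular K κ M m s) (hκ : 0 < κ) :
    Real.log (M.p : ℝ) ^ 3 * M.rate ≤ κ := by
  have h1 := h.load_le
  have h2 : κ * min 1 (l2norm M.γ) ≤ κ := mul_le_of_le_one_right hκ.le (min_le_left _ _)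
  refine le_trans ?_ (h1.trans h2)
  have hs : (1 : ℝ) ≤ s := by exact_mod_cast h.one_le_s
  have hL := h.one_le_log
  have hL0 : 0 ≤ Real.log (M.p : ℝ) := by linarith
  have h3 : 1 ≤ m ^ 3 * ((s : ℝ) * Real.sqrt s) :=
    one_le_mul_of_one_le_of_one_le (one_le_pow₀ h.one_le_m)
      (one_le_mul_of_one_le_of_one_le hs (Real.one_le_sqrt.2 hs))
  rw [Design.load, mul_assoc]
  exact le_mul_of_one_le_left (mul_nonneg (by positivity) rate_nonneg) h3

/-- A deviation constant for which the good event has probability close to one, together with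
a bound for the means of the products of features. -/
theorem exists_goodEvent_bound (K : Constants) : ∃ τ V B b : ℝ, 0 < τ ∧ 0 < V ∧ 0 < B ∧ 0 < b ∧
    ∀ {n : ℕ} {M : Design.{u} n}, 0 < n → 1 ≤ Real.log (M.p : ℝ) → M.rate ≤ 1 → Independent M →
      DesignAssumption K M → ErrorAssumption K M → M.Om.PosDef →
      (∀ i l, |∫ ω, M.prodFeature l (M.obs i ω) ∂M.P| ≤ V) ∧
      M.P.real {ω | ¬ GoodEvent τ M ω} ≤ (5 * (M.p : ℝ)) ^ 4 *
        (2 * (Real.exp (-5 * Real.log (M.p : ℝ)) +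
          n * (B * Real.exp (-b * Real.sqrt M.rate⁻¹)))) := by
  obtain ⟨B, b, V, hB, hb, hV, h⟩ := exists_prodFeature_bounds.{u} K
  -- With `τ = 2 V + 5` each product has Chernoff term `p⁻⁵`, which beats the `p⁴` quadruples of the
  -- union bound.
  refine ⟨2 * V + 5, 1 + V, B, b, by positivity, by positivity, hB, hb, ?_⟩
  intro n M hn hL hrate hind hD hE hO
  have hpos := rate_pos (M := M) hn hL
  refine ⟨fun i l => abs_integral_prodFeature_le (integrable_prodFeature hD hE hO i l)
    (h hD hE hO i l).2.1 (h hD hE hO i l).2.2, ?_⟩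
  have hset : {ω | ¬ GoodEvent (2 * V + 5) M ω} = ⋃ l, {ω | (2 * V + 5) * M.rate <
      |(1 / (n : ℝ)) * ∑ i, M.prodFeature l (M.obs i ω) -
        (1 / (n : ℝ)) * ∑ i, ∫ ω', M.prodFeature l (M.obs i ω') ∂M.P|} := by
    ext ω
    simp only [GoodEvent, not_forall, not_le, Set.mem_ofPred_eq, Set.mem_iUnion]
  rw [hset]
  refine (measureReal_iUnion_fintype_le _).trans ?_
  have hl : ∀ l, M.P.real {ω | (2 * V + 5) * M.rate <
      |(1 / (n : ℝ)) * ∑ i, M.prodFeature l (M.obs i ω) -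
        (1 / (n : ℝ)) * ∑ i, ∫ ω', M.prodFeature l (M.obs i ω') ∂M.P|} ≤
      2 * (Real.exp (-5 * Real.log (M.p : ℝ)) +
          n * (B * Real.exp (-b * Real.sqrt M.rate⁻¹))) := fun l => by
    have hind' : iIndepFun (fun i ω => M.prodFeature l (M.obs i ω)) M.P :=
      iIndepFun.comp hind (fun _ => M.prodFeature l) fun _ => measurable_prodFeature l
    have := measureReal_abs_average_sub_gt_le hn (τ := 2 * V + 5) hind'
      (fun i => (measurable_prodFeature l).comp (measurable_obs hD hE i)) hpos hrate
      (fun i => (h hD hE hO i l).1) (fun i => (h hD hE hO i l).2.1)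
      (fun i => (h hD hE hO i l).2.2)
    rw [mul_rate_sq hn] at this
    convert this using 5
    ring
  refine (Finset.sum_le_sum fun l _ => hl l).trans ?_
  rw [Finset.sum_const, nsmul_eq_mul]
  refine mul_le_mul_of_nonneg_right ?_ (by positivity)
  simp only [Finset.card_univ, Fintype.card_pi, Finset.prod_const, Fintype.card_fin,
    Fintype.card_sum]
  push_cast
  refine pow_le_pow_left₀ (by positivity) ?_ 4
  -- There are `2 p + 3` features, and `2 p + 3 ≤ 5 p` since `p ≥ 1`.
  have hp : (1 : ℝ) ≤ M.p := by
    by_contra hcon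
    have : M.p = 0 := by
      have : M.p < 1 := by exact_mod_cast not_le.1 hcon
      omega
    rw [this] at hL
    norm_num at hL
  have : (M.p : ℝ) = M.px + M.pz := by rw [Design.p]; push_cast; rfl
  linarith

theorem tendsto_pow_mul_exp_neg_mul {c : ℝ} (hc : 0 < c) :
    Tendsto (fun y : ℝ => y ^ 5 * Real.exp (-(c * y))) atTop (𝓝 0) := by
  have h := ((Real.tendsto_pow_mul_exp_neg_atTop_nhds_zero 5).comp
    (tendsto_id.const_mul_atTop hc)).const_mul (c⁻¹ ^ 5)
  rw [mul_zero] at h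
  refine h.congr fun y => ?_
  simp only [Function.comp, id]
  rw [← mul_assoc, ← mul_pow, ← mul_assoc, inv_mul_cancel₀ hc.ne', one_mul]

/-- Along sample sizes where `(log p)⁷ ≤ n`, the good event has probability tending to one. -/
theorem tendsto_bad_bound {l : Filter ℕ} {B b : ℝ} (hb : 0 < b) {M : ∀ n, Design.{u} n}
    (hL : Tendsto (fun n => Real.log ((M n).p : ℝ)) l atTop) (hn : ∀ᶠ n in l, 0 < n)
    (hrate : ∀ᶠ n in l, Real.log ((M n).p : ℝ) ^ 3 * (M n).rate ≤ 1) :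
    Tendsto (fun n => (5 * ((M n).p : ℝ)) ^ 4 * (2 * (Real.exp (-5 * Real.log ((M n).p : ℝ)) +
          n * (B * Real.exp (-b * Real.sqrt (M n).rate⁻¹))))) l (𝓝 0) := by
  -- With `y = √(1 / rate)` and `L = log p` the sample size is `n = L y⁴`, and the rate hypothesis
  -- reads `L³ ≤ y²`. The truncation term then becomes at most a multiple of `y⁵ exp (-b y / 2)`.
  set y : ℕ → ℝ := fun n => Real.sqrt (M n).rate⁻¹ with hy
  have hyL : ∀ᶠ n in l, Real.log ((M n).p : ℝ) ^ 3 ≤ y n ^ 2 := by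
    filter_upwards [hrate, hn, hL.eventually_ge_atTop 1] with n h1 h2 h3
    have hpos := rate_pos (M := M n) h2 h3
    rw [hy, Real.sq_sqrt (by positivity), ← one_div, le_div_iff₀ hpos]
    exact h1
  have hyt : Tendsto y l atTop := by
    refine tendsto_atTop_mono' l ?_ hL
    filter_upwards [hyL, hL.eventually_ge_atTop 1] with n h1 h3
    refine le_of_sq_le_sq ?_ (Real.sqrt_nonneg _)
    exact (pow_le_pow_right₀ h3 (by norm_num)).trans h1
  have hlim : Tendsto (fun n => 1250 * Real.exp (-Real.log ((M n).p : ℝ)) +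
      1250 * |B| * (y n ^ 5 * Real.exp (-(b / 2 * y n)))) l (𝓝 0) := by
    have h1 := (Real.tendsto_exp_neg_atTop_nhds_zero.comp hL).const_mul 1250
    have h2 := ((tendsto_pow_mul_exp_neg_mul (half_pos hb)).comp hyt).const_mul (1250 * |B|)
    simpa using h1.add h2
  have hlim' := squeeze_zero_norm' (f := fun n => (5 * ((M n).p : ℝ)) ^ 4 *
    (2 * (Real.exp (-5 * Real.log ((M n).p : ℝ)) +
          n * (B * Real.exp (-b * Real.sqrt (M n).rate⁻¹))))) ?_ hlim
  · exact hlim'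
  -- Once `L ≥ (8 / b)²`, `y² ≥ L³ ≥ (8 L / b)²`, so the factor `p⁴ = exp (4 L)` uses up only half
  -- of the exponent `b y`.
  filter_upwards [hyL, hn, hL.eventually_ge_atTop 1, hL.eventually_ge_atTop ((8 / b) ^ 2)] with
    n h1 h2 h3 h4
  set L := Real.log ((M n).p : ℝ)
  have hp : (0 : ℝ) < (M n).p := by
    by_contra hcon
    have : ((M n).p : ℝ) = 0 := le_antisymm (not_lt.1 hcon) (Nat.cast_nonneg _)
    have h5 : L = 0 := by simp only [L, this, Real.log_zero]
    linarith
  have hpL : ((M n).p : ℝ) = Real.exp L := (Real.exp_log hp).symm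
  have hL0 : 0 < L := by linarith
  have hy0 : 0 ≤ y n := Real.sqrt_nonneg _
  have hy1 : 1 ≤ y n := by
    refine le_of_sq_le_sq ?_ hy0
    rw [one_pow]
    exact (one_le_pow₀ h3).trans h1
  have hpos := rate_pos (M := M n) h2 h3
  have hny : (n : ℝ) = L * y n ^ 4 := by
    have e1 : y n ^ 4 = ((M n).rate ^ 2)⁻¹ := by
      rw [show (4 : ℕ) = 2 * 2 from rfl, pow_mul, hy, Real.sq_sqrt (by positivity), inv_pow]
    have e2 : n * (M n).rate ^ 2 = L := mul_rate_sq h2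
    rw [e1, ← e2]
    field_simp
  have hLy : L ≤ y n := by
    refine le_of_sq_le_sq ?_ hy0
    exact (pow_le_pow_right₀ h3 (by norm_num)).trans h1
  have h4L : 4 * L ≤ b / 2 * y n := by
    have e1 : 8 / b * L ≤ y n := by
      refine le_of_sq_le_sq ?_ hy0
      rw [mul_pow]
      calc (8 / b) ^ 2 * L ^ 2 ≤ L * L ^ 2 := by gcongr
        _ = L ^ 3 := by ring
        _ ≤ _ := h1
    have := mul_le_mul_of_nonneg_left e1 (half_pos hb).le
    have e2 : b / 2 * (8 / b * L) = 4 * L := by field_simp; ring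
    linarith
  have t1 : Real.exp L ^ 4 * Real.exp (-5 * L) = Real.exp (-L) := by
    rw [← Real.exp_nat_mul, ← Real.exp_add]; congr 1; push_cast; ring
  have t2 : Real.exp L ^ 4 * Real.exp (-b * y n) ≤ Real.exp (-(b / 2 * y n)) := by
    rw [← Real.exp_nat_mul, ← Real.exp_add]
    refine Real.exp_le_exp.2 ?_
    push_cast; linarith
  have t3 : (n : ℝ) ≤ y n ^ 5 := by
    rw [hny]
    calc L * y n ^ 4 ≤ y n * y n ^ 4 := by gcongr
      _ = y n ^ 5 := by ring
  rw [Real.norm_eq_abs, hpL]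
  have e0 : (5 * Real.exp L) ^ 4 * (2 * (Real.exp (-5 * L) + n * (B * Real.exp (-b * y n)))) =
      1250 * (Real.exp L ^ 4 * Real.exp (-5 * L)) +
        1250 * (n * (B * (Real.exp L ^ 4 * Real.exp (-b * y n)))) := by ring
  change |(5 * Real.exp L) ^ 4 * (2 * (Real.exp (-5 * L) + n * (B * Real.exp (-b * y n))))| ≤ _
  rw [e0, t1]
  refine (abs_add_le _ _).trans ?_
  rw [abs_of_nonneg (by positivity)]
  refine add_le_add le_rfl ?_
  rw [abs_mul, abs_mul, abs_mul, abs_of_pos (by norm_num : (0 : ℝ) < 1250),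
    abs_of_nonneg (Nat.cast_nonneg n),
    abs_of_nonneg (by positivity : 0 ≤ Real.exp L ^ 4 * Real.exp (-b * y n))]
  calc 1250 * ((n : ℝ) * (|B| * (Real.exp L ^ 4 * Real.exp (-b * y n))))
      ≤ 1250 * (y n ^ 5 * (|B| * Real.exp (-(b / 2 * y n)))) := by gcongr
    _ = _ := by ring

end Regime

/-! ### Diagonal quadratic forms -/

section Diagonal

variable {κ : Type} [Fintype κ]

theorem bil_add_right (A : Matrix κ κ ℝ) (x y z : κ → ℝ) :
    bil A x (y + z) = bil A x y + bil A x z := by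
  rw [bil, mulVec_add, dotProduct_add]; rfl

theorem bil_smul_right (A : Matrix κ κ ℝ) (c : ℝ) (x y : κ → ℝ) :
    bil A x (c • y) = c * bil A x y := by
  rw [bil, mulVec_smul, dotProduct_smul]; rfl

variable [DecidableEq κ] {w : κ → ℝ} {α Λ : ℝ}

theorem bil_diagonal (w x y : κ → ℝ) :
    bil (Matrix.diagonal w) x y = ∑ j, w j * (x j * y j) := by
  rw [bil, dotProduct]
  exact Finset.sum_congr rfl fun j _ => by rw [mulVec_diagonal]; ring

theorem quad_diagonal (w x : κ → ℝ) : quad (Matrix.diagonal w) x = ∑ j, w j * x j ^ 2 := by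
  rw [quad, bil_diagonal]; simp only [sq]

theorem bil_diagonal_comm (w x y : κ → ℝ) :
    bil (Matrix.diagonal w) x y = bil (Matrix.diagonal w) y x := by
  simp only [bil_diagonal, mul_comm (x _)]

theorem quad_diagonal_add (w x y : κ → ℝ) :
    quad (Matrix.diagonal w) (x + y) = quad (Matrix.diagonal w) x +
      2 * bil (Matrix.diagonal w) x y + quad (Matrix.diagonal w) y := by
  simp only [quad_diagonal, bil_diagonal, Finset.mul_sum, ← Finset.sum_add_distrib, Pi.add_apply]
  exact Finset.sum_congr rfl fun j _ => by ring

theorem bil_diagonal_add_add (w x dx y dy : κ → ℝ) :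
    bil (Matrix.diagonal w) (x + dx) (y + dy) = bil (Matrix.diagonal w) x y +
      bil (Matrix.diagonal w) x dy + bil (Matrix.diagonal w) dx y +
      bil (Matrix.diagonal w) dx dy := by
  simp only [bil_diagonal, ← Finset.sum_add_distrib, Pi.add_apply]
  exact Finset.sum_congr rfl fun j _ => by ring

theorem le_quad_diagonal (h : ∀ j, α ≤ w j) (x : κ → ℝ) :
    α * l2norm x ^ 2 ≤ quad (Matrix.diagonal w) x := by
  rw [quad_diagonal, l2norm_sq, Finset.mul_sum]
  exact Finset.sum_le_sum fun j _ => mul_le_mul_of_nonneg_right (h j) (sq_nonneg _)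

theorem quad_diagonal_le (h : ∀ j, w j ≤ Λ) (x : κ → ℝ) :
    quad (Matrix.diagonal w) x ≤ Λ * l2norm x ^ 2 := by
  rw [quad_diagonal, l2norm_sq, Finset.mul_sum]
  exact Finset.sum_le_sum fun j _ => mul_le_mul_of_nonneg_right (h j) (sq_nonneg _)

theorem abs_bil_diagonal_le (h0 : ∀ j, 0 ≤ w j) (h : ∀ j, w j ≤ Λ) (hΛ : 0 ≤ Λ) (x y : κ → ℝ) :
    |bil (Matrix.diagonal w) x y| ≤ Λ * (l2norm x * l2norm y) := by
  have h1 : l2norm (Matrix.diagonal w *ᵥ y) ≤ Λ * l2norm y := by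
    refine le_of_sq_le_sq ?_ (mul_nonneg hΛ (l2norm_nonneg _))
    rw [mul_pow, l2norm_sq, l2norm_sq, Finset.mul_sum]
    refine Finset.sum_le_sum fun j _ => ?_
    rw [mulVec_diagonal, mul_pow]
    exact mul_le_mul_of_nonneg_right (pow_le_pow_left₀ (h0 j) (h j) 2) (sq_nonneg _)
  refine (abs_dotProduct_le_l2norm _ _).trans ?_
  have := mul_le_mul_of_nonneg_left h1 (l2norm_nonneg x)
  linarith

theorem l1norm_diagonal_mulVec_le (h0 : ∀ j, 0 ≤ w j) (h : ∀ j, w j ≤ Λ) (x : κ → ℝ) :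
    l1norm (Matrix.diagonal w *ᵥ x) ≤ Λ * l1norm x := by
  rw [l1norm, l1norm, Finset.mul_sum]
  refine Finset.sum_le_sum fun j _ => ?_
  rw [mulVec_diagonal, abs_mul, abs_of_nonneg (h0 j)]
  exact mul_le_mul_of_nonneg_right (h j) (abs_nonneg _)

end Diagonal

/-! ### CLIME -/

section Clime

variable {κ : Type}

theorem abs_climeSym_le_left (N : Matrix κ κ ℝ) (j k : κ) : |climeSym N j k| ≤ |N j k| := by
  simp only [climeSym, Matrix.of_apply]
  split_ifs with h
  · exact le_rfl
  · exact (not_le.1 h).le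

theorem abs_climeSym_le_right (N : Matrix κ κ ℝ) (j k : κ) : |climeSym N j k| ≤ |N k j| := by
  simp only [climeSym, Matrix.of_apply]
  split_ifs with h
  · exact h
  · exact le_rfl

theorem climeSym_eq_or (N : Matrix κ κ ℝ) (j k : κ) :
    climeSym N j k = N j k ∨ climeSym N j k = N k j := by
  simp only [climeSym, Matrix.of_apply]
  split_ifs with h
  · exact Or.inl rfl
  · exact Or.inr rfl

variable [Fintype κ] [DecidableEq κ]

/-- `Ω` is feasible, so minimality bounds each column of the unsymmetrized matrix by `m`. The
symmetrized entry is dominated by both candidates, which bounds columns and rows alike. -/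
theorem climeSym_col_sum_le {N O : Matrix κ κ ℝ} {S : Matrix κ κ ℝ} {μ m : ℝ}
    (hN : ∀ j, IsClimeColumn S μ j fun k => N k j)
    (hfeas : ∀ k, ClimeFeasible S μ k fun l => O l k) (hO : ∀ k, ∑ j, |O j k| ≤ m) :
    (∀ k, ∑ j, |N j k| ≤ m) ∧ (∀ k, ∑ j, |climeSym N j k| ≤ m) ∧
      ∀ j, ∑ k, |climeSym N j k| ≤ m := by
  have h1 : ∀ k, ∑ j, |N j k| ≤ m := fun k =>
    (((hN k) ⟨_, hfeas k⟩).2 _ (hfeas k)).trans (hO k)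
  exact ⟨h1, fun k => (Finset.sum_le_sum fun j _ => abs_climeSym_le_left N j k).trans (h1 k),
    fun j => (Finset.sum_le_sum fun k _ => abs_climeSym_le_right N j k).trans (h1 j)⟩

/-- Entrywise error of CLIME. -/
theorem abs_climeSym_sub_le {N O S S' : Matrix κ κ ℝ} {μ m ρ : ℝ}
    (hOS : O * S' = 1) (hsymm : ∀ j k, O j k = O k j)
    (hdev : ∀ j k, |S j k - S' j k| ≤ ρ)
    (hN : ∀ j, IsClimeColumn S μ j fun k => N k j)
    (hfeas : ∀ k, ClimeFeasible S μ k fun l => O l k) (hO : ∀ k, ∑ j, |O j k| ≤ m) (j k : κ) :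
    |climeSym N j k - O j k| ≤ m * (2 * μ + ρ * (2 * m)) := by
  have hmain : ∀ j k, |N j k - O j k| ≤ m * (2 * μ + ρ * (2 * m)) := by
    intro j k
    set v : κ → ℝ := (fun l => N l k) - fun l => O l k with hv
    have hNf := ((hN k) ⟨_, hfeas k⟩).1
    have hv1 : l1norm v ≤ 2 * m := by
      have h1 := (climeSym_col_sum_le hN hfeas hO).1 k
      have h2 := hO k
      have h3 := l1norm_sub_le (fun l => N l k) (fun l => O l k)
      simp only [l1norm] at h3 ⊢
      simp only [hv, Pi.sub_apply] at h3 ⊢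
      linarith
    have hSv : ∀ i, |(S *ᵥ v) i| ≤ 2 * μ := fun i => by
      have h1 := abs_le.1 (hNf i)
      have h2 := abs_le.1 (hfeas k i)
      rw [hv, mulVec_sub, Pi.sub_apply, abs_le]
      constructor <;> linarith [h1.1, h1.2, h2.1, h2.2]
    have hS'v : ∀ i, |(S' *ᵥ v) i| ≤ 2 * μ + ρ * (2 * m) := fun i => by
      have e : (S' *ᵥ v) i = (S *ᵥ v) i - ((S - S') *ᵥ v) i := by
        rw [sub_mulVec, Pi.sub_apply]; ring
      have h1 : |((S - S') *ᵥ v) i| ≤ ρ * (2 * m) := by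
        rw [mulVec, dotProduct_comm]
        have hρ : 0 ≤ ρ := (abs_nonneg _).trans (hdev i i)
        refine (abs_dotProduct_le_l1norm (hdev i)).trans ?_
        rw [mul_comm]
        exact mul_le_mul_of_nonneg_left hv1 hρ
      rw [e]
      refine (abs_sub _ _).trans ?_
      linarith [hSv i]
    -- The column error `v` is recovered as `Ω (Σ v)`. Here `Σ v` is small because both columns are
    -- feasible for `Σ̂`, and `‖v‖₁ ≤ 2 m` controls the change from `Σ̂` to `Σ`.
    have e2 : N j k - O j k = (O *ᵥ (S' *ᵥ v)) j := by
      rw [mulVec_mulVec, hOS, one_mulVec]; rfl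
    rw [e2, mulVec]
    refine (abs_dotProduct_le_l1norm hS'v).trans ?_
    refine mul_le_mul_of_nonneg_right ?_ ((abs_nonneg _).trans (hS'v j))
    have := hO j
    simp only [l1norm]
    simpa only [hsymm j] using this
  rcases climeSym_eq_or N j k with h | h
  · rw [h]; exact hmain j k
  · rw [h, hsymm j k]; exact hmain k j

end Clime

/-! ### The estimators on the good event -/

/-- Deviation and tuning constants. -/
structure Tuning (K : Constants) where
  τ : ℝ
  F : ℝ
  Cβ : ℝ
  Clam : ℝ
  C1 : ℝ
  C2 : ℝ
  C3 : ℝ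
  Cw : ℝ
  τ_pos : 0 < τ
  F_pos : 0 < F
  Cβ_pos : 0 < Cβ
  le_Clam : 4 * τ * (2 + 4 * K.CSig / K.cSig + Cβ) ≤ Clam
  Clam_le_C1 : Clam ≤ C1
  Clam_le_C2 : Clam ≤ C2
  Clam_le_C3 : Clam ≤ C3
  τ_le_Cw : τ ≤ Cw

/-- The estimators are computed on a sample for which the good event holds. -/
structure Setup {K : Constants} (T : Tuning K) (κ : ℝ) {n : ℕ} (M : Design.{u} n) (m : ℝ) (s : ℕ)
    (π : Fin M.pz → ℝ) (ω : M.S) (E : Estimates M.px M.pz) : Prop where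
  reg : Regular K κ M m s
  smp : SampleBounds K T.τ T.F M ω
  beta : |M.β| ≤ T.Cβ
  adm : Admissible M s T.Clam T.C3 π
  est : IsEstimates (T.C1 * M.rate) (T.C2 * M.rate) (T.C3 * M.rate) (T.Cw * M.rate)
    (M.data π ω) E

section Estimators

variable {K : Constants} {T : Tuning K} {κ : ℝ} {n : ℕ} {M : Design.{u} n} {m : ℝ} {s : ℕ}
  {π : Fin M.pz → ℝ} {ω : M.S} {E : Estimates M.px M.pz}

theorem Regular.mono {κ' : ℝ} (h : Regular K κ M m s) (hκ : κ ≤ κ') : Regular K κ' M m s :=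
  { h with
    load_le := h.load_le.trans (mul_le_mul_of_nonneg_right hκ (le_min zero_le_one (l2norm_nonneg _))) }

theorem Setup.mono {κ' : ℝ} (h : Setup T κ M m s π ω E) (hκ : κ ≤ κ') : Setup T κ' M m s π ω E :=
  { h with reg := h.reg.mono hκ }

theorem Tuning.Clam_pos (T : Tuning K) : 0 < T.Clam := by
  have h1 := T.τ_pos
  have h2 := T.Cβ_pos
  have h3 := K.cSig_pos
  have h4 := K.cSig_pos.trans_le K.cSig_le
  exact lt_of_lt_of_le (by positivity) T.le_Clam

/-- The exponent `3` is reached for `m` in `exists_varLoading_bounds`, for `√s` in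
`exists_VHat_bounds`, and for `log p` in `Setup.scaled_error_le`. -/
theorem Regular.monomial_le (h : Regular K κ M m s) {i j k : ℕ} (hi : i ≤ 3) (hj : j ≤ 3)
    (hk : k ≤ 3) :
    m ^ i * Real.sqrt s ^ j * Real.log (M.p : ℝ) ^ k * M.rate ≤ κ * min 1 (l2norm M.γ) := by
  refine le_trans ?_ h.load_le
  have hs : (1 : ℝ) ≤ Real.sqrt s := Real.one_le_sqrt.2 (by exact_mod_cast h.one_le_s)
  have hL := h.one_le_log
  have hm := h.one_le_m
  have e : (s : ℝ) * Real.sqrt s = Real.sqrt s ^ 3 := by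
    rw [pow_succ, Real.sq_sqrt (Nat.cast_nonneg _)]
  rw [Design.load, e]
  refine mul_le_mul_of_nonneg_right ?_ rate_nonneg
  have h1 := pow_le_pow_right₀ hm hi
  have h2 := pow_le_pow_right₀ hs hj
  have h3 := pow_le_pow_right₀ hL hk
  have : 0 ≤ m := by linarith
  have : 0 ≤ Real.log (M.p : ℝ) := by linarith
  gcongr

theorem Sig_diag_bounds (hD : DesignAssumption K M) (j : Idx M.px M.pz) :
    K.cSig ≤ M.Sig j j ∧ M.Sig j j ≤ K.CSig := by
  have h1 := hD.eigen_lower (Pi.single j 1)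
  have h2 := hD.eigen_upper (Pi.single j 1)
  have e1 : l2norm (Pi.single j 1 : Idx M.px M.pz → ℝ) = 1 := by simp [l2norm, Pi.single_apply]
  have e2 : quad M.Sig (Pi.single j 1) = M.Sig j j := by
    simp [quad, bil]
  rw [e1, e2] at h1 h2
  exact ⟨by linarith, by linarith⟩

theorem Astar_eq : M.Astar = Matrix.diagonal fun j => M.Sig (Sum.inr j) (Sum.inr j) := by
  simp only [Design.Astar, Design.Sig, Matrix.of_apply, sq]

theorem zVar_eq (j : Fin M.pz) :
    zVar (M.Wmat ω) j = gram (M.Wmat ω) (Sum.inr j) (Sum.inr j) := by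
  simp [zVar, gram, mul_apply, sq]

theorem exists_zVar_bounds (T : Tuning K) : ∃ κ : ℝ, 0 < κ ∧ κ ≤ 1 ∧
    ∀ {n : ℕ} {M : Design.{u} n} {m : ℝ} {s : ℕ} {π : Fin M.pz → ℝ} {ω : M.S}
      {E : Estimates M.px M.pz}, Setup T κ M m s π ω E → ∀ j,
      K.cSig / 2 ≤ zVar (M.Wmat ω) j ∧ zVar (M.Wmat ω) j ≤ 2 * K.CSig := by
  have hc := K.cSig_pos
  have hτ := T.τ_pos
  refine ⟨min 1 (K.cSig / (2 * T.τ)), lt_min one_pos (by positivity), min_le_left _ _, ?_⟩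
  intro n M m s π ω E h j
  have h1 := h.reg.monomial_le (i := 0) (j := 0) (k := 0) (by norm_num) (by norm_num) (by norm_num)
  simp only [pow_zero, one_mul] at h1
  have h2 : M.rate ≤ K.cSig / (2 * T.τ) := by
    refine h1.trans ((mul_le_of_le_one_right (by positivity) (min_le_left _ _)).trans
      (min_le_right _ _))
  have h3 : T.τ * M.rate ≤ K.cSig / 2 := by
    have := mul_le_mul_of_nonneg_left h2 hτ.le
    have e : T.τ * (K.cSig / (2 * T.τ)) = K.cSig / 2 := by field_simp
    linarith
  have h4 := abs_le.1 (h.smp.gram_dev (Sum.inr j) (Sum.inr j))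
  have h5 := Sig_diag_bounds h.reg.design (Sum.inr j)
  have h6 := K.cSig_le
  rw [zVar_eq]
  constructor <;> linarith [h4.1, h4.2, h5.1, h5.2]

/-- Coefficients of the reduced form for `Y - t D`. -/
def Design.thetaY (M : Design.{u} n) (π : Fin M.pz → ℝ) (t : ℝ) : Idx M.px M.pz → ℝ :=
  Sum.elim (M.β • M.ψ + M.φ) (M.Gam π) - t • Sum.elim M.ψ M.γ

/-- Subtracting `t D` leaves a linear regression on `W` with noise `e + (β - t) ε₂`. One Lasso
result thus covers the fit of `Y` (`t = 0`) and the fit of `Y - D β̂_A`, even though `β̂_A` depends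
on the data. -/
theorem data_Y_sub (t : ℝ) : (M.data π ω).Y - t • (M.data π ω).D =
    M.Wmat ω *ᵥ M.thetaY π t + fun i => M.e i ω + (M.β - t) * M.eps2 i ω := by
  ext i
  have hW : ∀ v : Idx M.px M.pz → ℝ, (M.Wmat ω *ᵥ v) i = M.W i ω ⬝ᵥ v := fun v => rfl
  have e : (Sum.elim (M.β • M.ψ + M.φ) (M.Gam π) : Idx M.px M.pz → ℝ) =
      M.β • Sum.elim M.ψ M.γ + Sum.elim M.φ π := by
    ext j
    rcases j with j | j <;> simp [Design.Gam]
  simp only [Design.data, Design.Y, Design.D, Pi.sub_apply, Pi.add_apply, Pi.smul_apply,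
    smul_eq_mul, hW, Design.thetaY, e, dotProduct_sub, dotProduct_add, dotProduct_smul]
  ring

theorem data_D_eq : (M.data π ω).D =
    M.Wmat ω *ᵥ Sum.elim M.ψ M.γ + fun i => M.eps2 i ω := rfl

theorem Setup.noise_le (h : Setup T κ M m s π ω E) (t : ℝ) (j : Idx M.px M.pz) :
    |((1 / (n : ℝ)) • ((M.Wmat ω)ᵀ *ᵥ fun i => M.e i ω + t * M.eps2 i ω)) j| ≤
      (1 + |t|) * (T.τ * M.rate) := by
  have e : (fun i => M.e i ω + t * M.eps2 i ω) =
      (fun i => M.e i ω) + t • fun i => M.eps2 i ω := rfl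
  rw [e, mulVec_add, mulVec_smul, smul_add, smul_comm, Pi.add_apply]
  refine (abs_add_le _ _).trans ?_
  rw [Pi.smul_apply t, smul_eq_mul, abs_mul, add_mul, one_mul]
  exact add_le_add (h.smp.noise_e j)
    (mul_le_mul_of_nonneg_left (h.smp.noise_eps2 j) (abs_nonneg _))

theorem Setup.l0norm_le (h : Setup T κ M m s π ω E) :
    l0norm M.γ ≤ s ∧ l0norm (M.Gam π) ≤ s ∧
    l0norm (Sum.elim M.ψ M.γ : Idx M.px M.pz → ℝ) ≤ 2 * s ∧
    ∀ t, l0norm (M.thetaY π t) ≤ 2 * s := by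
  have h1 := h.adm.1
  simp only [Design.sparsity, max_le_iff] at h1
  refine ⟨by omega, by omega, by rw [l0norm_sumElim]; omega, fun t => ?_⟩
  refine (l0norm_sub_smul_le _ _ _).trans ?_
  rw [l0norm_sumElim, l0norm_sumElim]; omega

/-- The error bounds shared by the three Lasso fits: constant `C`, error `δ`, score `g`. -/
structure LassoBounds (C : ℝ) (M : Design.{u} n) (s : ℕ) (δ g : Idx M.px M.pz → ℝ) : Prop where
  l2 : l2norm δ ≤ C * (Real.sqrt s * M.rate)
  l1 : l1norm δ ≤ C * (Real.sqrt s * (Real.sqrt s * M.rate))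
  score : ∀ j, |g j| ≤ C * M.rate

/-- The smallness of `s √(log p / n)` supplies the restricted eigenvalue condition. The sparsity is
`2 s` because `Y - t D` combines two `s`-sparse coefficient vectors; hence the factors `64 = 2 · 32`
and `√(2 s) ≤ 2 √s`. -/
theorem exists_lasso_constant (T : Tuning K) : ∃ κ : ℝ, 0 < κ ∧ κ ≤ 1 ∧
    ∀ Cl : ℝ, 0 < Cl → ∃ C : ℝ, 0 < C ∧
    ∀ {n : ℕ} {M : Design.{u} n} {m : ℝ} {s : ℕ} {π : Fin M.pz → ℝ} {ω : M.S}
      {E : Estimates M.px M.pz}, Setup T κ M m s π ω E →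
      ∀ {y ξ : Fin n → ℝ} {θ θ' : Idx M.px M.pz → ℝ}, y = M.Wmat ω *ᵥ θ + ξ →
      (∀ j, |((1 / (n : ℝ)) • ((M.Wmat ω)ᵀ *ᵥ ξ)) j| ≤ Cl * M.rate / 4) → l0norm θ ≤ 2 * s →
      IsLasso y (M.Wmat ω) (Cl * M.rate) θ' →
      LassoBounds C M s (θ' - θ) ((1 / (n : ℝ)) • ((M.Wmat ω)ᵀ *ᵥ (y - M.Wmat ω *ᵥ θ'))) := by
  have hc := K.cSig_pos
  have hτ := T.τ_pos
  refine ⟨min 1 (K.cSig / (64 * T.τ)), lt_min one_pos (by positivity), min_le_left _ _, ?_⟩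
  intro Cl hCl
  refine ⟨max (max (6 * Cl / K.cSig) (8 * (6 * Cl / K.cSig))) Cl, by positivity, ?_⟩
  intro n M m s π ω E h y ξ θ θ' hy hξ hθ hlasso
  have ha := rate_pos (M := M) h.reg.n_pos h.reg.one_le_log
  have hlam : 0 < Cl * M.rate := by positivity
  have h1 := h.reg.monomial_le (i := 0) (j := 2) (k := 0) (by norm_num) (by norm_num) (by norm_num)
  simp only [pow_zero, one_mul, mul_one] at h1
  rw [Real.sq_sqrt (Nat.cast_nonneg _)] at h1
  have h2 : (s : ℝ) * M.rate ≤ K.cSig / (64 * T.τ) :=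
    h1.trans ((mul_le_of_le_one_right (by positivity) (min_le_left _ _)).trans (min_le_right _ _))
  have h3 : 32 * (T.τ * M.rate * (2 * s : ℕ)) ≤ K.cSig := by
    have := mul_le_mul_of_nonneg_left h2 (by positivity : 0 ≤ 64 * T.τ)
    have e : 64 * T.τ * (K.cSig / (64 * T.τ)) = K.cSig := by field_simp
    push_cast
    linarith
  obtain ⟨b1, b2⟩ := IsLasso.error_bound hc h.reg.design.eigen_lower h.smp.gram_dev h3 hlam hy hξ
    hθ hlasso
  have hsq : Real.sqrt ((2 * s : ℕ) : ℝ) ≤ 2 * Real.sqrt s := by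
    refine Real.sqrt_le_iff.2 ⟨by positivity, ?_⟩
    rw [mul_pow, Real.sq_sqrt (Nat.cast_nonneg _)]
    push_cast
    nlinarith [(Nat.cast_nonneg s : (0 : ℝ) ≤ s)]
  have b1' : l2norm (θ' - θ) ≤ 6 * Cl / K.cSig * (Real.sqrt s * M.rate) := by
    refine b1.trans ?_
    rw [div_mul_eq_mul_div]
    refine div_le_div_of_nonneg_right ?_ hc.le
    have := mul_le_mul_of_nonneg_left hsq (by positivity : 0 ≤ 3 * (Cl * M.rate))
    linarith
  refine ⟨b1'.trans ?_, ?_, fun j => ?_⟩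
  · refine mul_le_mul_of_nonneg_right ?_ (by positivity)
    exact (le_max_left _ _).trans (le_max_left _ _)
  · calc l1norm (θ' - θ) ≤ 4 * (2 * Real.sqrt s) * (6 * Cl / K.cSig * (Real.sqrt s * M.rate)) := by
          refine b2.trans ?_
          gcongr
          exact l2norm_nonneg _
      _ = 8 * (6 * Cl / K.cSig) * (Real.sqrt s * (Real.sqrt s * M.rate)) := by ring
      _ ≤ _ := by
          refine mul_le_mul_of_nonneg_right ?_ (by positivity)
          exact (le_max_right _ _).trans (le_max_left _ _)
  · refine (hlasso.abs_score_le hlam.le j).trans ?_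
    have : Cl * M.rate ≤ max (max (6 * Cl / K.cSig) (8 * (6 * Cl / K.cSig))) Cl * M.rate :=
      mul_le_mul_of_nonneg_right (le_max_right _ _) ha.le
    linarith

end Estimators

/-! ### First-stage fits and the debiased estimators of `Q_A(γ)` and `I_A(γ, Γ)`. -/

section Estimators

variable {K : Constants} {T : Tuning K} {κ : ℝ} {n : ℕ} {M : Design.{u} n} {m : ℝ} {s : ℕ}
  {π : Fin M.pz → ℝ} {ω : M.S} {E : Estimates M.px M.pz}

theorem LassoBounds.mono {C C' : ℝ} {δ g : Idx M.px M.pz → ℝ} (h : LassoBounds C M s δ g)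
    (hC : C ≤ C') : LassoBounds C' M s δ g := by
  have ha := rate_nonneg (M := M)
  have hs := Real.sqrt_nonneg (s : ℝ)
  exact ⟨h.l2.trans (by gcongr), h.l1.trans (by gcongr), fun j => (h.score j).trans (by gcongr)⟩

/-- Elementary size relations on the good event: with `r = √s`, `a = √(log p/n)` and
`x = m r a`, one has `r a ≤ x ≤ κ (1 ∧ ‖γ‖)` and `‖π‖ ≲ ‖γ‖`. -/
theorem Setup.sizes (h : Setup T κ M m s π ω E) :
    0 < l2norm M.γ ∧ 0 < M.rate ∧ 1 ≤ Real.sqrt s ∧ 1 ≤ m ∧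
    Real.sqrt s * M.rate ≤ m * Real.sqrt s * M.rate ∧
    m * Real.sqrt s * M.rate ≤ κ * min 1 (l2norm M.γ) ∧
    l2norm π ≤ T.C3 / T.Clam * l2norm M.γ ∧
    l2norm (M.Gam π) ≤ (T.Cβ + T.C3 / T.Clam) * l2norm M.γ := by
  have hg := l2norm_pos h.reg.gam_ne
  have ha := rate_pos (M := M) h.reg.n_pos h.reg.one_le_log
  have hr : 1 ≤ Real.sqrt s := Real.one_le_sqrt.2 (by exact_mod_cast h.reg.one_le_s)
  have hm := h.reg.one_le_m
  have hx := h.reg.monomial_le (i := 1) (j := 1) (k := 0) (by norm_num) (by norm_num) (by norm_num)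
  simp only [pow_one, pow_zero, mul_one] at hx
  have hcl := T.Clam_pos
  have hπ : l2norm π ≤ T.C3 / T.Clam * l2norm M.γ := by
    have h1 := h.adm.2
    have h2 : l2norm π / l2norm M.γ ≤ T.C3 / T.Clam := by
      rw [le_div_iff₀ hcl]
      nlinarith
    rwa [div_le_iff₀ hg] at h2
  refine ⟨hg, ha, hr, hm, ?_, hx, hπ, ?_⟩
  · refine mul_le_mul_of_nonneg_right ?_ ha.le
    exact le_mul_of_one_le_left (by linarith) hm
  · refine (l2norm_add_le _ _).trans ?_
    rw [l2norm_smul, add_mul]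
    exact add_le_add (mul_le_mul_of_nonneg_right h.beta hg.le) hπ

theorem exists_first_stage_bounds (T : Tuning K) : ∃ κ C : ℝ, 0 < κ ∧ κ ≤ 1 ∧ 0 < C ∧
    ∀ {n : ℕ} {M : Design.{u} n} {m : ℝ} {s : ℕ} {π : Fin M.pz → ℝ} {ω : M.S}
      {E : Estimates M.px M.pz}, Setup T κ M m s π ω E →
      LassoBounds C M s (E.thY - M.thetaY π 0)
        ((1 / (n : ℝ)) • ((M.Wmat ω)ᵀ *ᵥ ((M.data π ω).Y - M.Wmat ω *ᵥ E.thY))) ∧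
      LassoBounds C M s (E.thD - Sum.elim M.ψ M.γ)
        ((1 / (n : ℝ)) • ((M.Wmat ω)ᵀ *ᵥ ((M.data π ω).D - M.Wmat ω *ᵥ E.thD))) := by
  obtain ⟨κ, hκ, hκ1, hlasso⟩ := exists_lasso_constant.{u} T
  have hcl := T.Clam_pos
  obtain ⟨CY, hCY, hY⟩ := hlasso T.C1 (hcl.trans_le T.Clam_le_C1)
  obtain ⟨CD, hCD, hD⟩ := hlasso T.C2 (hcl.trans_le T.Clam_le_C2)
  refine ⟨κ, max CY CD, hκ, hκ1, lt_max_of_lt_left hCY, ?_⟩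
  intro n M m s π ω E h
  have ha := rate_nonneg (M := M)
  have hτ := T.τ_pos
  have hCβ := T.Cβ_pos
  have hc := K.cSig_pos
  have hC := K.cSig_pos.trans_le K.cSig_le
  have hlarge : 0 ≤ 4 * K.CSig / K.cSig := by positivity
  have hT := T.le_Clam
  have e0 : (M.data π ω).Y = M.Wmat ω *ᵥ M.thetaY π 0 + fun i => M.e i ω + M.β * M.eps2 i ω := by
    have := data_Y_sub (M := M) (π := π) (ω := ω) 0
    simpa using this
  constructor
  · refine (hY h e0 (fun j => ?_) (h.l0norm_le.2.2.2 0) h.est.lassoY).mono (le_max_left _ _)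
    refine (h.noise_le M.β j).trans ?_
    have h1 : 4 * T.τ * (1 + |M.β|) ≤ T.C1 := by
      refine le_trans ?_ (hT.trans T.Clam_le_C1)
      refine mul_le_mul_of_nonneg_left ?_ (by positivity)
      linarith [h.beta]
    have := mul_le_mul_of_nonneg_right h1 ha
    linarith
  · refine (hD h data_D_eq (fun j => ?_) h.l0norm_le.2.2.1 h.est.lassoD).mono (le_max_right _ _)
    refine (h.smp.noise_eps2 j).trans ?_
    have h1 : 4 * T.τ * 1 ≤ T.C2 := by
      refine le_trans ?_ (hT.trans T.Clam_le_C2)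
      refine mul_le_mul_of_nonneg_left ?_ (by positivity)
      linarith
    have := mul_le_mul_of_nonneg_right h1 ha
    linarith

theorem Setup.clime_columns (h : Setup T κ M m s π ω E) :
    (∀ j, IsClimeColumn (gram (M.Wmat ω)) (T.Cw * M.rate) j fun k => E.Om1 k j) ∧
    (∀ k, ClimeFeasible (gram (M.Wmat ω)) (T.Cw * M.rate) k fun l => M.Om l k) :=
  ⟨h.est.clime, fun k j => (h.smp.precision k j).trans
    (mul_le_mul_of_nonneg_right T.τ_le_Cw rate_nonneg)⟩

theorem Setup.OmHat_col_sum_le (h : Setup T κ M m s π ω E) :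
    (∀ k, ∑ j, |OmHat E j k| ≤ m) ∧ ∀ j, ∑ k, |OmHat E j k| ≤ m :=
  (climeSym_col_sum_le h.clime_columns.1 h.clime_columns.2 h.reg.col_sum).2

/-- The bias correction is at most `‖Ω̂‖₁ ‖A v‖₁` times the largest score. -/
theorem Setup.abs_correction_le {Λ : ℝ} (h : Setup T κ M m s π ω E)
    (hz0 : ∀ j, 0 ≤ zVar (M.Wmat ω) j) (hz : ∀ j, zVar (M.Wmat ω) j ≤ Λ) {v : Fin M.pz → ℝ}
    {ξ : Fin n → ℝ} {B L1 : ℝ} (hv : l1norm v ≤ L1) (hΛ : 0 ≤ Λ) (hB0 : 0 ≤ B)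
    (hB : ∀ j, |((1 / (n : ℝ)) • ((M.Wmat ω)ᵀ *ᵥ ξ)) j| ≤ B) (c : ℝ) :
    |c / (n : ℝ) * (uHat (M.data π ω) E v ⬝ᵥ ((M.data π ω).Wᵀ *ᵥ ξ))| ≤
      |c| * (m * (Λ * L1) * B) := by
  have e : c / (n : ℝ) * (uHat (M.data π ω) E v ⬝ᵥ ((M.data π ω).Wᵀ *ᵥ ξ)) =
      c * (uHat (M.data π ω) E v ⬝ᵥ ((1 / (n : ℝ)) • ((M.Wmat ω)ᵀ *ᵥ ξ))) := by
    rw [dotProduct_smul, smul_eq_mul, ← mul_assoc, mul_one_div]; rfl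
  rw [e, abs_mul]
  refine mul_le_mul_of_nonneg_left ?_ (abs_nonneg c)
  refine (abs_dotProduct_le_l1norm hB).trans (mul_le_mul_of_nonneg_right ?_ hB0)
  have hm : 0 ≤ m := by linarith [h.reg.one_le_m]
  refine (l1norm_mulVec_le h.OmHat_col_sum_le.1 _).trans (mul_le_mul_of_nonneg_left ?_ hm)
  rw [l1norm_emb]
  refine (l1norm_diagonal_mulVec_le hz0 hz v).trans (mul_le_mul_of_nonneg_left hv hΛ)

/-- Errors of `γ̂`, `Γ̂`, and of the debiased estimators of `Q_A(γ)` and `I_A(γ, Γ)`. -/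
theorem exists_debiased_bounds (T : Tuning K) : ∃ κ C : ℝ, 0 < κ ∧ κ ≤ 1 ∧ 0 < C ∧
    ∀ {n : ℕ} {M : Design.{u} n} {m : ℝ} {s : ℕ} {π : Fin M.pz → ℝ} {ω : M.S}
      {E : Estimates M.px M.pz}, Setup T κ M m s π ω E →
      l2norm (gamHat E - M.γ) ≤ C * (m * Real.sqrt s * M.rate) ∧
      l1norm (gamHat E) ≤ C * (Real.sqrt s * l2norm M.γ) ∧
      |QgamHat (M.data π ω) E - quad (M.A ω) M.γ| ≤
        C * (m * Real.sqrt s * M.rate) * l2norm M.γ ∧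
      |IHat (M.data π ω) E - bil (M.A ω) M.γ (M.Gam π)| ≤
        C * (m * Real.sqrt s * M.rate) * l2norm M.γ := by
  obtain ⟨κ1, hκ1, hκ1', hz⟩ := exists_zVar_bounds.{u} T
  obtain ⟨κ2, C, hκ2, -, hC, hfirst⟩ := exists_first_stage_bounds.{u} T
  have hc := K.cSig_pos
  have hCS := K.cSig_pos.trans_le K.cSig_le
  set Λ := 2 * K.CSig with hΛ
  have hΛ0 : 0 < Λ := by positivity
  have hcl := T.Clam_pos
  have hCβ := T.Cβ_pos
  have hC3 : 0 < T.C3 := hcl.trans_le T.Clam_le_C3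
  set G := T.Cβ + T.C3 / T.Clam with hG
  have hG0 : 0 < G := by positivity
  set C4 := Λ * C + Λ * (G * C) + Λ * C ^ 2 + Λ * (2 * (G + C) * C) with hC4
  set C5 := 2 * Λ * C + Λ * C ^ 2 + Λ * (2 * (1 + C) * C) with hC5
  have hC40 : 0 < C4 := by positivity
  have hC50 : 0 < C5 := by positivity
  have b5 : 0 < Λ * (2 * (1 + C) * C) := by positivity
  refine ⟨min κ1 κ2, C + 1 + C5 + C4 + Λ * (2 * (1 + C) * C), lt_min hκ1 hκ2,
    (min_le_left _ _).trans hκ1', by positivity, ?_⟩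
  intro n M m s π ω E h
  obtain ⟨hY, hD⟩ := hfirst (h.mono (min_le_right _ _))
  have hz := hz (h.mono (min_le_left _ _))
  have hz0 : ∀ j, 0 ≤ zVar (M.Wmat ω) j := fun j => by linarith [(hz j).1]
  have hzΛ : ∀ j, zVar (M.Wmat ω) j ≤ Λ := fun j => (hz j).2
  obtain ⟨hg, ha, hr, hm, hrx, hxg, -, hΓ⟩ := h.sizes
  -- Here the condition relative to `‖γ‖` enters: quadratic errors `x²` are absorbed into `x ‖γ‖`.
  have hxg : m * Real.sqrt s * M.rate ≤ l2norm M.γ := by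
    have hmin : min κ1 κ2 * min 1 (l2norm M.γ) ≤ 1 * l2norm M.γ :=
      mul_le_mul ((min_le_left _ _).trans hκ1') (min_le_right _ _)
        (le_min zero_le_one hg.le) zero_le_one
    linarith
  have hl0 := h.l0norm_le
  set d1 := gamHat E - M.γ with hd1
  set d2 := GamHat E - M.Gam π with hd2
  set g := l2norm M.γ
  set r := Real.sqrt s
  set a := M.rate
  set x := m * r * a with hx
  have hx0 : 0 < x := by positivity
  have ed1 : l2norm d1 ≤ C * x := by
    refine (l2norm_inr_le (E.thD - Sum.elim M.ψ M.γ)).trans (hD.l2.trans ?_)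
    exact mul_le_mul_of_nonneg_left hrx hC.le
  -- The regression of `Y` is the case `t = 0` of `thetaY`, whose instrument block is `Γ`.
  have ed2' : d2 = fun j => (E.thY - M.thetaY π 0) (Sum.inr j) := by
    ext j; simp [hd2, GamHat, Design.thetaY]
  have ed2 : l2norm d2 ≤ C * x := by
    rw [ed2']
    refine (l2norm_inr_le (E.thY - M.thetaY π 0)).trans (hY.l2.trans ?_)
    exact mul_le_mul_of_nonneg_left hrx hC.le
  have hrrg : r * (r * a) ≤ r * g := mul_le_mul_of_nonneg_left (hrx.trans hxg) (by linarith)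
  have fd1 : l1norm d1 ≤ C * (r * g) :=
    (l1norm_inr_le (E.thD - Sum.elim M.ψ M.γ)).trans
      (hD.l1.trans (mul_le_mul_of_nonneg_left hrrg hC.le))
  have fd2 : l1norm d2 ≤ C * (r * g) := by
    rw [ed2']
    exact (l1norm_inr_le (E.thY - M.thetaY π 0)).trans
      (hY.l1.trans (mul_le_mul_of_nonneg_left hrrg hC.le))
  have hrsq : ∀ k : ℕ, k ≤ s → Real.sqrt k ≤ r := fun k hk =>
    Real.sqrt_le_sqrt (by exact_mod_cast hk)
  have fγ : l1norm M.γ ≤ r * g := (l1norm_le_sqrt_l0norm_mul _).trans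
    (mul_le_mul_of_nonneg_right (hrsq _ hl0.1) hg.le)
  have fΓ : l1norm (M.Gam π) ≤ G * (r * g) := by
    refine (l1norm_le_sqrt_l0norm_mul _).trans ?_
    calc Real.sqrt (l0norm (M.Gam π)) * l2norm (M.Gam π) ≤ r * (G * g) :=
          mul_le_mul (hrsq _ hl0.2.1) hΓ (l2norm_nonneg _) (by linarith)
      _ = G * (r * g) := by ring
  have eγ : gamHat E = M.γ + d1 := by rw [hd1]; abel
  have eΓ : GamHat E = M.Gam π + d2 := by rw [hd2]; abel
  have fγ' : l1norm (gamHat E) ≤ (1 + C) * (r * g) := by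
    rw [eγ]; refine (l1norm_add_le _ _).trans ?_
    linarith
  have fΓ' : l1norm (GamHat E) ≤ (G + C) * (r * g) := by
    rw [eΓ]; refine (l1norm_add_le _ _).trans ?_
    linarith
  have hCa : 0 ≤ C * a := by positivity
  have hbil := fun u v => abs_bil_diagonal_le hz0 hzΛ hΛ0.le u v
  have hA : weightA (M.data π ω).W = Matrix.diagonal (zVar (M.Wmat ω)) := rfl
  have hA' : M.A ω = Matrix.diagonal (zVar (M.Wmat ω)) := rfl
  have hxx : (C * x) * (C * x) ≤ C ^ 2 * (x * g) := by
    have : x * x ≤ x * g := mul_le_mul_of_nonneg_left hxg hx0.le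
    calc (C * x) * (C * x) = C ^ 2 * (x * x) := by ring
      _ ≤ _ := mul_le_mul_of_nonneg_left this (by positivity)
  have hxg0 : 0 < x * g := by positivity
  have hl1 := l2norm_nonneg d1
  have hl2 := l2norm_nonneg d2
  have hl3 := l2norm_nonneg (M.Gam π)
  refine ⟨?_, ?_, ?_, ?_⟩
  · refine ed1.trans (mul_le_mul_of_nonneg_right ?_ hx0.le)
    linarith
  · refine fγ'.trans (mul_le_mul_of_nonneg_right ?_ (by positivity))
    linarith
  · have hQ : QgamHat (M.data π ω) E - quad (M.A ω) M.γ =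
        2 * bil (M.A ω) M.γ d1 + bil (M.A ω) d1 d1 + 2 / (n : ℝ) *
          (uHat (M.data π ω) E (gamHat E) ⬝ᵥ ((M.data π ω).Wᵀ *ᵥ
            ((M.data π ω).D - (M.data π ω).W *ᵥ E.thD))) := by
      rw [QgamHat, hA, hA']
      conv_lhs => rw [show quad (Matrix.diagonal (zVar (M.Wmat ω))) (gamHat E) =
        quad (Matrix.diagonal (zVar (M.Wmat ω))) (M.γ + d1) by rw [← eγ], quad_diagonal_add]
      have hq : quad (Matrix.diagonal (zVar (M.Wmat ω))) d1 =
        bil (Matrix.diagonal (zVar (M.Wmat ω))) d1 d1 := rfl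
      rw [hq]; ring
    have c1 := h.abs_correction_le hz0 hzΛ fγ' hΛ0.le hCa hD.score 2
    have b1 : |bil (M.A ω) M.γ d1| ≤ Λ * C * (x * g) := by
      refine (hbil _ _).trans ?_
      calc Λ * (g * l2norm d1) ≤ Λ * (g * (C * x)) := by gcongr
        _ = _ := by ring
    have b2 : |bil (M.A ω) d1 d1| ≤ Λ * C ^ 2 * (x * g) := by
      refine (hbil _ _).trans ?_
      calc Λ * (l2norm d1 * l2norm d1) ≤ Λ * ((C * x) * (C * x)) := by gcongr
        _ ≤ Λ * (C ^ 2 * (x * g)) := by gcongr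
        _ = _ := by ring
    rw [hQ]
    refine (abs_add_three _ _ _).trans ?_
    rw [abs_mul, abs_two]
    rw [abs_two] at c1
    have e1 : 2 * (m * (Λ * ((1 + C) * (r * g))) * (C * a)) =
        Λ * (2 * (1 + C) * C) * (x * g) := by rw [hx]; ring
    rw [e1] at c1
    have hsum := add_le_add (add_le_add (mul_le_mul_of_nonneg_left b1 zero_le_two) b2) c1
    refine hsum.trans ?_
    have e2 : 2 * (Λ * C * (x * g)) + Λ * C ^ 2 * (x * g) + Λ * (2 * (1 + C) * C) * (x * g) =
        C5 * (x * g) := by rw [hC5]; ring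
    rw [e2]
    refine le_trans ?_ (le_of_eq (mul_assoc _ _ _).symm)
    refine mul_le_mul_of_nonneg_right ?_ hxg0.le
    linarith
  · have hI : IHat (M.data π ω) E - bil (M.A ω) M.γ (M.Gam π) =
        bil (M.A ω) M.γ d2 + bil (M.A ω) d1 (M.Gam π) + bil (M.A ω) d1 d2 + (1 / (n : ℝ) *
          (uHat (M.data π ω) E (GamHat E) ⬝ᵥ ((M.data π ω).Wᵀ *ᵥ
            ((M.data π ω).D - (M.data π ω).W *ᵥ E.thD))) + 1 / (n : ℝ) *
          (uHat (M.data π ω) E (gamHat E) ⬝ᵥ ((M.data π ω).Wᵀ *ᵥ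
            ((M.data π ω).Y - (M.data π ω).W *ᵥ E.thY)))) := by
      rw [IHat, hA, hA']
      conv_lhs => rw [show bil (Matrix.diagonal (zVar (M.Wmat ω))) (gamHat E) (GamHat E) =
        bil (Matrix.diagonal (zVar (M.Wmat ω))) (M.γ + d1) (M.Gam π + d2) by rw [← eγ, ← eΓ],
        bil_diagonal_add_add]
      ring
    have c1 := h.abs_correction_le hz0 hzΛ fΓ' hΛ0.le hCa hD.score 1
    have c2 := h.abs_correction_le hz0 hzΛ fγ' hΛ0.le hCa hY.score 1
    have b1 : |bil (M.A ω) M.γ d2| ≤ Λ * C * (x * g) := by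
      refine (hbil _ _).trans ?_
      calc Λ * (g * l2norm d2) ≤ Λ * (g * (C * x)) := by gcongr
        _ = _ := by ring
    have b2 : |bil (M.A ω) d1 (M.Gam π)| ≤ Λ * (G * C) * (x * g) := by
      refine (hbil _ _).trans ?_
      calc Λ * (l2norm d1 * l2norm (M.Gam π)) ≤ Λ * ((C * x) * (G * g)) := by gcongr
        _ = _ := by ring
    have b3 : |bil (M.A ω) d1 d2| ≤ Λ * C ^ 2 * (x * g) := by
      refine (hbil _ _).trans ?_
      calc Λ * (l2norm d1 * l2norm d2) ≤ Λ * ((C * x) * (C * x)) := by gcongr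
        _ ≤ Λ * (C ^ 2 * (x * g)) := by gcongr
        _ = _ := by ring
    rw [abs_one, one_mul] at c1 c2
    have e1 : m * (Λ * ((G + C) * (r * g))) * (C * a) = Λ * ((G + C) * C) * (x * g) := by
      rw [hx]; ring
    have e2 : m * (Λ * ((1 + C) * (r * g))) * (C * a) = Λ * ((1 + C) * C) * (x * g) := by
      rw [hx]; ring
    rw [e1] at c1
    rw [e2] at c2
    rw [hI]
    refine (abs_add_le _ _).trans ?_
    refine (add_le_add (abs_add_three _ _ _) (abs_add_le _ _)).trans ?_
    refine (add_le_add (add_le_add (add_le_add b1 b2) b3) (add_le_add c1 c2)).trans ?_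
    have e3 : Λ * C * (x * g) + Λ * (G * C) * (x * g) + Λ * C ^ 2 * (x * g) +
        (Λ * ((G + C) * C) * (x * g) + Λ * ((1 + C) * C) * (x * g)) =
        (Λ * C + Λ * (G * C) + Λ * C ^ 2 + Λ * ((G + C) * C) + Λ * ((1 + C) * C)) * (x * g) := by
      ring
    rw [e3]
    refine le_trans ?_ (le_of_eq (mul_assoc _ _ _).symm)
    refine mul_le_mul_of_nonneg_right ?_ hxg0.le
    have b6 : 0 < Λ * ((G + C) * C) := by positivity
    have b7 : 0 < Λ * ((1 + C) * C) := by positivity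
    rw [hC4]
    linarith

end Estimators

/-! ### Weighted projection of `Γ` off `γ`. -/

section Projection

variable {n : ℕ} {M : Design.{u} n} {π : Fin M.pz → ℝ} {w : Fin M.pz → ℝ} {α Λ : ℝ}

theorem bil_gam_piOf (h : quad (Matrix.diagonal w) M.γ ≠ 0) :
    bil (Matrix.diagonal w) M.γ (M.piOf (Matrix.diagonal w) π) = 0 := by
  rw [Design.piOf, sub_eq_add_neg, ← neg_smul, bil_add_right, bil_smul_right, Design.betaOf]
  change _ + _ * quad (Matrix.diagonal w) M.γ = 0
  rw [neg_mul, div_mul_cancel₀ _ h, add_neg_cancel]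

/-- Pythagoras: `π_B` is orthogonal to `γ` in the inner product of the weighting. So `π_B` minimizes
the form over `Γ - t γ`, which allows `π_A` and `π_{A*}` to be compared. -/
theorem quad_sub_smul_gam (h : quad (Matrix.diagonal w) M.γ ≠ 0) (t : ℝ) :
    quad (Matrix.diagonal w) (M.Gam π - t • M.γ) =
      quad (Matrix.diagonal w) (M.piOf (Matrix.diagonal w) π) +
        (M.betaOf (Matrix.diagonal w) π - t) ^ 2 * quad (Matrix.diagonal w) M.γ := by
  have e : M.Gam π - t • M.γ = M.piOf (Matrix.diagonal w) π +
      (M.betaOf (Matrix.diagonal w) π - t) • M.γ := by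
    rw [Design.piOf, sub_smul]; abel
  rw [e, quad_diagonal_add, bil_smul_right, bil_diagonal_comm, bil_gam_piOf h]
  simp only [quad_diagonal, Pi.smul_apply, smul_eq_mul, Finset.mul_sum, mul_zero, add_zero]
  congr 1
  exact Finset.sum_congr rfl fun j _ => by ring

theorem quad_gam_pos (hγ : M.γ ≠ 0) (hα : 0 < α) (hw : ∀ j, α ≤ w j) :
    0 < quad (Matrix.diagonal w) M.γ :=
  lt_of_lt_of_le (mul_pos hα (pow_pos (l2norm_pos hγ) 2)) (le_quad_diagonal hw _)

/-- Minimality of the projection residual, across two weightings. -/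
theorem l2norm_piOf_le {w' : Fin M.pz → ℝ} (hγ : M.γ ≠ 0) (hα : 0 < α) (hw : ∀ j, α ≤ w j)
    (hw' : ∀ j, w j ≤ Λ) :
    α * l2norm (M.piOf (Matrix.diagonal w) π) ^ 2 ≤
      Λ * l2norm (M.piOf (Matrix.diagonal w') π) ^ 2 := by
  have hq := quad_gam_pos hγ hα hw
  have h1 := quad_sub_smul_gam (π := π) hq.ne' (M.betaOf (Matrix.diagonal w') π)
  have h2 := mul_nonneg (sq_nonneg (M.betaOf (Matrix.diagonal w) π -
    M.betaOf (Matrix.diagonal w') π)) hq.le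
  have h3 := le_quad_diagonal hw (M.piOf (Matrix.diagonal w) π)
  have h4 := quad_diagonal_le hw' (M.piOf (Matrix.diagonal w') π)
  rw [Design.piOf.eq_1 M (Matrix.diagonal w')] at *
  linarith

theorem abs_betaOf_sub_le (hγ : M.γ ≠ 0) (hα : 0 < α) (hΛ : 0 ≤ Λ) (hw : ∀ j, α ≤ w j)
    (hw' : ∀ j, w j ≤ Λ) :
    |M.betaOf (Matrix.diagonal w) π - M.β| ≤ Λ / α * (l2norm π / l2norm M.γ) := by
  have hq := quad_gam_pos hγ hα hw
  have hg := l2norm_pos hγ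
  have e : M.betaOf (Matrix.diagonal w) π - M.β =
      bil (Matrix.diagonal w) M.γ π / quad (Matrix.diagonal w) M.γ := by
    rw [Design.betaOf, Design.Gam, bil_add_right, bil_smul_right]
    change (_ * quad (Matrix.diagonal w) M.γ + _) / _ - _ = _
    field_simp
    ring
  rw [e, abs_div, abs_of_pos hq]
  have h1 := abs_bil_diagonal_le (fun j => hα.le.trans (hw j)) hw' hΛ M.γ π
  have h2 := le_quad_diagonal hw M.γ
  have hp := l2norm_nonneg π
  calc _ ≤ Λ * (l2norm M.γ * l2norm π) / (α * l2norm M.γ ^ 2) :=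
        div_le_div₀ (by positivity) h1 (by positivity) h2
    _ = _ := by field_simp

end Projection

/-! ### The estimators `β̂_A`, `π̂_A` and `Q̂_A`. -/

section Estimators

variable {K : Constants} {T : Tuning K} {κ : ℝ} {n : ℕ} {M : Design.{u} n} {m : ℝ} {s : ℕ}
  {π : Fin M.pz → ℝ} {ω : M.S} {E : Estimates M.px M.pz}

/-- The estimator `β̂_A` is well defined and close to `β_A`. -/
theorem exists_betaHat_bounds (T : Tuning K) : ∃ κ C : ℝ, 0 < κ ∧ κ ≤ 1 ∧ 0 < C ∧
    ∀ {n : ℕ} {M : Design.{u} n} {m : ℝ} {s : ℕ} {π : Fin M.pz → ℝ} {ω : M.S}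
      {E : Estimates M.px M.pz}, Setup T κ M m s π ω E →
      K.cSig / 4 * l2norm M.γ ^ 2 ≤ QgamHat (M.data π ω) E ∧
      |betaHat (M.data π ω) E - M.betaOf (M.A ω) π| * l2norm M.γ ≤
        C * (m * Real.sqrt s * M.rate) ∧
      |betaHat (M.data π ω) E - M.betaOf (M.A ω) π| ≤ 1 ∧
      |M.betaOf (M.A ω) π - M.β| ≤ 4 * K.CSig / K.cSig * (l2norm π / l2norm M.γ) ∧
      |M.betaOf (M.A ω) π - M.β| ≤ C ∧ |betaHat (M.data π ω) E - M.β| ≤ C := by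
  obtain ⟨κ1, hκ1, hκ1', hz⟩ := exists_zVar_bounds.{u} T
  obtain ⟨κ2, C, hκ2, -, hC, hdeb⟩ := exists_debiased_bounds.{u} T
  have hc := K.cSig_pos
  have hCS := K.cSig_pos.trans_le K.cSig_le
  have hcl := T.Clam_pos
  have hCβ := T.Cβ_pos
  have hC3 : 0 < T.C3 := hcl.trans_le T.Clam_le_C3
  set H := 4 * K.CSig / K.cSig * (T.C3 / T.Clam) with hH
  have hH0 : 0 < H := by positivity
  set C' := C * (1 + T.Cβ + H) / (K.cSig / 4) with hC'
  have hC'0 : 0 < C' := by positivity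
  -- The threshold `cSig / (4 C)` keeps `Q̂_A(γ)` above half of the lower bound for `Q_A(γ)`; the
  -- threshold `1 / C'` forces `|β̂_A - β_A| ≤ 1`.
  refine ⟨min (min κ1 κ2) (min (K.cSig / (4 * C)) (1 / C')), C' + (H + 1), ?_, ?_, by positivity, ?_⟩
  · exact lt_min (lt_min hκ1 hκ2) (lt_min (by positivity) (by positivity))
  · exact (min_le_left _ _).trans ((min_le_left _ _).trans hκ1')
  intro n M m s π ω E h
  set κ := min (min κ1 κ2) (min (K.cSig / (4 * C)) (1 / C')) with hκ
  have hz := hz (h.mono ((min_le_left _ _).trans (min_le_left _ _)))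
  obtain ⟨-, -, hQ, hI⟩ := hdeb (h.mono ((min_le_left _ _).trans (min_le_right _ _)))
  obtain ⟨hg, ha, hr, hm, hrx, hxg, hπ, -⟩ := h.sizes
  set g := l2norm M.γ
  set x := m * Real.sqrt s * M.rate with hx
  have hx0 : 0 < x := by positivity
  have hκ0 : 0 < κ := lt_min (lt_min hκ1 hκ2) (lt_min (by positivity) (by positivity))
  have hxκ : x ≤ κ * g := hxg.trans (mul_le_mul_of_nonneg_left (min_le_right _ _) hκ0.le)
  have hx1 : C * x ≤ K.cSig / 4 * g := by
    have h1 : κ ≤ K.cSig / (4 * C) := (min_le_right _ _).trans (min_le_left _ _)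
    have h2 := mul_le_mul_of_nonneg_left (hxκ.trans (mul_le_mul_of_nonneg_right h1 hg.le)) hC.le
    have e : C * (K.cSig / (4 * C) * g) = K.cSig / 4 * g := by field_simp
    linarith
  have hx2 : C' * x ≤ g := by
    have h1 : κ ≤ 1 / C' := (min_le_right _ _).trans (min_le_right _ _)
    have h2 := mul_le_mul_of_nonneg_left (hxκ.trans (mul_le_mul_of_nonneg_right h1 hg.le)) hC'0.le
    have e : C' * (1 / C' * g) = g := by field_simp
    linarith
  have hw : ∀ j, K.cSig / 2 ≤ zVar (M.Wmat ω) j := fun j => (hz j).1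
  have hw' : ∀ j, zVar (M.Wmat ω) j ≤ 2 * K.CSig := fun j => (hz j).2
  have hc2 : 0 < K.cSig / 2 := by positivity
  have hA : M.A ω = Matrix.diagonal (zVar (M.Wmat ω)) := rfl
  have hqpos := quad_gam_pos h.reg.gam_ne hc2 hw
  have hqge := le_quad_diagonal hw M.γ
  have hb1 : |M.betaOf (M.A ω) π - M.β| ≤ 4 * K.CSig / K.cSig * (l2norm π / g) := by
    refine (abs_betaOf_sub_le h.reg.gam_ne hc2 (by positivity) hw hw').trans (le_of_eq ?_)
    have e : 2 * K.CSig / (K.cSig / 2) = 4 * K.CSig / K.cSig := by field_simp; ring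
    rw [e]
  have hb2 : |M.betaOf (M.A ω) π - M.β| ≤ H := by
    refine hb1.trans (mul_le_mul_of_nonneg_left ?_ (by positivity))
    rwa [div_le_iff₀ hg]
  have hb3 : |M.betaOf (M.A ω) π| ≤ T.Cβ + H := by
    have e : M.betaOf (M.A ω) π = M.β + (M.betaOf (M.A ω) π - M.β) := by ring
    rw [e]
    exact (abs_add_le _ _).trans (add_le_add h.beta hb2)
  have hQhat : K.cSig / 4 * g ^ 2 ≤ QgamHat (M.data π ω) E := by
    have h1 := (abs_le.1 hQ).1
    have h2 := mul_le_mul_of_nonneg_right hx1 hg.le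
    rw [hA] at h1
    nlinarith
  have hQpos : 0 < QgamHat (M.data π ω) E := lt_of_lt_of_le (by positivity) hQhat
  -- Because `I_A = β_A Q_A`, the numerator only contains the two estimation errors, each of order
  -- `x ‖γ‖`, while the denominator is of order `‖γ‖²`.
  have hdiff : betaHat (M.data π ω) E - M.betaOf (M.A ω) π =
      ((IHat (M.data π ω) E - bil (M.A ω) M.γ (M.Gam π)) - M.betaOf (M.A ω) π *
        (QgamHat (M.data π ω) E - quad (M.A ω) M.γ)) / QgamHat (M.data π ω) E := by
    rw [betaHat, if_pos hQpos, eq_div_iff hQpos.ne', sub_mul, div_mul_cancel₀ _ hQpos.ne', mul_sub]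
    have e : M.betaOf (M.A ω) π * quad (M.A ω) M.γ = bil (M.A ω) M.γ (M.Gam π) := by
      rw [Design.betaOf, div_mul_cancel₀ _ (by rw [hA]; exact hqpos.ne')]
    rw [e]; ring
  have hnum : |(IHat (M.data π ω) E - bil (M.A ω) M.γ (M.Gam π)) - M.betaOf (M.A ω) π *
        (QgamHat (M.data π ω) E - quad (M.A ω) M.γ)| ≤ C * (1 + T.Cβ + H) * x * g := by
    refine (abs_sub _ _).trans ?_
    rw [abs_mul]
    have h1 := mul_le_mul hb3 hQ (abs_nonneg _) (by positivity)
    calc _ ≤ C * x * g + (T.Cβ + H) * (C * x * g) := add_le_add hI h1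
      _ = _ := by ring
  have hmain : |betaHat (M.data π ω) E - M.betaOf (M.A ω) π| * g ≤ C' * x := by
    rw [hdiff, abs_div, abs_of_pos hQpos, div_mul_eq_mul_div, div_le_iff₀ hQpos]
    have h1 := mul_le_mul_of_nonneg_right hnum hg.le
    have h2 := mul_le_mul_of_nonneg_left hQhat (by positivity : 0 ≤ C' * x)
    have e : C' * x * (K.cSig / 4 * g ^ 2) = C * (1 + T.Cβ + H) * x * g * g := by
      rw [hC']; field_simp
    linarith
  have hone : |betaHat (M.data π ω) E - M.betaOf (M.A ω) π| ≤ 1 := by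
    have h1 := hmain.trans hx2
    by_contra hcon
    have := mul_lt_mul_of_pos_right (not_le.1 hcon) hg
    linarith
  refine ⟨hQhat, hmain.trans ?_, hone, hb1, ?_, ?_⟩
  · exact mul_le_mul_of_nonneg_right (by linarith) hx0.le
  · linarith
  · have e : betaHat (M.data π ω) E - M.β = (betaHat (M.data π ω) E - M.betaOf (M.A ω) π) +
      (M.betaOf (M.A ω) π - M.β) := by ring
    rw [e]
    refine (abs_add_le _ _).trans ?_
    linarith

/-- The Lasso fit of `Y - D β̂_A`. -/
theorem exists_third_stage_bounds (T : Tuning K) : ∃ κ C : ℝ, 0 < κ ∧ κ ≤ 1 ∧ 0 < C ∧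
    ∀ {n : ℕ} {M : Design.{u} n} {m : ℝ} {s : ℕ} {π : Fin M.pz → ℝ} {ω : M.S}
      {E : Estimates M.px M.pz}, Setup T κ M m s π ω E →
      LassoBounds C M s (E.thA - M.thetaY π (betaHat (M.data π ω) E))
        ((1 / (n : ℝ)) • ((M.Wmat ω)ᵀ *ᵥ resid (M.data π ω) E)) := by
  obtain ⟨κ1, hκ1, hκ1', hlasso⟩ := exists_lasso_constant.{u} T
  obtain ⟨κ2, C2, hκ2, -, -, hbeta⟩ := exists_betaHat_bounds.{u} T
  have hcl := T.Clam_pos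
  obtain ⟨C, hC, hA⟩ := hlasso T.C3 (hcl.trans_le T.Clam_le_C3)
  refine ⟨min κ1 κ2, C, lt_min hκ1 hκ2, (min_le_left _ _).trans hκ1', hC, ?_⟩
  intro n M m s π ω E h
  obtain ⟨-, -, hone, hb, -, -⟩ := hbeta (h.mono (min_le_right _ _))
  have ha := rate_nonneg (M := M)
  have hτ := T.τ_pos
  have hCβ := T.Cβ_pos
  have hc := K.cSig_pos
  have hCS := K.cSig_pos.trans_le K.cSig_le
  set t := betaHat (M.data π ω) E with ht
  refine hA (h.mono (min_le_left _ _)) (data_Y_sub (M := M) (π := π) (ω := ω) t) (fun j => ?_)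
    (h.l0norm_le.2.2.2 t) h.est.lassoA
  refine (h.noise_le (M.β - t) j).trans ?_
  have hρ : 0 ≤ l2norm π / l2norm M.γ := div_nonneg (l2norm_nonneg _) (l2norm_nonneg _)
  set ρ := l2norm π / l2norm M.γ
  have h1 : |M.β - t| ≤ 1 + 4 * K.CSig / K.cSig * ρ := by
    have e : M.β - t = -(t - M.betaOf (M.A ω) π) - (M.betaOf (M.A ω) π - M.β) := by ring
    rw [e]
    refine (abs_sub _ _).trans ?_
    rw [abs_neg]
    exact add_le_add hone hb
  have hL : 0 ≤ 4 * K.CSig / K.cSig := by positivity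
  -- The noise level is at most `2 + (4 C_Σ / c_Σ) ‖π‖ / ‖γ‖`. This is why the tuning constant has
  -- to grow with `1 + ‖π‖ / ‖γ‖` and why the bound on `Clam` contains `2 + 4 C_Σ / c_Σ`.
  have h2 : 4 * T.τ * (1 + |M.β - t|) ≤ T.C3 := by
    refine le_trans ?_ h.adm.2
    refine le_trans ?_ (mul_le_mul_of_nonneg_right T.le_Clam (by positivity))
    rw [mul_assoc (4 * T.τ)]
    refine mul_le_mul_of_nonneg_left ?_ (by positivity)
    have := mul_nonneg hCβ.le hρ
    have := mul_nonneg hL hρ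
    linarith
  have := mul_le_mul_of_nonneg_right h2 ha
  linarith

/-- Plug-in and bias-corrected estimation of `Q_A`, and the linear term. -/
theorem exists_QHat_bounds (T : Tuning K) : ∃ κ C : ℝ, 0 < κ ∧ κ ≤ 1 ∧ 0 < C ∧
    ∀ {n : ℕ} {M : Design.{u} n} {m : ℝ} {s : ℕ} {π : Fin M.pz → ℝ} {ω : M.S}
      {E : Estimates M.px M.pz}, Setup T κ M m s π ω E →
      |QHat (M.data π ω) E - M.QA π ω| ≤
        C * (m * Real.sqrt s * M.rate * l2norm (M.piStar π) + (m * Real.sqrt s * M.rate) ^ 2) ∧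
      |M.linTerm π ω| ≤ C * (m * Real.sqrt s * M.rate * l2norm (M.piStar π)) ∧
      l2norm (M.piStar π) ^ 2 ≤ C * M.QA π ω := by
  obtain ⟨κ1, hκ1, hκ1', hz⟩ := exists_zVar_bounds.{u} T
  obtain ⟨κ2, C2, hκ2, -, hC2, hbeta⟩ := exists_betaHat_bounds.{u} T
  obtain ⟨κ3, C3, hκ3, -, hC3, hthird⟩ := exists_third_stage_bounds.{u} T
  have hc := K.cSig_pos
  have hCS := K.cSig_pos.trans_le K.cSig_le
  have hτ := T.τ_pos
  set Λ := 2 * K.CSig with hΛ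
  have hΛ0 : 0 < Λ := by positivity
  set G := C2 + C3 with hG
  have hG0 : 0 < G := by positivity
  set R := Real.sqrt (Λ / (K.cSig / 2)) with hR
  have hR0 : 0 < R := by positivity
  set D1 := 2 * Λ * G + 4 * Λ * C3 with hD1
  set D2 := Λ * G ^ 2 + 2 * Λ * G * C3 with hD2
  set D3 := 2 * Λ * (1 + C2) * T.τ with hD3
  set D4 := Λ / (K.cSig / 2) / (K.cSig / 2) with hD4
  have hD10 : 0 < D1 := by positivity
  have hD20 : 0 < D2 := by positivity
  have hD30 : 0 < D3 := by positivity
  have hD40 : 0 < D4 := by positivity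
  refine ⟨min κ1 (min κ2 κ3), D1 * R + D2 + D3 * R + D4, lt_min hκ1 (lt_min hκ2 hκ3),
    (min_le_left _ _).trans hκ1', by positivity, ?_⟩
  intro n M m s π ω E h
  have hz := hz (h.mono (min_le_left _ _))
  obtain ⟨-, hbx, -, -, hb5, -⟩ := hbeta (h.mono ((min_le_right _ _).trans (min_le_left _ _)))
  have hA3 := hthird (h.mono ((min_le_right _ _).trans (min_le_right _ _)))
  obtain ⟨hg, ha, hr, hm, hrx, -, -, -⟩ := h.sizes
  set g := l2norm M.γ
  set r := Real.sqrt s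
  set a := M.rate
  set x := m * r * a with hx
  have hx0 : 0 < x := by positivity
  have hw : ∀ j, K.cSig / 2 ≤ zVar (M.Wmat ω) j := fun j => (hz j).1
  have hz0 : ∀ j, 0 ≤ zVar (M.Wmat ω) j := fun j => by linarith [(hz j).1]
  have hzΛ : ∀ j, zVar (M.Wmat ω) j ≤ Λ := fun j => (hz j).2
  have hc2 : 0 < K.cSig / 2 := by positivity
  have hA : M.A ω = Matrix.diagonal (zVar (M.Wmat ω)) := rfl
  have hA' : weightA (M.data π ω).W = Matrix.diagonal (zVar (M.Wmat ω)) := rfl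
  set t := betaHat (M.data π ω) E
  set bA := M.betaOf (M.A ω) π
  set pA := M.piOf (M.A ω) π with hpA
  set P := l2norm pA with hP
  have hP0 : 0 ≤ P := l2norm_nonneg _
  -- comparison of the two projections
  have hstar : ∀ j, K.cSig / 2 ≤ M.Sig (Sum.inr j) (Sum.inr j) ∧
      M.Sig (Sum.inr j) (Sum.inr j) ≤ Λ := fun j => by
    have := Sig_diag_bounds h.reg.design (Sum.inr j)
    constructor <;> linarith [this.1, this.2]
  have hps : M.piStar π =
      M.piOf (Matrix.diagonal fun j => M.Sig (Sum.inr j) (Sum.inr j)) π := by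
    rw [Design.piStar, Astar_eq]
  have hPS : P ≤ R * l2norm (M.piStar π) := by
    have h1 := l2norm_piOf_le (π := π) (w' := fun j => M.Sig (Sum.inr j) (Sum.inr j))
      h.reg.gam_ne hc2 hw hzΛ
    rw [← hps, ← hA, ← hpA, ← hP] at h1
    refine le_of_sq_le_sq ?_ (mul_nonneg hR0.le (l2norm_nonneg _))
    rw [mul_pow, hR, Real.sq_sqrt (by positivity), div_mul_eq_mul_div, le_div_iff₀ hc2]
    linarith
  have hSP : l2norm (M.piStar π) ^ 2 ≤ D4 * M.QA π ω := by
    have h1 := l2norm_piOf_le (π := π) (w' := zVar (M.Wmat ω))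
      h.reg.gam_ne hc2 (fun j => (hstar j).1) fun j => (hstar j).2
    rw [← hps, ← hA, ← hpA, ← hP] at h1
    have h2 : K.cSig / 2 * P ^ 2 ≤ M.QA π ω := le_quad_diagonal hw pA
    have e : D4 * M.QA π ω = Λ / (K.cSig / 2) * (M.QA π ω / (K.cSig / 2)) := by
      rw [hD4]; ring
    have h3 : P ^ 2 ≤ M.QA π ω / (K.cSig / 2) := by
      rw [le_div_iff₀ hc2]; linarith
    have h4 : l2norm (M.piStar π) ^ 2 ≤ Λ / (K.cSig / 2) * P ^ 2 := by
      rw [div_mul_eq_mul_div, le_div_iff₀ hc2]; linarith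
    rw [e]
    exact h4.trans (mul_le_mul_of_nonneg_left h3 (by positivity))
  -- the error of `π̂_A`
  set d1 : Fin M.pz → ℝ := fun j => (E.thA - M.thetaY π t) (Sum.inr j) with hd1
  set d := d1 + (bA - t) • M.γ with hd
  -- Two sources add up: the Lasso error around `Γ - β̂_A γ`, and the shift `(β_A - β̂_A) γ` of that
  -- target away from `π_A`.
  have hpi : piHat E = pA + d := by
    ext j
    simp only [hd, hd1, hpA, piHat, Design.piOf, Design.thetaY, Pi.add_apply, Pi.sub_apply,
      Pi.smul_apply, smul_eq_mul, Sum.elim_inr, bA]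
    ring
  have hbt : |bA - t| * g ≤ C2 * x := by rw [abs_sub_comm]; exact hbx
  have hd2 : l2norm d ≤ G * x := by
    refine (l2norm_add_le _ _).trans ?_
    rw [l2norm_smul]
    have h1 : l2norm d1 ≤ C3 * x := (l2norm_inr_le _).trans
      (hA3.l2.trans (mul_le_mul_of_nonneg_left hrx hC3.le))
    linarith
  have hl0 := h.l0norm_le
  have hrsq : ∀ k : ℕ, k ≤ s → Real.sqrt k ≤ r := fun k hk =>
    Real.sqrt_le_sqrt (by exact_mod_cast hk)
  have fγ : l1norm M.γ ≤ r * g := (l1norm_le_sqrt_l0norm_mul _).trans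
    (mul_le_mul_of_nonneg_right (hrsq _ hl0.1) hg.le)
  have hd3 : l1norm d ≤ G * (r * x) := by
    refine (l1norm_add_le _ _).trans ?_
    rw [l1norm_smul]
    have h1 : l1norm d1 ≤ C3 * (r * x) := (l1norm_inr_le _).trans
      (hA3.l1.trans (by gcongr))
    have h2 : |bA - t| * l1norm M.γ ≤ C2 * (r * x) := by
      calc |bA - t| * l1norm M.γ ≤ |bA - t| * (r * g) := by gcongr
        _ = r * (|bA - t| * g) := by ring
        _ ≤ r * (C2 * x) := by gcongr
        _ = _ := by ring
    linarith
  -- `π_A` combines `Γ` and `γ`, so it is sparse although it depends on the data. The count is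
  -- rounded up to `4 s` to make the square root `2 √s`.
  have fpA : l1norm pA ≤ 2 * r * P := by
    have h1 : l0norm pA ≤ 4 * s := by
      have := l0norm_sub_smul_le (M.Gam π) M.γ bA
      change l0norm pA ≤ _ at this
      omega
    refine (l1norm_le_sqrt_l0norm_mul _).trans (mul_le_mul_of_nonneg_right ?_ hP0)
    refine (Real.sqrt_le_sqrt (show (l0norm pA : ℝ) ≤ (4 * s : ℕ) by exact_mod_cast h1)).trans ?_
    push_cast
    rw [Real.sqrt_mul (by norm_num), show (4 : ℝ) = 2 ^ 2 by norm_num,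
      Real.sqrt_sq (by norm_num)]
  have fpi : l1norm (piHat E) ≤ 2 * r * P + G * (r * x) := by
    rw [hpi]; exact (l1norm_add_le _ _).trans (add_le_add fpA hd3)
  have hbil := fun u v => abs_bil_diagonal_le hz0 hzΛ hΛ0.le u v
  have hd0 := l2norm_nonneg d
  have hxP : x * P ≤ R * (x * l2norm (M.piStar π)) := by
    have := mul_le_mul_of_nonneg_left hPS hx0.le
    linarith
  have hS0 := l2norm_nonneg (M.piStar π)
  have hxS : 0 ≤ x * l2norm (M.piStar π) := by positivity
  refine ⟨?_, ?_, ?_⟩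
  · have hQ : QHat (M.data π ω) E - M.QA π ω = 2 * bil (M.A ω) pA d + bil (M.A ω) d d +
        2 / (n : ℝ) * (uHat (M.data π ω) E (piHat E) ⬝ᵥ ((M.data π ω).Wᵀ *ᵥ
          resid (M.data π ω) E)) := by
      rw [QHat, Design.QA, ← hpA, hA, hA']
      conv_lhs => rw [show quad (Matrix.diagonal (zVar (M.Wmat ω))) (piHat E) =
        quad (Matrix.diagonal (zVar (M.Wmat ω))) (pA + d) by rw [← hpi], quad_diagonal_add]
      have hq : quad (Matrix.diagonal (zVar (M.Wmat ω))) d =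
        bil (Matrix.diagonal (zVar (M.Wmat ω))) d d := rfl
      rw [hq]; ring
    have c1 := h.abs_correction_le hz0 hzΛ fpi hΛ0.le (by positivity) hA3.score 2
    have b1 : |bil (M.A ω) pA d| ≤ Λ * G * (x * P) := by
      refine (hbil _ _).trans ?_
      calc Λ * (P * l2norm d) ≤ Λ * (P * (G * x)) := by gcongr
        _ = _ := by ring
    have b2 : |bil (M.A ω) d d| ≤ Λ * G ^ 2 * x ^ 2 := by
      refine (hbil _ _).trans ?_
      calc Λ * (l2norm d * l2norm d) ≤ Λ * ((G * x) * (G * x)) := by gcongr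
        _ = _ := by ring
    have e1 : 2 * (m * (Λ * (2 * r * P + G * (r * x))) * (C3 * a)) =
        4 * Λ * C3 * (x * P) + 2 * Λ * G * C3 * x ^ 2 := by
      rw [hx]; ring
    rw [abs_two, e1] at c1
    rw [hQ]
    refine (abs_add_three _ _ _).trans ?_
    rw [abs_mul, abs_two]
    have hsum := add_le_add (add_le_add (mul_le_mul_of_nonneg_left b1 zero_le_two) b2) c1
    refine hsum.trans ?_
    have e2 : 2 * (Λ * G * (x * P)) + Λ * G ^ 2 * x ^ 2 +
        (4 * Λ * C3 * (x * P) + 2 * Λ * G * C3 * x ^ 2) = D1 * (x * P) + D2 * x ^ 2 := by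
      rw [hD1, hD2]; ring
    rw [e2]
    have h1 := mul_le_mul_of_nonneg_left hxP hD10.le
    have h2 : 0 ≤ (D2 + D3 * R + D4) * (x * l2norm (M.piStar π)) := by positivity
    have h3 : 0 ≤ (D1 * R + D3 * R + D4) * x ^ 2 := by positivity
    linarith
  -- The linear term is bounded by Hölder's inequality with the score of `e_A`, so it has the same
  -- order as the leading error of `Q̂_A`.
  · have hnoise : ∀ j, |((1 / (n : ℝ)) • ((M.Wmat ω)ᵀ *ᵥ M.eA π ω)) j| ≤
        (1 + C2) * (T.τ * a) := fun j => by
      have e : M.eA π ω = fun i => M.e i ω + (M.β - bA) * M.eps2 i ω := by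
        ext i; simp only [Design.eA, Design.eps1, bA]; ring
      rw [e]
      refine (h.noise_le _ j).trans (mul_le_mul_of_nonneg_right ?_ (by positivity))
      rw [abs_sub_comm]
      linarith
    have e : M.linTerm π ω = emb (M.A ω *ᵥ pA) ⬝ᵥ ((1 / (n : ℝ)) • ((M.Wmat ω)ᵀ *ᵥ M.eA π ω)) := by
      rw [dotProduct_smul, smul_eq_mul, one_div, inv_mul_eq_div]; rfl
    rw [e]
    refine (abs_dotProduct_le_l1norm hnoise).trans ?_
    rw [l1norm_emb, hA]
    have h1 := l1norm_diagonal_mulVec_le hz0 hzΛ pA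
    have h0 : (r * a) * P ≤ x * P := mul_le_mul_of_nonneg_right hrx hP0
    calc l1norm (Matrix.diagonal (zVar (M.Wmat ω)) *ᵥ pA) * ((1 + C2) * (T.τ * a))
        ≤ (Λ * (2 * r * P)) * ((1 + C2) * (T.τ * a)) := by
          refine mul_le_mul_of_nonneg_right (h1.trans ?_) (by positivity)
          gcongr
      _ = D3 * (r * a * P) := by rw [hD3]; ring
      _ ≤ D3 * (R * (x * l2norm (M.piStar π))) := by
          refine mul_le_mul_of_nonneg_left (h0.trans hxP) hD30.le
      _ ≤ _ := by
          have h2 : 0 ≤ (D1 * R + D2 + D4) * (x * l2norm (M.piStar π)) := by positivity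
          linarith
  · refine hSP.trans (mul_le_mul_of_nonneg_right ?_ ?_)
    · have : 0 < D1 * R + D2 + D3 * R := by positivity
      linarith
    · exact le_trans (by positivity : 0 ≤ K.cSig / 2 * P ^ 2) (le_quad_diagonal hw pA)

end Estimators

/-! ### The diagonal of the variance estimator `V̂_A`. -/

section Variance

/-- The vector `Ω̂ᵀ (0ᵀ, aᵀ)ᵀ` for `a` the `j`-th row of `Â₀`. -/
noncomputable def varLoading {n px pz : ℕ} (d : Data n px pz) (E : Estimates px pz) (j : Fin pz) :
    Idx px pz → ℝ :=
  (OmHat E)ᵀ *ᵥ emb (A0Hat d E j)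

/-- Each diagonal entry is an average of `(bᵀ W_i)² ê_i²` with a data-dependent loading `b`, the
form to which the uniform bounds of `SampleBounds` apply. -/
theorem VHat_diag {n px pz : ℕ} (d : Data n px pz) (E : Estimates px pz) (j : Fin pz) :
    VHat d E j j = (1 / (n : ℝ)) * ∑ i, (varLoading d E j ⬝ᵥ d.W i) ^ 2 * resid d E i ^ 2 := by
  have hN : (A0Hat d E * OmHatZ E) j = varLoading d E j := by
    ext l
    simp [varLoading, mul_apply, OmHatZ, mulVec, dotProduct, Fintype.sum_sum_type, emb, mul_comm]
  rw [VHat, Matrix.mul_assoc _ (OmHatZ E)ᵀ, ← transpose_mul, Matrix.smul_apply, smul_eq_mul]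
  congr 1
  rw [Matrix.mul_sum, Matrix.sum_mul, Matrix.sum_apply]
  refine Finset.sum_congr rfl fun i _ => ?_
  rw [Matrix.mul_smul, Matrix.smul_mul, Matrix.smul_apply, smul_eq_mul, mul_vecMulVec,
    vecMulVec_mul, vecMulVec_apply, vecMul_transpose]
  have e : ((A0Hat d E * OmHatZ E) *ᵥ d.W i) j = varLoading d E j ⬝ᵥ d.W i := by
    rw [← hN]; rfl
  rw [e]; ring

theorem A0Hat_row {n px pz : ℕ} (d : Data n px pz) (E : Estimates px pz) (j : Fin pz) :
    A0Hat d E j = Real.sqrt (zVar d.W j) • ((Pi.single j 1 : Fin pz → ℝ) -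
      (gamHat E j / QgamHat d E) • (weightA d.W *ᵥ gamHat E)) := by
  ext k
  rw [A0Hat, sqrtA, diagonal_mul]
  simp only [Matrix.sub_apply, Matrix.smul_apply, smul_eq_mul, Pi.smul_apply, Pi.sub_apply,
    weightA, mulVec_diagonal, mul_diagonal, vecMulVec_apply, one_apply, Pi.single_apply,
    eq_comm (a := k)]
  ring

variable {K : Constants} {T : Tuning K} {κ : ℝ} {n : ℕ} {M : Design.{u} n} {m : ℝ} {s : ℕ}
  {π : Fin M.pz → ℝ} {ω : M.S} {E : Estimates M.px M.pz}

/-- At least two instruments are needed: with a single one the projection off `γ` would leave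
nothing. -/
theorem exists_coord_le_half {pz : ℕ} (h : 2 ≤ pz) {f : Fin pz → ℝ} (hf : ∀ j, 0 ≤ f j) :
    ∃ j, f j ≤ (∑ k, f k) / 2 := by
  by_contra! hcon
  set i0 : Fin pz := ⟨0, by omega⟩
  set i1 : Fin pz := ⟨1, by omega⟩
  have hne : i0 ≠ i1 := by simp [i0, i1]
  have h1 : f i0 + f i1 ≤ ∑ k, f k := by
    rw [← Finset.sum_pair hne]
    exact Finset.sum_le_sum_of_subset_of_nonneg (Finset.subset_univ _) fun k _ _ => hf k
  linarith [hcon i0, hcon i1]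

/-- The rows of `Â₀` are bounded, approximately sparse, and not all close to zero. -/
theorem exists_A0Hat_bounds (T : Tuning K) : ∃ κ C : ℝ, 0 < κ ∧ κ ≤ 1 ∧ 0 < C ∧
    ∀ {n : ℕ} {M : Design.{u} n} {m : ℝ} {s : ℕ} {π : Fin M.pz → ℝ} {ω : M.S}
      {E : Estimates M.px M.pz}, Setup T κ M m s π ω E →
      (∀ j, l2norm (A0Hat (M.data π ω) E j) ≤ C ∧
        l1norm (A0Hat (M.data π ω) E j) ≤ C * Real.sqrt s) ∧
      ∃ j, 2 / 25 * K.cSig ≤ l2norm (A0Hat (M.data π ω) E j) ^ 2 := by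
  obtain ⟨κ1, hκ1, hκ1', hz⟩ := exists_zVar_bounds.{u} T
  obtain ⟨κ2, C, hκ2, -, hC, hdeb⟩ := exists_debiased_bounds.{u} T
  obtain ⟨κ3, C3, hκ3, -, -, hbeta⟩ := exists_betaHat_bounds.{u} T
  have hc := K.cSig_pos
  have hCS := K.cSig_pos.trans_le K.cSig_le
  set Λ := 2 * K.CSig with hΛ
  have hΛ0 : 0 < Λ := by positivity
  set C' := C + Λ * (2 * C + C ^ 2) with hC'
  have hC'0 : 0 < C' := by positivity
  set A2 := Real.sqrt Λ * (1 + 4 * Λ * (1 + C) ^ 2 / K.cSig) with hA2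
  set A1 := Real.sqrt Λ * (1 + 4 * Λ * ((1 + C) * C) / K.cSig) with hA1
  have hA20 : 0 < A2 := by positivity
  have hA10 : 0 < A1 := by positivity
  refine ⟨min (min κ1 κ2) (min κ3 (K.cSig / (20 * C'))), A2 + A1, ?_, ?_, by positivity, ?_⟩
  · exact lt_min (lt_min hκ1 hκ2) (lt_min hκ3 (by positivity))
  · exact (min_le_left _ _).trans ((min_le_left _ _).trans hκ1')
  intro n M m s π ω E h
  set κ := min (min κ1 κ2) (min κ3 (K.cSig / (20 * C'))) with hκ
  have hκ0 : 0 < κ := lt_min (lt_min hκ1 hκ2) (lt_min hκ3 (by positivity))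
  have hκ4 : κ ≤ 1 := (min_le_left _ _).trans ((min_le_left _ _).trans hκ1')
  have hz := hz (h.mono ((min_le_left _ _).trans (min_le_left _ _)))
  obtain ⟨hγ2, hγ1, hQ, -⟩ := hdeb (h.mono ((min_le_left _ _).trans (min_le_right _ _)))
  have hQge := (hbeta (h.mono ((min_le_right _ _).trans (min_le_left _ _)))).1
  obtain ⟨hg, ha, hr, hm, -, hxg, -, -⟩ := h.sizes
  set g := l2norm M.γ
  set r := Real.sqrt s
  set x := m * r * M.rate with hx
  have hx0 : 0 < x := by positivity
  have hxκ : x ≤ κ * g := hxg.trans (mul_le_mul_of_nonneg_left (min_le_right _ _) hκ0.le)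
  have hxg : x ≤ g := hxκ.trans (mul_le_of_le_one_left hg.le hκ4)
  have hw : ∀ j, K.cSig / 2 ≤ zVar (M.Wmat ω) j := fun j => (hz j).1
  have hz0 : ∀ j, 0 ≤ zVar (M.Wmat ω) j := fun j => by linarith [(hz j).1]
  have hzΛ : ∀ j, zVar (M.Wmat ω) j ≤ Λ := fun j => (hz j).2
  have hA : weightA (M.data π ω).W = Matrix.diagonal (zVar (M.Wmat ω)) := rfl
  have hA' : M.A ω = Matrix.diagonal (zVar (M.Wmat ω)) := rfl
  set Q := QgamHat (M.data π ω) E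
  have hQ0 : 0 < Q := lt_of_lt_of_le (by positivity) hQge
  have hgam : l2norm (gamHat E) ≤ (1 + C) * g := by
    have e : gamHat E = M.γ + (gamHat E - M.γ) := by abel
    rw [e]
    refine (l2norm_add_le _ _).trans ?_
    have := hγ2.trans (mul_le_mul_of_nonneg_left hxg hC.le)
    linarith
  have hAv2 : l2norm (Matrix.diagonal (zVar (M.Wmat ω)) *ᵥ gamHat E) ≤ Λ * l2norm (gamHat E) := by
    refine le_of_sq_le_sq ?_ (mul_nonneg hΛ0.le (l2norm_nonneg _))
    rw [mul_pow, l2norm_sq, l2norm_sq, Finset.mul_sum]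
    refine Finset.sum_le_sum fun j _ => ?_
    rw [mulVec_diagonal, mul_pow]
    exact mul_le_mul_of_nonneg_right (pow_le_pow_left₀ (hz0 j) (hzΛ j) 2) (sq_nonneg _)
  have hratio : ∀ j, |gamHat E j / Q| ≤ (1 + C) * g / (K.cSig / 4 * g ^ 2) := fun j => by
    rw [abs_div, abs_of_pos hQ0]
    exact div_le_div₀ (by positivity) ((abs_apply_le_l2norm _ j).trans hgam) (by positivity) hQge
  have hsqrt : ∀ j, |Real.sqrt (zVar (M.Wmat ω) j)| ≤ Real.sqrt Λ := fun j => by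
    rw [abs_of_nonneg (Real.sqrt_nonneg _)]
    exact Real.sqrt_le_sqrt (hzΛ j)
  have hrow : ∀ j, A0Hat (M.data π ω) E j = Real.sqrt (zVar (M.Wmat ω) j) •
      ((Pi.single j 1 : Fin M.pz → ℝ) -
        (gamHat E j / Q) • (Matrix.diagonal (zVar (M.Wmat ω)) *ᵥ gamHat E)) :=
    fun j => A0Hat_row _ _ _
  refine ⟨fun j => ⟨?_, ?_⟩, ?_⟩
  · rw [hrow, l2norm_smul]
    have h1 : l2norm ((Pi.single j 1 : Fin M.pz → ℝ) -
        (gamHat E j / Q) • (Matrix.diagonal (zVar (M.Wmat ω)) *ᵥ gamHat E)) ≤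
        1 + 4 * Λ * (1 + C) ^ 2 / K.cSig := by
      refine (l2norm_sub_le _ _).trans ?_
      rw [l2norm_smul]
      have e1 : l2norm (Pi.single j 1 : Fin M.pz → ℝ) = 1 := by simp [l2norm, Pi.single_apply]
      rw [e1]
      refine add_le_add le_rfl ?_
      calc _ ≤ (1 + C) * g / (K.cSig / 4 * g ^ 2) * (Λ * ((1 + C) * g)) :=
            mul_le_mul (hratio j) (hAv2.trans (mul_le_mul_of_nonneg_left hgam hΛ0.le))
              (l2norm_nonneg _) (by positivity)
        _ = _ := by field_simp
    have h2 : |Real.sqrt (zVar (M.Wmat ω) j)| * _ ≤ A2 :=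
      mul_le_mul (hsqrt j) h1 (l2norm_nonneg _) (Real.sqrt_nonneg _)
    linarith
  · rw [hrow, l1norm_smul]
    have h1 : l1norm ((Pi.single j 1 : Fin M.pz → ℝ) -
        (gamHat E j / Q) • (Matrix.diagonal (zVar (M.Wmat ω)) *ᵥ gamHat E)) ≤
        (1 + 4 * Λ * ((1 + C) * C) / K.cSig) * r := by
      refine (l1norm_sub_le _ _).trans ?_
      rw [l1norm_smul]
      have e1 : l1norm (Pi.single j 1 : Fin M.pz → ℝ) = 1 := by
        simp [l1norm, Pi.single_apply, apply_ite abs]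
      rw [e1, add_mul, one_mul]
      refine add_le_add hr ?_
      calc _ ≤ (1 + C) * g / (K.cSig / 4 * g ^ 2) * (Λ * (C * (r * g))) :=
            mul_le_mul (hratio j) ((l1norm_diagonal_mulVec_le hz0 hzΛ _).trans
              (mul_le_mul_of_nonneg_left hγ1 hΛ0.le)) (l1norm_nonneg _) (by positivity)
        _ = _ := by field_simp
    have h2 : |Real.sqrt (zVar (M.Wmat ω) j)| * _ ≤ Real.sqrt Λ * _ :=
      mul_le_mul (hsqrt j) h1 (l1norm_nonneg _) (Real.sqrt_nonneg _)
    refine h2.trans ?_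
    rw [← mul_assoc]
    exact mul_le_mul_of_nonneg_right (by linarith) (by linarith)
  · obtain ⟨j, hj⟩ := exists_coord_le_half h.reg.two_le_pz
      (f := fun j => zVar (M.Wmat ω) j * gamHat E j ^ 2)
      fun j => mul_nonneg (hz0 j) (sq_nonneg _)
    rw [← quad_diagonal] at hj
    -- The plug-in form exceeds `Q̂_A(γ)` by at most `(c_Σ / 20) ‖γ‖²`, which is at most a fifth of
    -- `Q̂_A(γ)`.
    have hplug : quad (Matrix.diagonal (zVar (M.Wmat ω))) (gamHat E) ≤ 6 / 5 * Q := by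
      set d1 := gamHat E - M.γ with hd1
      have hl := l2norm_nonneg d1
      have e : gamHat E = M.γ + d1 := by rw [hd1]; abel
      have h1 := abs_le.1 (abs_bil_diagonal_le hz0 hzΛ hΛ0.le M.γ d1)
      have h2 := quad_diagonal_le hzΛ d1
      have h3 : Λ * (g * l2norm d1) ≤ Λ * (g * (C * x)) := by gcongr
      have h4 : Λ * l2norm d1 ^ 2 ≤ Λ * (C ^ 2 * (x * g)) := by
        refine mul_le_mul_of_nonneg_left ?_ hΛ0.le
        calc l2norm d1 ^ 2 ≤ (C * x) ^ 2 := pow_le_pow_left₀ hl hγ2 2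
          _ = C ^ 2 * (x * x) := by ring
          _ ≤ _ := by gcongr
      have h5 := (abs_le.1 hQ).1
      rw [hA'] at h5
      have h6 : quad (Matrix.diagonal (zVar (M.Wmat ω))) (gamHat E) - Q ≤ C' * (x * g) := by
        rw [e, quad_diagonal_add, hC']
        have h7 := h1.2
        linarith
      have h8 : C' * (x * g) ≤ K.cSig / 20 * g ^ 2 := by
        have h9 : κ ≤ K.cSig / (20 * C') := (min_le_right _ _).trans (min_le_right _ _)
        calc C' * (x * g) ≤ C' * ((K.cSig / (20 * C') * g) * g) := by
              refine mul_le_mul_of_nonneg_left (mul_le_mul_of_nonneg_right ?_ hg.le) hC'0.le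
              exact hxκ.trans (mul_le_mul_of_nonneg_right h9 hg.le)
          _ = _ := by field_simp
      linarith
    refine ⟨j, ?_⟩
    -- Coordinate `j` carries at most half of the plug-in form, hence at most `3 / 5` of `Q̂_A(γ)`.
    -- The diagonal entry of `Â₀` then has square at least `(c_Σ / 2) (2 / 5)²`.
    have h1 : 2 / 5 ≤ 1 - zVar (M.Wmat ω) j * gamHat E j ^ 2 / Q := by
      have : zVar (M.Wmat ω) j * gamHat E j ^ 2 / Q ≤ 3 / 5 := by
        rw [div_le_iff₀ hQ0]; linarith
      linarith
    have h2 : A0Hat (M.data π ω) E j j ^ 2 =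
        zVar (M.Wmat ω) j * (1 - zVar (M.Wmat ω) j * gamHat E j ^ 2 / Q) ^ 2 := by
      rw [hrow]
      simp only [Pi.smul_apply, Pi.sub_apply, smul_eq_mul, Pi.single_eq_same, mulVec_diagonal]
      rw [mul_pow, Real.sq_sqrt (hz0 j)]
      ring
    have h3 : A0Hat (M.data π ω) E j j ^ 2 ≤ l2norm (A0Hat (M.data π ω) E j) ^ 2 := by
      rw [← sq_abs]
      exact pow_le_pow_left₀ (abs_nonneg _) (abs_apply_le_l2norm _ j) 2
    refine le_trans ?_ h3
    rw [h2]
    have h4 : (2 / 5 : ℝ) ^ 2 ≤ (1 - zVar (M.Wmat ω) j * gamHat E j ^ 2 / Q) ^ 2 :=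
      pow_le_pow_left₀ (by norm_num) h1 2
    have h5 := mul_le_mul (hw j) h4 (by norm_num) (hz0 j)
    linarith

theorem l2norm_sq_le_two_mul {ι : Type} [Fintype ι] (u v : ι → ℝ) :
    l2norm u ^ 2 ≤ 2 * l2norm v ^ 2 + 2 * l2norm (u - v) ^ 2 := by
  simp only [l2norm_sq, Finset.mul_sum, ← Finset.sum_add_distrib, Pi.sub_apply]
  exact Finset.sum_le_sum fun j _ => by nlinarith [sq_nonneg (u j - 2 * v j)]

theorem l2norm_sub_rev {ι : Type} [Fintype ι] (u v : ι → ℝ) : l2norm (u - v) = l2norm (v - u) := by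
  rw [← neg_sub, ← neg_one_smul ℝ, l2norm_smul]; simp

/-- `Ω̂ᵀ v` is compared with `Ω v` for `v` a row of `Â₀`. The `ℓ₂` error is at most the square root
of entrywise error times `ℓ₁` size, of order `m³ s √(log p / n)` after squaring, and the spectrum of
`Ω` transfers the bounds on `v`. -/
theorem exists_varLoading_bounds (T : Tuning K) : ∃ κ C c : ℝ, 0 < κ ∧ κ ≤ 1 ∧ 0 < C ∧ 0 < c ∧
    ∀ {n : ℕ} {M : Design.{u} n} {m : ℝ} {s : ℕ} {π : Fin M.pz → ℝ} {ω : M.S}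
      {E : Estimates M.px M.pz}, Setup T κ M m s π ω E →
      (∀ j, l2norm (varLoading (M.data π ω) E j) ^ 2 ≤ C ∧
        l1norm (varLoading (M.data π ω) E j) ≤ C * (m * Real.sqrt s)) ∧
      ∃ j, c ≤ l2norm (varLoading (M.data π ω) E j) ^ 2 := by
  obtain ⟨κ1, C, hκ1, hκ1', hC, hrow⟩ := exists_A0Hat_bounds.{u} T
  have hc := K.cSig_pos
  have hCS := K.cSig_pos.trans_le K.cSig_le
  have hτ := T.τ_pos
  have hCw : 0 < T.Cw := hτ.trans_le T.τ_le_Cw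
  set D := 2 * C ^ 2 * (2 * T.Cw + 2 * T.τ) with hD
  have hD0 : 0 < D := by positivity
  -- A quarter of `(2 / 25) c_Σ / C_Σ²`: from `4 c ≤ ‖Ω v‖² ≤ 2 ‖Ω̂ᵀ v‖² + 2 c` there remains `‖Ω̂ᵀ
  -- v‖² ≥ c`.
  set c := K.cSig / (50 * K.CSig ^ 2) with hcdef
  have hc0 : 0 < c := by positivity
  refine ⟨min κ1 (c / D), 2 * (C / K.cSig) ^ 2 + 2 * c + C, c, lt_min hκ1 (by positivity),
    (min_le_left _ _).trans hκ1', by positivity, hc0, ?_⟩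
  intro n M m s π ω E h
  obtain ⟨hup, j0, hlow⟩ := hrow (h.mono (min_le_left _ _))
  set κ := min κ1 (c / D) with hκ
  have hκ0 : 0 < κ := lt_min hκ1 (by positivity)
  obtain ⟨hg, ha, hr, hm, -, -, -, -⟩ := h.sizes
  have hmono := h.reg.monomial_le (i := 3) (j := 2) (k := 0) (by norm_num) (by norm_num)
    (by norm_num)
  rw [pow_zero, mul_one] at hmono
  set r := Real.sqrt s
  set a := M.rate
  have hmono : D * (m ^ 3 * r ^ 2 * a) ≤ c := by
    have h1 : m ^ 3 * r ^ 2 * a ≤ c / D :=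
      hmono.trans ((mul_le_of_le_one_right hκ0.le (min_le_left _ _)).trans (min_le_right _ _))
    calc _ ≤ D * (c / D) := mul_le_mul_of_nonneg_left h1 hD0.le
      _ = c := by field_simp
  have hm0 : 0 ≤ m := by linarith
  have herr : ∀ j k, |OmHat E j k - M.Om j k| ≤ m ^ 2 * a * (2 * T.Cw + 2 * T.τ) := fun j k => by
    refine (abs_climeSym_sub_le (Om_mul_Sig h.reg.posDef) (Om_symm h.reg.posDef) h.smp.gram_dev
      h.clime_columns.1 h.clime_columns.2 h.reg.col_sum j k).trans ?_
    have h1 : m * (2 * (T.Cw * a)) ≤ m ^ 2 * (2 * (T.Cw * a)) := by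
      refine mul_le_mul_of_nonneg_right ?_ (by positivity)
      nlinarith
    have e : m * (T.τ * a * (2 * m)) = m ^ 2 * a * (2 * T.τ) := by ring
    calc _ = m * (2 * (T.Cw * a)) + m * (T.τ * a * (2 * m)) := by ring
      _ ≤ m ^ 2 * (2 * (T.Cw * a)) + m ^ 2 * a * (2 * T.τ) := by linarith
      _ = _ := by ring
  have hb1 : ∀ j, l1norm (varLoading (M.data π ω) E j) ≤ m * (C * r) := fun j => by
    refine (l1norm_mulVec_le (m := m) (fun k => ?_) _).trans
      (mul_le_mul_of_nonneg_left ?_ hm0)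
    · simpa only [transpose_apply] using h.OmHat_col_sum_le.2 k
    · rw [l1norm_emb]; exact (hup j).2
  have happ : ∀ j, l2norm (varLoading (M.data π ω) E j -
      M.Om *ᵥ emb (A0Hat (M.data π ω) E j)) ^ 2 ≤ c := fun j => by
    set v : Idx M.px M.pz → ℝ := emb (A0Hat (M.data π ω) E j) with hv
    have hv1 : l1norm v ≤ C * r := by rw [hv, l1norm_emb]; exact (hup j).2
    have hent : ∀ k, |(varLoading (M.data π ω) E j - M.Om *ᵥ v) k| ≤
        C * r * (m ^ 2 * a * (2 * T.Cw + 2 * T.τ)) := fun k => by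
      have e : (varLoading (M.data π ω) E j - M.Om *ᵥ v) k =
          v ⬝ᵥ fun l => OmHat E l k - M.Om l k := by
        rw [varLoading, ← hv, ← sub_mulVec, mulVec, dotProduct_comm]
        congr 1
        ext l
        rw [Matrix.sub_apply, transpose_apply, Om_symm h.reg.posDef k l]
      rw [e]
      exact (abs_dotProduct_le_l1norm fun l => herr l k).trans
        (mul_le_mul_of_nonneg_right hv1 (by positivity))
    have hl1 : l1norm (varLoading (M.data π ω) E j - M.Om *ᵥ v) ≤ 2 * (m * (C * r)) := by
      refine (l1norm_sub_le _ _).trans ?_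
      have := (l1norm_mulVec_le h.reg.col_sum v).trans (mul_le_mul_of_nonneg_left hv1 hm0)
      linarith [hb1 j]
    refine (l2norm_sq_le_mul_l1norm hent).trans ?_
    calc _ ≤ 2 * (m * (C * r)) * (C * r * (m ^ 2 * a * (2 * T.Cw + 2 * T.τ))) :=
          mul_le_mul_of_nonneg_right hl1 (by positivity)
      _ = D * (m ^ 3 * r ^ 2 * a) := by rw [hD]; ring
      _ ≤ c := hmono
  refine ⟨fun j => ⟨?_, ?_⟩, j0, ?_⟩
  · have h1 := l2norm_sq_le_two_mul (varLoading (M.data π ω) E j)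
      (M.Om *ᵥ emb (A0Hat (M.data π ω) E j))
    have h2 := l2norm_Om_mulVec_le h.reg.design h.reg.posDef
      (emb (A0Hat (M.data π ω) E j) : Idx M.px M.pz → ℝ)
    rw [l2norm_emb] at h2
    have h3 := pow_le_pow_left₀ (l2norm_nonneg _)
      (h2.trans (div_le_div_of_nonneg_right (hup j).1 hc.le)) 2
    linarith [happ j]
  · refine (hb1 j).trans ?_
    have h1 : 0 ≤ (2 * (C / K.cSig) ^ 2 + 2 * c) * (m * r) := by positivity
    linarith
  · have h1 := l2norm_sq_le_two_mul (M.Om *ᵥ emb (A0Hat (M.data π ω) E j0))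
      (varLoading (M.data π ω) E j0)
    have h2 := le_l2norm_Om_mulVec h.reg.design h.reg.posDef
      (emb (A0Hat (M.data π ω) E j0) : Idx M.px M.pz → ℝ)
    rw [l2norm_emb] at h2
    have h3 := pow_le_pow_left₀ (div_nonneg (l2norm_nonneg _) hCS.le) h2 2
    rw [l2norm_sub_rev] at h1
    have h4 : 4 * c ≤ (l2norm (A0Hat (M.data π ω) E j0) / K.CSig) ^ 2 := by
      rw [div_pow, le_div_iff₀ (by positivity)]
      refine le_trans (le_of_eq ?_) hlow
      rw [hcdef]; field_simp; ring
    linarith [happ j0]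

theorem resid_eq (i : Fin n) : resid (M.data π ω) E i =
    (M.e i ω + (M.β - betaHat (M.data π ω) E) * M.eps2 i ω) -
      (E.thA - M.thetaY π (betaHat (M.data π ω) E)) ⬝ᵥ M.W i ω := by
  have h1 := congrFun (data_Y_sub (M := M) (π := π) (ω := ω) (betaHat (M.data π ω) E)) i
  have hW : ∀ v : Idx M.px M.pz → ℝ, (M.Wmat ω *ᵥ v) i = v ⬝ᵥ M.W i ω := fun v => by
    rw [dotProduct_comm]; rfl
  rw [resid, Pi.sub_apply, h1, Pi.add_apply, hW, sub_dotProduct]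
  have h2 : ((M.data π ω).W *ᵥ E.thA) i = E.thA ⬝ᵥ M.W i ω := hW _
  rw [h2]; ring

/-- From `u² / 2 - v² ≤ (u - v)² ≤ 2 u² + 2 v²`. Applied with `u` the true error combination and `v`
the Lasso prediction error, it avoids any analysis of cross terms. -/
theorem average_sq_sub_bounds (p u v : Fin n → ℝ) :
    (1 / (n : ℝ)) * ∑ i, p i ^ 2 * (u i - v i) ^ 2 ≤
      2 * ((1 / (n : ℝ)) * ∑ i, p i ^ 2 * u i ^ 2) + 2 * ((1 / (n : ℝ)) * ∑ i, p i ^ 2 * v i ^ 2) ∧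
    1 / 2 * ((1 / (n : ℝ)) * ∑ i, p i ^ 2 * u i ^ 2) - (1 / (n : ℝ)) * ∑ i, p i ^ 2 * v i ^ 2 ≤
      (1 / (n : ℝ)) * ∑ i, p i ^ 2 * (u i - v i) ^ 2 := by
  simp only [Finset.mul_sum, ← Finset.sum_add_distrib, ← Finset.sum_sub_distrib]
  have hn : 0 ≤ 1 / (n : ℝ) := by positivity
  constructor <;> refine Finset.sum_le_sum fun i _ => ?_
  · have := mul_nonneg (mul_nonneg hn (sq_nonneg (p i))) (sq_nonneg (u i + v i))
    linear_combination this
  · have := mul_nonneg (mul_nonneg hn (sq_nonneg (p i))) (sq_nonneg (u i - 2 * v i))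
    linear_combination 1 / 2 * this

/-- The diagonal of `V̂_A` is bounded, and one of its entries is bounded away from zero. -/
theorem exists_VHat_bounds (T : Tuning K) : ∃ κ C c : ℝ, 0 < κ ∧ κ ≤ 1 ∧ 0 < C ∧ 0 < c ∧
    ∀ {n : ℕ} {M : Design.{u} n} {m : ℝ} {s : ℕ} {π : Fin M.pz → ℝ} {ω : M.S}
      {E : Estimates M.px M.pz}, Setup T κ M m s π ω E →
      (∀ j, VHat (M.data π ω) E j j ≤ C) ∧ ∃ j, c ≤ VHat (M.data π ω) E j j := by
  obtain ⟨κ1, C1, c1, hκ1, hκ1', hC1, hc1, hload⟩ := exists_varLoading_bounds.{u} T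
  obtain ⟨κ2, C2, hκ2, -, hC2, hbeta⟩ := exists_betaHat_bounds.{u} T
  obtain ⟨κ3, C3, hκ3, -, hC3, hthird⟩ := exists_third_stage_bounds.{u} T
  have hc := K.cSig_pos
  have hCS := K.cSig_pos.trans_le K.cSig_le
  have hτ := T.τ_pos
  have hF := T.F_pos
  have hCβ := T.Cβ_pos
  have hσ := K.sigMin_pos
  have hσ' := K.sigMin_pos.trans_le K.sigMin_le
  have hρ : 0 < 1 - max K.rho 0 := by
    have : max K.rho 0 < 1 := max_lt K.rho_lt one_pos
    linarith
  set c2 := (1 - max K.rho 0) * K.sigMin * K.cSig with hc2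
  have hc20 : 0 < c2 := by positivity
  set N := (1 + C2) ^ 2 * (C1 ^ 2 * T.τ) with hN
  set G := C1 ^ 2 * C3 ^ 2 * T.F with hG
  have hN0 : 0 < N := by positivity
  have hG0 : 0 < G := by positivity
  set U := 2 * K.sigMax * (1 + (T.Cβ + C2) ^ 2) * K.CSig * C1 with hU
  have hU0 : 0 < U := by positivity
  refine ⟨min κ1 (min κ2 (min κ3 (c2 * c1 / (4 * (N + G))))), 2 * (U + N) + 2 * G, c2 * c1 / 4,
    lt_min hκ1 (lt_min hκ2 (lt_min hκ3 (by positivity))), (min_le_left _ _).trans hκ1',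
    by positivity, by positivity, ?_⟩
  intro n M m s π ω E h
  set κ := min κ1 (min κ2 (min κ3 (c2 * c1 / (4 * (N + G))))) with hκ
  have hκ0 : 0 < κ := lt_min hκ1 (lt_min hκ2 (lt_min hκ3 (by positivity)))
  have hκ' : κ ≤ 1 := (min_le_left _ _).trans hκ1'
  have hκ4 : κ * (N + G) ≤ c2 * c1 / 4 := by
    have h1 : κ ≤ c2 * c1 / (4 * (N + G)) :=
      (min_le_right _ _).trans ((min_le_right _ _).trans (min_le_right _ _))
    calc _ ≤ c2 * c1 / (4 * (N + G)) * (N + G) := mul_le_mul_of_nonneg_right h1 (by positivity)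
      _ = _ := by field_simp
  obtain ⟨hup, j0, hlow⟩ := hload (h.mono (min_le_left _ _))
  have hb := (hbeta (h.mono ((min_le_right _ _).trans (min_le_left _ _)))).2.2.2.2.2
  have hδ := (hthird (h.mono ((min_le_right _ _).trans ((min_le_right _ _).trans
    (min_le_left _ _))))).l1
  obtain ⟨hg, ha, hr, hm, -, -, -, -⟩ := h.sizes
  have hmono1 := h.reg.monomial_le (i := 2) (j := 2) (k := 0) (by norm_num) (by norm_num)
    (by norm_num)
  have hmono2 := h.reg.monomial_le (i := 1) (j := 3) (k := 0) (by norm_num) (by norm_num)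
    (by norm_num)
  have hmin : κ * min 1 (l2norm M.γ) ≤ κ := mul_le_of_le_one_right hκ0.le (min_le_left _ _)
  replace hmono1 := hmono1.trans hmin
  replace hmono2 := hmono2.trans hmin
  rw [pow_zero, mul_one] at hmono1 hmono2
  rw [pow_one] at hmono2
  set r := Real.sqrt s
  set a := M.rate
  set t := M.β - betaHat (M.data π ω) E with ht
  set δ := E.thA - M.thetaY π (betaHat (M.data π ω) E) with hδdef
  have htC : |t| ≤ C2 := by rw [ht, abs_sub_comm]; exact hb
  have ht2 : (1 + |t|) ^ 2 ≤ (1 + C2) ^ 2 := pow_le_pow_left₀ (by positivity) (by linarith) 2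
  have hm0 : 0 ≤ m := by linarith
  have hl1 : ∀ j, l1norm (varLoading (M.data π ω) E j) ^ 2 ≤ C1 ^ 2 * (m ^ 2 * r ^ 2) := fun j => by
    refine (pow_le_pow_left₀ (l1norm_nonneg _) (hup j).2 2).trans (le_of_eq ?_)
    ring
  have hnoise : ∀ j, (1 + |t|) ^ 2 * (l1norm (varLoading (M.data π ω) E j) ^ 2 * (T.τ * a)) ≤
      N * κ := fun j => by
    calc _ ≤ (1 + C2) ^ 2 * (C1 ^ 2 * (m ^ 2 * r ^ 2) * (T.τ * a)) :=
          mul_le_mul ht2 (mul_le_mul_of_nonneg_right (hl1 j) (by positivity))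
            (by positivity) (by positivity)
      _ = N * (m ^ 2 * r ^ 2 * a) := by rw [hN]; ring
      _ ≤ N * κ := mul_le_mul_of_nonneg_left hmono1 hN0.le
  -- The prediction error enters through `‖b‖₁² ‖δ‖₁²`, of order `(m √s · s √(log p / n))²`. This is
  -- where `s^{3/2}` is needed.
  have hfour : ∀ j, (1 / (n : ℝ)) * ∑ i, (varLoading (M.data π ω) E j ⬝ᵥ M.W i ω) ^ 2 *
      (δ ⬝ᵥ M.W i ω) ^ 2 ≤ G * κ := fun j => by
    refine (h.smp.fourth_le _ _).trans ?_
    have h1 : l1norm δ ^ 2 ≤ C3 ^ 2 * (r ^ 2 * a) ^ 2 := by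
      refine (pow_le_pow_left₀ (l1norm_nonneg _) hδ 2).trans (le_of_eq ?_)
      ring
    have h2 : (m * r ^ 3 * a) ^ 2 ≤ κ := by
      have h3 : 0 ≤ m * r ^ 3 * a := by positivity
      calc (m * r ^ 3 * a) ^ 2 ≤ κ ^ 2 := pow_le_pow_left₀ h3 hmono2 2
        _ ≤ κ := by nlinarith
    calc _ ≤ C1 ^ 2 * (m ^ 2 * r ^ 2) * (C3 ^ 2 * (r ^ 2 * a) ^ 2 * T.F) :=
          mul_le_mul (hl1 j) (mul_le_mul_of_nonneg_right h1 hF.le) (by positivity) (by positivity)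
      _ = G * (m * r ^ 3 * a) ^ 2 := by rw [hG]; ring
      _ ≤ G * κ := mul_le_mul_of_nonneg_left h2 hG0.le
  have hV : ∀ j, VHat (M.data π ω) E j j = (1 / (n : ℝ)) * ∑ i,
      (varLoading (M.data π ω) E j ⬝ᵥ M.W i ω) ^ 2 *
        ((M.e i ω + t * M.eps2 i ω) - δ ⬝ᵥ M.W i ω) ^ 2 := fun j => by
    rw [VHat_diag]
    simp only [resid_eq]
    rfl
  constructor
  · intro j
    have h1 := (average_sq_sub_bounds (fun i => varLoading (M.data π ω) E j ⬝ᵥ M.W i ω)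
      (fun i => M.e i ω + t * M.eps2 i ω) fun i => δ ⬝ᵥ M.W i ω).1
    have h2 := h.smp.weighted_le (varLoading (M.data π ω) E j) t
    have h3 : 2 * K.sigMax * (1 + (t - M.β) ^ 2) * K.CSig *
        l2norm (varLoading (M.data π ω) E j) ^ 2 ≤ U := by
      have h6 : |t - M.β| ≤ T.Cβ + C2 := by
        refine (abs_sub _ _).trans ?_
        linarith [h.beta]
      have h7 : (t - M.β) ^ 2 ≤ (T.Cβ + C2) ^ 2 := by
        rw [← sq_abs]; exact pow_le_pow_left₀ (abs_nonneg _) h6 2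
      rw [hU]
      have h8 := (hup j).1
      gcongr
    have h4 := hnoise j
    have h5 := hfour j
    have h6 : N * κ ≤ N := mul_le_of_le_one_right hN0.le hκ'
    have h7 : G * κ ≤ G := mul_le_of_le_one_right hG0.le hκ'
    rw [hV]
    refine h1.trans (add_le_add ?_ ?_)
    · exact mul_le_mul_of_nonneg_left (h2.trans (add_le_add h3 (h4.trans h6))) zero_le_two
    · exact mul_le_mul_of_nonneg_left (h5.trans h7) zero_le_two
  · refine ⟨j0, ?_⟩
    have h1 := (average_sq_sub_bounds (fun i => varLoading (M.data π ω) E j0 ⬝ᵥ M.W i ω)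
      (fun i => M.e i ω + t * M.eps2 i ω) fun i => δ ⬝ᵥ M.W i ω).2
    have h2 := h.smp.weighted_ge (varLoading (M.data π ω) E j0) t
    have h3 := mul_le_mul_of_nonneg_left hlow hc20.le
    have h4 := hnoise j0
    have h5 := hfour j0
    rw [hV]
    refine le_trans ?_ h1
    have h6 := mul_le_mul_of_nonneg_left h2 (by norm_num : (0 : ℝ) ≤ 1 / 2)
    refine le_trans ?_ (sub_le_sub h6 h5)
    have h7 : 0 < N * κ := by positivity
    rw [← hc2]
    linarith

end Variance

/-! ### The Q statistic and the critical value. -/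

section Statistic

variable {K : Constants} {T : Tuning K} {κ : ℝ} {n : ℕ} {M : Design.{u} n} {m : ℝ} {s : ℕ}
  {π : Fin M.pz → ℝ} {ω : M.S} {E : Estimates M.px M.pz}

theorem Setup.sqrt_mul_log_pos (h : Setup T κ M m s π ω E) :
    0 < Real.sqrt n * Real.log (M.p : ℝ) := by
  have h1 : (0 : ℝ) < n := by exact_mod_cast h.reg.n_pos
  have h2 := h.reg.one_le_log
  exact mul_pos (Real.sqrt_pos.2 h1) (by linarith)

theorem Setup.scaled_error_le {η : ℝ} (h : Setup T κ M m s π ω E) (hη : 0 < η) (hη1 : η ≤ 1)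
    (hκ0 : 0 < κ) (hκ : κ ≤ η ^ 2) {P : ℝ} :
    Real.sqrt n * Real.log (M.p : ℝ) * (m * Real.sqrt s * M.rate * P +
      (m * Real.sqrt s * M.rate) ^ 2) ≤ 2 * η * (1 + Real.sqrt n * P ^ 2) := by
  obtain ⟨-, ha, hr, hm, -, -, -, -⟩ := h.sizes
  have hmono := h.reg.monomial_le (i := 2) (j := 2) (k := 3) (by norm_num) (by norm_num)
    (by norm_num)
  have hmono := (hmono.trans (mul_le_of_le_one_right hκ0.le (min_le_left _ _))).trans hκ
  have hL := h.reg.one_le_log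
  have hnr := mul_rate_sq (M := M) h.reg.n_pos
  have hn : Real.sqrt n ^ 2 = n := Real.sq_sqrt (Nat.cast_nonneg _)
  set N := Real.sqrt n
  set L := Real.log (M.p : ℝ)
  set r := Real.sqrt s
  set a := M.rate
  have hN : 0 ≤ N := Real.sqrt_nonneg _
  have hNa : N * a ≤ L := by
    refine le_of_sq_le_sq ?_ (by linarith)
    rw [mul_pow, hn, hnr]
    nlinarith
  -- One factor `√n rate = √(log p)` is bounded by `log p`, which leaves a single power of the rate
  -- and the load monomial with exponents `2, 2, 3`.
  have hkey : N * L ^ 2 * (m * r * a) ^ 2 ≤ η ^ 2 := by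
    refine le_trans ?_ hmono
    calc N * L ^ 2 * (m * r * a) ^ 2 = m ^ 2 * r ^ 2 * L ^ 2 * a * (N * a) := by ring
      _ ≤ m ^ 2 * r ^ 2 * L ^ 2 * a * L := mul_le_mul_of_nonneg_left hNa (by positivity)
      _ = _ := by ring
  set x := m * r * a
  have h1 : N * L * x ^ 2 ≤ η := by
    have h2 : N * L * x ^ 2 ≤ N * L ^ 2 * x ^ 2 := by
      refine mul_le_mul_of_nonneg_right (mul_le_mul_of_nonneg_left ?_ hN) (sq_nonneg _)
      nlinarith
    nlinarith
  -- The weighted inequality between `η √n P²` and `√n (log p)² x² / η`, from the square of `2 η P -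
  -- L x`.
  have h3 : N * L * (x * P) ≤ η * (N * P ^ 2) + η := by
    have h4 : 0 ≤ N * (2 * η * P - L * x) ^ 2 := mul_nonneg hN (sq_nonneg _)
    have h5 : η * (N * L * (x * P)) ≤ η * (η * (N * P ^ 2) + η) := by nlinarith
    exact le_of_mul_le_mul_left h5 hη
  have h6 : 0 ≤ η * (N * P ^ 2) := by positivity
  linarith

/-- The linear term is no larger than the error bound for `Q̂_A`, so the decomposition and the plain
approximation of the statistic by `√n log p Q_A` hold with the same remainder. The threshold `η²`
for the load yields remainder size `η`. -/
theorem exists_scaled_bounds (T : Tuning K) : ∃ κ C : ℝ, 0 < κ ∧ 0 < C ∧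
    ∀ η : ℝ, 0 < η → η ≤ 1 → ∀ {n : ℕ} {M : Design.{u} n} {m : ℝ} {s : ℕ} {π : Fin M.pz → ℝ}
      {ω : M.S} {E : Estimates M.px M.pz}, Setup T (min κ (η ^ 2)) M m s π ω E →
      Real.sqrt n * Real.log (M.p : ℝ) * |QHat (M.data π ω) E - M.QA π ω - M.linTerm π ω| ≤
        C * η * (1 + Real.sqrt n * l2norm (M.piStar π) ^ 2) ∧
      |Qstat (M.data π ω) E - Real.sqrt n * Real.log (M.p : ℝ) * M.QA π ω| ≤
        C * η * (1 + Real.sqrt n * l2norm (M.piStar π) ^ 2) ∧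
      l2norm (M.piStar π) ^ 2 ≤ C * M.QA π ω := by
  obtain ⟨κ, C, hκ, -, hC, hQ⟩ := exists_QHat_bounds.{u} T
  refine ⟨κ, 4 * C, hκ, by positivity, ?_⟩
  intro η hη hη1 n M m s π ω E h
  obtain ⟨h1, h2, h3⟩ := hQ (h.mono (min_le_left _ _))
  have h4 := h.scaled_error_le hη hη1 (lt_min hκ (by positivity)) (min_le_right _ _)
    (P := l2norm (M.piStar π))
  have h5 := h.sqrt_mul_log_pos
  obtain ⟨-, ha, hr, hm, -, -, -, -⟩ := h.sizes
  set x := m * Real.sqrt s * M.rate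
  set P := l2norm (M.piStar π)
  set Z := Real.sqrt n * Real.log (M.p : ℝ) with hZ
  have h6 : |QHat (M.data π ω) E - M.QA π ω - M.linTerm π ω| ≤ 2 * C * (x * P + x ^ 2) := by
    refine (abs_sub _ _).trans ?_
    have : 0 ≤ C * x ^ 2 := by positivity
    linarith
  have h7 : 0 ≤ η * (1 + Real.sqrt n * P ^ 2) := by positivity
  refine ⟨?_, ?_, ?_⟩
  · calc _ ≤ Z * (2 * C * (x * P + x ^ 2)) := mul_le_mul_of_nonneg_left h6 h5.le
      _ = 2 * C * (Z * (x * P + x ^ 2)) := by ring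
      _ ≤ 2 * C * (2 * η * (1 + Real.sqrt n * P ^ 2)) :=
          mul_le_mul_of_nonneg_left h4 (by positivity)
      _ = _ := by ring
  · have e : Qstat (M.data π ω) E - Z * M.QA π ω = Z * (QHat (M.data π ω) E - M.QA π ω) := by
      rw [mul_sub]; rfl
    rw [e, abs_mul, abs_of_pos h5]
    calc _ ≤ Z * (C * (x * P + x ^ 2)) := mul_le_mul_of_nonneg_left h1 h5.le
      _ = C * (Z * (x * P + x ^ 2)) := by ring
      _ ≤ C * (2 * η * (1 + Real.sqrt n * P ^ 2)) := mul_le_mul_of_nonneg_left h4 hC.le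
      _ ≤ _ := by
          have := mul_nonneg hC.le h7
          linarith
  · have h8 : 0 ≤ C * M.QA π ω := (sq_nonneg _).trans h3
    linarith

theorem piOf_zero {w : Fin M.pz → ℝ} (h : quad (Matrix.diagonal w) M.γ ≠ 0) :
    M.piOf (Matrix.diagonal w) 0 = 0 := by
  have e : M.betaOf (Matrix.diagonal w) 0 = M.β := by
    rw [Design.betaOf, Design.Gam, add_zero, bil_smul_right]
    exact mul_div_cancel_right₀ _ h
  rw [Design.piOf, e, Design.Gam, add_zero, sub_self]

/-- Without direct effects the Q statistic is close to zero. -/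
theorem exists_abs_Qstat_le (T : Tuning K) {δ : ℝ} (hδ : 0 < δ) : ∃ κ : ℝ, 0 < κ ∧
    ∀ {n : ℕ} {M : Design.{u} n} {m : ℝ} {s : ℕ} {ω : M.S} {E : Estimates M.px M.pz},
      Setup T κ M m s 0 ω E → |Qstat (M.data 0 ω) E| ≤ δ := by
  obtain ⟨κ1, hκ1, -, hz⟩ := exists_zVar_bounds.{u} T
  obtain ⟨κ2, C, hκ2, hC, hQ⟩ := exists_scaled_bounds.{u} T
  have hη : 0 < min 1 (δ / C) := lt_min one_pos (by positivity)
  refine ⟨min κ1 (min κ2 (min 1 (δ / C) ^ 2)), lt_min hκ1 (lt_min hκ2 (by positivity)), ?_⟩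
  intro n M m s ω E h
  have hz := hz (h.mono (min_le_left _ _))
  obtain ⟨-, h1, -⟩ := hQ _ hη (min_le_left _ _) (h.mono (min_le_right _ _))
  have hc : 0 < K.cSig / 2 := by have := K.cSig_pos; positivity
  have e1 : M.QA 0 ω = 0 := by
    have hA : M.A ω = Matrix.diagonal (zVar (M.Wmat ω)) := rfl
    rw [Design.QA, hA, piOf_zero (quad_gam_pos h.reg.gam_ne hc fun j => (hz j).1).ne']
    simp [quad, bil]
  have e2 : l2norm (M.piStar 0) = 0 := by
    rw [Design.piStar, Astar_eq, piOf_zero (quad_gam_pos h.reg.gam_ne K.cSig_pos fun j =>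
      (Sig_diag_bounds h.reg.design (Sum.inr j)).1).ne']
    simp [l2norm]
  rw [e1, e2] at h1
  simp only [mul_zero, sub_zero, ne_eq, OfNat.ofNat_ne_zero, not_false_eq_true, zero_pow,
    add_zero, mul_one] at h1
  refine h1.trans ?_
  calc C * min 1 (δ / C) ≤ C * (δ / C) := mul_le_mul_of_nonneg_left (min_le_right _ _) hC.le
    _ = δ := by field_simp

theorem sqrt_mul_sq_rpow (hn : 0 < n) (a : ℝ) :
    Real.sqrt n * (a * (n : ℝ) ^ (-(1 / 4 : ℝ))) ^ 2 = a ^ 2 := by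
  have hn' : (0 : ℝ) < n := by exact_mod_cast hn
  have e : ((n : ℝ) ^ (-(1 / 4 : ℝ))) ^ 2 = (n : ℝ) ^ (-(1 / 2 : ℝ)) := by
    rw [← Real.rpow_natCast, ← Real.rpow_mul hn'.le]; norm_num
  rw [mul_pow, e, Real.sqrt_eq_rpow, mul_left_comm, ← Real.rpow_add hn']
  norm_num

/-- For direct effects of order at least `n ^ (-1/4)` the Q statistic is of order `log p`. -/
theorem exists_le_Qstat (T : Tuning K) {a : ℝ} (ha : 0 < a) : ∃ κ c : ℝ, 0 < κ ∧ 0 < c ∧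
    ∀ {n : ℕ} {M : Design.{u} n} {m : ℝ} {s : ℕ} {π : Fin M.pz → ℝ} {ω : M.S}
      {E : Estimates M.px M.pz}, Setup T κ M m s π ω E →
      a * (n : ℝ) ^ (-(1 / 4 : ℝ)) ≤ l2norm (M.piStar π) →
      c * Real.log (M.p : ℝ) ≤ Qstat (M.data π ω) E := by
  obtain ⟨κ, C, hκ, hC, hQ⟩ := exists_scaled_bounds.{u} T
  -- Chosen so that for every `y ≥ a²` the error `C η (1 + y)` uses at most half of the signal `y /
  -- C`.
  set η := min 1 (a ^ 2 / (2 * C ^ 2 * (1 + a ^ 2))) with hη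
  have hη0 : 0 < η := lt_min one_pos (by positivity)
  refine ⟨min κ (η ^ 2), a ^ 2 / (2 * C), lt_min hκ (by positivity), by positivity, ?_⟩
  intro n M m s π ω E h hP
  obtain ⟨-, h1, h2⟩ := hQ η hη0 (min_le_left _ _) h
  have hL := h.reg.one_le_log
  have hy : a ^ 2 ≤ Real.sqrt n * l2norm (M.piStar π) ^ 2 := by
    rw [← sqrt_mul_sq_rpow h.reg.n_pos a]
    exact mul_le_mul_of_nonneg_left (pow_le_pow_left₀ (by positivity) hP 2) (Real.sqrt_nonneg _)
  have h3 : Real.log (M.p : ℝ) * (Real.sqrt n * l2norm (M.piStar π) ^ 2) ≤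
      C * (Real.sqrt n * Real.log (M.p : ℝ) * M.QA π ω) := by
    have := mul_le_mul_of_nonneg_left h2 h.sqrt_mul_log_pos.le
    linarith
  set L := Real.log (M.p : ℝ)
  set y := Real.sqrt n * l2norm (M.piStar π) ^ 2
  have hy0 : 0 < y := lt_of_lt_of_le (by positivity) hy
  have h4 : C * η * (1 + y) ≤ y / (2 * C) := by
    have h5 : η ≤ a ^ 2 / (2 * C ^ 2 * (1 + a ^ 2)) := min_le_right _ _
    have h6 : a ^ 2 * (1 + y) ≤ (1 + a ^ 2) * y := by nlinarith
    calc C * η * (1 + y) ≤ C * (a ^ 2 / (2 * C ^ 2 * (1 + a ^ 2))) * (1 + y) := by gcongr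
      _ = a ^ 2 * (1 + y) / (2 * C * (1 + a ^ 2)) := by field_simp
      _ ≤ (1 + a ^ 2) * y / (2 * C * (1 + a ^ 2)) :=
          div_le_div_of_nonneg_right h6 (by positivity)
      _ = y / (2 * C) := by field_simp
  have h7 : L * y / C ≤ Real.sqrt n * L * M.QA π ω := by
    rw [div_le_iff₀ hC]; linarith
  have h8 := (abs_le.1 h1).1
  have h9 : y / (2 * C) ≤ L * y / (2 * C) :=
    div_le_div_of_nonneg_right (le_mul_of_one_le_left hy0.le hL) (by positivity)
  have h10 : a ^ 2 / (2 * C) * L ≤ L * y / (2 * C) := by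
    rw [div_mul_eq_mul_div]
    refine div_le_div_of_nonneg_right ?_ (by positivity)
    rw [mul_comm]
    exact mul_le_mul_of_nonneg_left hy (by linarith)
  have e : L * y / C = 2 * (L * y / (2 * C)) := by field_simp
  linarith

/-- The critical value is bounded away from zero. -/
theorem exists_le_cv (T : Tuning K) {α : ℝ} (hα : 0 < α) (hα1 : α < 1) : ∃ κ c : ℝ, 0 < κ ∧ 0 < c ∧
    ∀ {n : ℕ} {M : Design.{u} n} {m : ℝ} {s : ℕ} {π : Fin M.pz → ℝ} {ω : M.S}
      {E : Estimates M.px M.pz}, Setup T κ M m s π ω E → c ≤ cv (M.data π ω) E α := by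
  obtain ⟨κ, C, c, hκ, -, -, hc, hV⟩ := exists_VHat_bounds.{u} T
  refine ⟨κ, (1 - α) * Real.sqrt c, hκ, mul_pos (by linarith) (Real.sqrt_pos.2 hc), ?_⟩
  intro n M m s π ω E h
  obtain ⟨j, hj⟩ := (hV h).2
  exact le_cv hc hα hα1 hj

/-- The critical value is of order at most `√(log p)`. -/
theorem exists_cv_le (T : Tuning K) {α : ℝ} (hα : 0 < α) (hα1 : α < 1) : ∃ κ C : ℝ, 0 < κ ∧ 0 < C ∧
    ∀ {n : ℕ} {M : Design.{u} n} {m : ℝ} {s : ℕ} {π : Fin M.pz → ℝ} {ω : M.S}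
      {E : Estimates M.px M.pz}, Setup T κ M m s π ω E →
      cv (M.data π ω) E α ≤ C * Real.sqrt (Real.log (M.p : ℝ)) := by
  obtain ⟨κ, V, c, hκ, -, hV0, -, hV⟩ := exists_VHat_bounds.{u} T
  have hℓ : 0 < Real.log (2 / α) := Real.log_pos (by rw [lt_div_iff₀ hα]; linarith)
  set ℓ := Real.log (2 / α) with hℓdef
  -- With this constant the Gaussian exponent is `(1 + ℓ) log p ≥ log p + ℓ`, and `2 p exp (-log p -
  -- ℓ) = α` for `ℓ = log (2 / α)`.
  refine ⟨κ, Real.sqrt (2 * V * (1 + ℓ)), hκ, by positivity, ?_⟩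
  intro n M m s π ω E h
  refine cv_le hV0 hα1 (by positivity) (hV h).1 ?_
  have hL := h.reg.one_le_log
  have hp : (0 : ℝ) < M.p := by
    have : 0 < M.p := by have := h.reg.two_le_pz; rw [Design.p]; omega
    exact_mod_cast this
  have e : (Real.sqrt (2 * V * (1 + ℓ)) * Real.sqrt (Real.log (M.p : ℝ))) ^ 2 =
      2 * V * ((1 + ℓ) * Real.log (M.p : ℝ)) := by
    rw [mul_pow, Real.sq_sqrt (by positivity), Real.sq_sqrt (by linarith)]; ring
  have e2 : -(2 * V * ((1 + ℓ) * Real.log (M.p : ℝ))) / (2 * V) =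
      -((1 + ℓ) * Real.log (M.p : ℝ)) := by field_simp
  rw [e, e2]
  have h1 : Real.exp (-((1 + ℓ) * Real.log (M.p : ℝ))) ≤ Real.exp (-Real.log (M.p : ℝ) - ℓ) := by
    refine Real.exp_le_exp.2 ?_
    nlinarith
  have h2 : Real.exp (-Real.log (M.p : ℝ) - ℓ) = (M.p : ℝ)⁻¹ * (α / 2) := by
    rw [Real.exp_sub, Real.exp_neg, Real.exp_log hp, hℓdef, Real.exp_log (by positivity)]
    field_simp
  have h3 : (M.pz : ℝ) ≤ M.p := by
    have : M.pz ≤ M.p := Nat.le_add_left _ _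
    exact_mod_cast this
  calc (M.pz : ℝ) * (2 * Real.exp (-((1 + ℓ) * Real.log (M.p : ℝ)))) ≤
        M.p * (2 * ((M.p : ℝ)⁻¹ * (α / 2))) := by
        rw [← h2]; gcongr
    _ = α := by field_simp

end Statistic

/-! ### From the good event to probabilities -/

theorem Admissible.one_le {n : ℕ} {M : Design.{u} n} {s : ℕ} {Clam C3 : ℝ} {π : Fin M.pz → ℝ}
    (h : Admissible M s Clam C3 π) (hγ : M.γ ≠ 0) : 1 ≤ s := by
  have h1 := h.1
  simp only [Design.sparsity, max_le_iff] at h1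
  have := l0norm_pos hγ
  omega

/-- The constants of the good event, and the resulting bound, uniform in `π`, on the probability
that a consequence of `Setup` fails. -/
theorem exists_deviation_constants (K : Constants) : ∃ τ F Cβ : ℝ, 0 < τ ∧ 0 < F ∧ 0 < Cβ ∧
    ∀ T : Tuning K, T.τ = τ → T.F = F → T.Cβ = Cβ →
    ∀ {q ν : ℝ} {M : ∀ n, Design.{u} n} {m s_om : ℕ → ℝ} {s : ℕ → ℕ}
      {est : ∀ n, Data n (M n).px (M n).pz → Estimates (M n).px (M n).pz},
      0 ≤ q → q < 1 → 0 < ν → StandingAssumptions K q ν M m s_om s →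
      (∀ n d, IsEstimates (T.C1 * (M n).rate) (T.C2 * (M n).rate) (T.C3 * (M n).rate)
        (T.Cw * (M n).rate) d (est n d)) →
      ∃ g : ℕ → ENNReal, Tendsto g atTop (𝓝 0) ∧ ∀ κ : ℝ, 0 < κ → ∀ᶠ n in atTop,
        ∀ π, Admissible (M n) (s n) T.Clam T.C3 π → ∀ R : (M n).S → Prop,
          (∀ ω, Setup T κ (M n) (m n) (s n) π ω (est n ((M n).data π ω)) → R ω) →
          (M n).P {ω | ¬ R ω} ≤ g n := by
  obtain ⟨τ, V, B, b, hτ, hV, hB, hb, hgood⟩ := exists_goodEvent_bound.{u} K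
  obtain ⟨Cβ, hCβ, hbeta⟩ := exists_beta_bound.{u} K
  refine ⟨τ, V + τ, Cβ, hτ, by positivity, hCβ, ?_⟩
  intro T hTτ hTF hTβ q ν M m s_om s est hq0 hq1 hν h hest
  classical
  set bound : ℕ → ℝ := fun n => (5 * ((M n).p : ℝ)) ^ 4 *
    (2 * (Real.exp (-5 * Real.log ((M n).p : ℝ)) +
      n * (B * Real.exp (-b * Real.sqrt (M n).rate⁻¹)))) with hbound
  -- When `s n = 0` no `π` is admissible, because `γ ≠ 0` counts in the sparsity index. The load
  -- condition gives no information at such `n`, so the tail bound is used only along `{n | 1 ≤ s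
  -- n}`.
  refine ⟨fun n => if 1 ≤ s n then ENNReal.ofReal (bound n) else 0, ?_, ?_⟩
  · refine Tendsto.if ?_ tendsto_const_nhds
    have hL : Tendsto (fun n => Real.log ((M n).p : ℝ)) (atTop ⊓ 𝓟 {n | 1 ≤ s n}) atTop :=
      h.tendsto_log_p.mono_left inf_le_left
    have hrate : ∀ᶠ n in atTop ⊓ 𝓟 {n | 1 ≤ s n},
        Real.log ((M n).p : ℝ) ^ 3 * (M n).rate ≤ 1 := by
      rw [eventually_inf_principal]
      filter_upwards [h.eventually_regular hq0 hq1 hν one_pos] with n hn hs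
      exact (hn hs).log_pow_mul_rate_le one_pos
    have := tendsto_bad_bound (B := B) hb hL
      ((eventually_gt_atTop 0).filter_mono inf_le_left) hrate
    rw [← ENNReal.ofReal_zero]
    exact ENNReal.tendsto_ofReal this
  · intro κ hκ
    filter_upwards [h.eventually_regular hq0 hq1 hν (lt_min hκ one_pos)] with n hreg π hadm R hR
    have hs := hadm.one_le (h.gam_ne n)
    have hreg := hreg hs
    have hrate : (M n).rate ≤ 1 := by
      have h1 := (hreg.mono (min_le_right κ 1)).log_pow_mul_rate_le one_pos
      exact (le_mul_of_one_le_left rate_nonneg (one_le_pow₀ hreg.one_le_log)).trans h1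
    obtain ⟨hVb, hP⟩ := hgood hreg.n_pos hreg.one_le_log hrate (h.indep n) hreg.design hreg.error
      hreg.posDef
    rw [if_pos hs]
    -- The good event does not mention `π`, so the same bound serves all admissible `π`.
    have hsub : {ω | ¬ R ω} ⊆ {ω | ¬ GoodEvent τ (M n) ω} := by
      intro ω hω hgoodω
      rw [Set.mem_ofPred_eq] at hω
      refine hω (hR ω ⟨hreg.mono (min_le_left _ _), ?_, ?_, hadm, hest n _⟩)
      · rw [hTτ, hTF]
        exact hgoodω.sampleBounds hreg.n_pos hτ.le hrate hreg.design hreg.error hreg.posDef hV.le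
          hVb
      · rw [hTβ]
        exact hbeta hreg.n_pos hreg.design hreg.error hreg.posDef
    refine (measure_mono hsub).trans ?_
    rw [← ofReal_measureReal]
    exact ENNReal.ofReal_le_ofReal hP

end IVTest

/-! ### Assembly of the theorem. -/

theorem theorem3 (K : IVTest.Constants) :
    ∃ Clam Com : ℝ, 0 < Clam ∧ 0 < Com ∧
    ∀ (q ν cr C1 C2 C3 Cw : ℝ), 0 ≤ q → q < 1 → 0 < ν → 0 < cr → cr < 1 →
      Clam ≤ C1 → Clam ≤ C2 → Com ≤ Cw →
    ∀ (M : ∀ n, IVTest.Design.{u} n) (m_om s_om : ℕ → ℝ) (s : ℕ → ℕ),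
      IVTest.StandingAssumptions K q ν M m_om s_om s →
    ∀ (est : ∀ n, IVTest.Data n (M n).px (M n).pz → IVTest.Estimates (M n).px (M n).pz),
      (∀ n d, IVTest.IsEstimates (C1 * (M n).rate) (C2 * (M n).rate) (C3 * (M n).rate)
        (Cw * (M n).rate) d (est n d)) →
    -- the decomposition, part (a), and the first half of part (b), along any sequence `π`
    (∀ π : ∀ n, Fin (M n).pz → ℝ,
      (∀ n, IVTest.Admissible (M n) (s n) Clam C3 (π n)) →
      (∃ Δ : ∀ n, (M n).S → ℝ,
        (∀ n ω, IVTest.QHat ((M n).data (π n) ω) (est n ((M n).data (π n) ω)) =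
          (M n).QA (π n) ω + Δ n ω + (M n).linTerm (π n) ω) ∧
        IVTest.IsLittleOP M Δ (fun n =>
          (1 + Real.sqrt n * IVTest.l2norm ((M n).piStar (π n)) ^ 2) /
            (Real.sqrt n * Real.log ((M n).p : ℝ)))) ∧
      ((∀ n, π n = 0) →
        IVTest.IsLittleOP M
          (fun n ω => IVTest.Qstat ((M n).data (π n) ω) (est n ((M n).data (π n) ω)))
          (fun _ => 1) ∧
        ∀ α : ℝ, 0 < α → α < 1 →
          Tendsto (fun n => (M n).P {ω |
            IVTest.cv ((M n).data (π n) ω) (est n ((M n).data (π n) ω)) α <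
              IVTest.Qstat ((M n).data (π n) ω) (est n ((M n).data (π n) ω))})
            atTop (𝓝 0)) ∧
      ((∃ a : ℝ, 0 < a ∧ ∀ᶠ n : ℕ in atTop,
          a * (n : ℝ) ^ (-(1 / 4 : ℝ)) ≤ IVTest.l2norm ((M n).piStar (π n))) →
        ∀ c : ℝ, IVTest.TendstoInfinityInProb M (fun n ω =>
          IVTest.Qstat ((M n).data (π n) ω) (est n ((M n).data (π n) ω)) -
            c * Real.sqrt (Real.log ((M n).p : ℝ))))) ∧
    -- the second half of part (b): the largest probability of not rejecting tends to `0`,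
    -- so the smallest probability of rejecting tends to `1`
    (∀ α ε : ℝ, 0 < α → α < 1 → 0 < ε →
      Tendsto (fun n =>
        ⨆ π ∈ {π | π ∈ (M n).HQ cr ε ∧ IVTest.Admissible (M n) (s n) Clam C3 π},
          (M n).P {ω |
            IVTest.Qstat ((M n).data π ω) (est n ((M n).data π ω)) ≤
              IVTest.cv ((M n).data π ω) (est n ((M n).data π ω)) α})
        atTop (𝓝 0)) := by
  obtain ⟨τ, F, Cβ, hτ, hF, hCβ, hdev⟩ := IVTest.exists_deviation_constants.{u} K
  have hc := K.cSig_pos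
  have hCS := K.cSig_pos.trans_le K.cSig_le
  have hpos : 0 < 4 * τ * (2 + 4 * K.CSig / K.cSig + Cβ) := by positivity
  -- `Clam` dominates four times the score of the noise in all three Lasso fits; `Com = τ` makes `Ω`
  -- feasible for CLIME on the good event.
  refine ⟨4 * τ * (2 + 4 * K.CSig / K.cSig + Cβ), τ, hpos, hτ, ?_⟩
  intro q ν cr C1 C2 C3 Cw hq0 hq1 hν _ _ hC1 hC2 hCw M m_om s_om s h est hest
  -- If `C3` is below the required constant, no `π` is admissible: claims about sequences are
  -- vacuous, and the supremum is over the empty set, hence `0`.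
  by_cases hC3 : 4 * τ * (2 + 4 * K.CSig / K.cSig + Cβ) ≤ C3
  swap
  · have hnone : ∀ n π, ¬ IVTest.Admissible (M n) (s n)
        (4 * τ * (2 + 4 * K.CSig / K.cSig + Cβ)) C3 π := by
      intro n π hadm
      refine hC3 (le_trans ?_ hadm.2)
      refine le_mul_of_one_le_right hpos.le ?_
      have := div_nonneg (IVTest.l2norm_nonneg π) (IVTest.l2norm_nonneg (M n).γ)
      linarith
    refine ⟨fun π hadm => absurd (hadm 0) (hnone 0 _), fun α ε _ _ _ => ?_⟩
    simp [hnone]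
  set T : IVTest.Tuning K :=
    ⟨τ, F, Cβ, _, C1, C2, C3, Cw, hτ, hF, hCβ, le_rfl, hC1, hC2, hC3, hCw⟩ with hT
  have hTC : 4 * τ * (2 + 4 * K.CSig / K.cSig + Cβ) = T.Clam := rfl
  rw [hTC]
  obtain ⟨g, hg, hgood⟩ := hdev T rfl rfl rfl hq0 hq1 hν h hest
  have hL := h.tendsto_log_p
  have hsq : Tendsto (fun n => Real.sqrt (Real.log ((M n).p : ℝ))) atTop atTop :=
    Real.tendsto_sqrt_atTop.comp hL
  have htend : ∀ {π : ∀ n, Fin (M n).pz → ℝ},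
      (∀ n, IVTest.Admissible (M n) (s n) T.Clam C3 (π n)) →
      ∀ {R : ∀ n, (M n).S → Prop} {κ : ℝ}, 0 < κ →
      (∀ᶠ n in atTop, ∀ ω, IVTest.Setup T κ (M n) (m_om n) (s n) (π n) ω
        (est n ((M n).data (π n) ω)) → R n ω) →
      Tendsto (fun n => (M n).P {ω | ¬ R n ω}) atTop (𝓝 0) := by
    intro π hadm R κ hκ hR
    refine tendsto_of_tendsto_of_tendsto_of_le_of_le' tendsto_const_nhds hg
      (Eventually.of_forall fun _ => zero_le) ?_
    filter_upwards [hgood κ hκ, hR] with n h1 h2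
    exact h1 (π n) (hadm n) (R n) h2
  refine ⟨fun π hadm => ⟨?_, ?_, ?_⟩, ?_⟩
  · refine ⟨fun n ω => IVTest.QHat ((M n).data (π n) ω) (est n ((M n).data (π n) ω)) -
      (M n).QA (π n) ω - (M n).linTerm (π n) ω, fun n ω => by ring, fun δ hδ => ?_⟩
    obtain ⟨κ, C, hκ, hC, hbd⟩ := IVTest.exists_scaled_bounds.{u} T
    have hη : 0 < min 1 (δ / C) := lt_min one_pos (by positivity)
    have hCη : C * min 1 (δ / C) ≤ δ := by
      calc C * min 1 (δ / C) ≤ C * (δ / C) := mul_le_mul_of_nonneg_left (min_le_right _ _) hC.le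
        _ = δ := by field_simp
    simp only [← not_le]
    refine htend hadm (lt_min hκ (sq_pos_of_pos hη)) (Eventually.of_forall fun n ω hS => ?_)
    have h1 := (hbd _ hη (min_le_left _ _) hS).1
    have h2 := hS.sqrt_mul_log_pos
    rw [← mul_div_assoc, le_div_iff₀ h2, mul_comm]
    refine h1.trans (mul_le_mul_of_nonneg_right hCη ?_)
    positivity
  · intro hπ
    obtain rfl : π = fun n => 0 := funext hπ
    refine ⟨fun δ hδ => ?_, fun α hα hα1 => ?_⟩
    · obtain ⟨κ, hκ, hbd⟩ := IVTest.exists_abs_Qstat_le.{u} T hδ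
      simp only [← not_le, mul_one]
      exact htend hadm hκ (Eventually.of_forall fun n ω hS => hbd hS)
    · obtain ⟨κ1, c, hκ1, hc, hcv⟩ := IVTest.exists_le_cv.{u} T hα hα1
      obtain ⟨κ2, hκ2, hbd⟩ := IVTest.exists_abs_Qstat_le.{u} T hc
      simp only [← not_le]
      refine htend hadm (lt_min hκ1 hκ2) (Eventually.of_forall fun n ω hS => ?_)
      exact (le_of_abs_le (hbd (hS.mono (min_le_right _ _)))).trans
        (hcv (hS.mono (min_le_left _ _)))
  · rintro ⟨a, ha, hπ⟩ c B
    obtain ⟨κ, c', hκ, hc', hbd⟩ := IVTest.exists_le_Qstat.{u} T ha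
    simp only [← not_lt]
    refine htend hadm hκ ?_
    -- With `y = √(log p)`, the threshold `(|c| + 1) / c'` gives `c' y² ≥ (|c| + 1) y`, so the
    -- statistic minus `c y` is at least `y > B`.
    filter_upwards [hπ, hsq.eventually_gt_atTop B, hsq.eventually_ge_atTop ((|c| + 1) / c'),
      hL.eventually_ge_atTop 1] with n hn h1 h2 h3 ω hS
    have h4 := hbd hS hn
    have h5 := Real.sq_sqrt (by linarith : 0 ≤ Real.log ((M n).p : ℝ))
    have h6 := Real.sqrt_nonneg (Real.log ((M n).p : ℝ))
    set y := Real.sqrt (Real.log ((M n).p : ℝ))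
    rw [← h5] at h4
    rw [div_le_iff₀ hc'] at h2
    have h7 := mul_le_mul_of_nonneg_right h2 h6
    have h8 := mul_le_mul_of_nonneg_right (le_abs_self c) h6
    linarith
  · intro α ε hα hα1 hε
    obtain ⟨κ1, C, hκ1, hC, hcv⟩ := IVTest.exists_cv_le.{u} T hα hα1
    obtain ⟨κ2, c, hκ2, hc, hbd⟩ := IVTest.exists_le_Qstat.{u} T hε
    refine tendsto_of_tendsto_of_tendsto_of_le_of_le' tendsto_const_nhds hg
      (Eventually.of_forall fun _ => zero_le) ?_
    -- For `√(log p) > C / c` the lower bound `c log p` of the statistic exceeds the upper bound `C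
    -- √(log p)` of the critical value. The threshold for `n` does not depend on `π`.
    filter_upwards [hgood _ (lt_min hκ1 hκ2), hsq.eventually_gt_atTop (C / c),
      hL.eventually_ge_atTop 1] with n hn h1 h3
    refine iSup₂_le fun π hπ => ?_
    obtain ⟨hHQ, hadm⟩ := hπ
    rw [IVTest.Design.HQ, Set.mem_ofPred_eq] at hHQ
    have hR := hn π hadm (fun ω => IVTest.cv ((M n).data π ω) (est n ((M n).data π ω)) α <
      IVTest.Qstat ((M n).data π ω) (est n ((M n).data π ω))) fun ω hS => ?_
    · simpa only [not_lt] using hR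
    have h2 := hcv (hS.mono (min_le_left _ _))
    have h4 := hbd (hS.mono (min_le_right _ _)) hHQ.1.ge
    have h5 := Real.sq_sqrt (by linarith : 0 ≤ Real.log ((M n).p : ℝ))
    have h6 : 0 < Real.sqrt (Real.log ((M n).p : ℝ)) := Real.sqrt_pos.2 (by linarith)
    set y := Real.sqrt (Real.log ((M n).p : ℝ))
    rw [← h5] at h4
    rw [div_lt_iff₀ hc] at h1
    have h7 := mul_lt_mul_of_pos_right h1 h6
    linarith
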